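/- **Setting.** Let $m\in\mathbb N$, let $|\cdot|$ be the Euclidean norm on $\mathbb C^m$, $\|\cdot\|_2$ the induced operator norm on $\mathbb C^{m\times m}$, and $\mathbb C^m_-=\{u\in\mathbb C^m:\mathrm{Re}\,u_i\le 0,\ i=1,\dots,m\}$. Parameters $(b,\beta,\sigma,K)$ are called *admissible* if 1. $b\in\mathbb R_+^m$, $\sigma\in\mathbb R_+^m$, and $\beta\in\mathbb R^{m\times m}$ satisfies $\beta_{ij}\ge 0$ for $i\ne j$; 2. $K=\mathrm{diag}(K_1,\dots,K_m)$ with $K_i\in L^2_{loc}(\mathbb R_+;\mathbb R)$; 3. there are $\gamma\in(0,2]$ and $C_1>0$ with $\int_0^h|K_i(r)|^2dr\le C_1h^\gamma$, and for each $T>0$ there is $C_2(T)>0$ with $\int_0^T|K_i(r+h)-K_i(r)|^2dr\le C_2(T)h^\gamma$, for all $h\in[0,1]$ and all $i$; 4. for all $i$ and all $h\in[0,1]$ the shifted kernel $t\mapsto K_i(t+h)$ is nonnegative, not identically zero, nonincreasing and continuous on $(0,\infty)$, and it has a resolvent of the first kind $L$ (a measure on $\mathbb R_+$ with $\int_{[0,t)}K_i(t-s+h)L(ds)=1$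 for $t>0$) that is nonnegative and such that $s\mapsto L([s,s+t])$ is nonincreasing on $\mathbb R_+$ for each $t\ge0$. For $u\in\mathbb C^m$ let $R_i(u)=\sum_{j=1}^m\beta_{ji}u_j+\frac{\sigma_i^2}{2}u_i^2$ and $R=(R_1,\dots,R_m)^\top$. Let $R_{\beta^\top}\in L^1_{loc}(\mathbb R_+;\mathbb C^{m\times m})$ be the resolvent of the second kind of $k(t)=-K(t)\beta^\top$, that is, the a.e. unique function with $R_{\beta^\top}*k=k*R_{\beta^\top}=k-R_{\beta^\top}$, where $f*g(t)=\int_0^tf(t-s)g(s)ds$, and let $E_{\beta^\top}=K-R_{\beta^\top}*K$. For $p\ge2$, $\eta\in(0,1)$ and $T>0$ put $$[K]_{\eta,p,T}=\Big(\int_0^Tt^{-\eta p}\|K(t)\|_2^p\,dt+\int_0^T\!\!\int_0^T\frac{\|K(t)-K(s)\|_2^p}{|t-s|^{1+\eta p}}\,ds\,dt\Big)^{1/p},$$ $$\|g\|_{W^{\eta,p}([0,T])}=\Big(\int_0^T|g(t)|^p\,dt+\int_0^T\!\!\int_0^T\frac{|g(t)-g(s)|^p}{|t-s|^{1+\eta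 p}}\,ds\,dt\Big)^{1/p}.$$ Let $\mathcal M_{lf}^-$ be the set of $\mathbb C^m$-valued set functions $\mu$ on $\mathbb R_+$ whose restriction to $[0,T]$ is a finite $\mathbb C^m$-valued measure for each $T>0$ and with $\mathrm{Re}\,\mu\le0$ componentwise. Let $|\mu|$ be the total variation and $K*\mu(t)=\int_{[0,t)}K(t-s)\mu(ds)$, $t\ge 0$. **Theorem.** Let $(b,\beta,\sigma,K)$ be admissible and suppose that there are $p\ge2$ and $\eta\in(0,1)$ with $[K]_{\eta,p,T}<\infty$ for each $T>0$. Then: (a) For each $\mu\in\mathcal M_{lf}^-$ the equation $$\psi(t)=\int_{[0,t)}K(t-s)\mu(ds)+\int_0^tK(t-s)R(\psi(s))\,ds,\qquad t\ge0,$$ has a solution $\psi=\psi(\cdot,\mu)\in L^2_{loc}(\mathbb R_+;\mathbb C^m_-)$, and every solution in $L^2_{loc}(\mathbb R_+;\mathbb C^m)$ agrees with it almost everywhere. (b) For each $T>0$ and $q\in[1,p]$ this solution satisfies $$\|\psi\|_{L^q([0,T])}\le2|\mu|([0,T])\,\|E_{\beta^\top}\|_{L^q([0,T])}+\Big(\sum_{i=1}^m\frac{\sigma_i^2}{2}\Big)|\mu|([0,T])^2\,\|E_{\beta^\top}\|_{L^q([0,T])}\,\|E_{\beta^\top}\|_{L^2([0,T])}^2,$$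 and if $\mathrm{Im}\,\mu=0$, then even $\|\psi\|_{L^q([0,T])}\le|\mu|([0,T])\,\|E_{\beta^\top}\|_{L^q([0,T])}$. Finally, for each $T>0$ we have $\|\psi\|_{W^{\eta,p}([0,T])}<\infty$, and there is a constant $C$, depending only on $m,\beta,\sigma,p,\eta,T$ (in particular independent of $\mu$), such that $$\|\psi\|_{W^{\eta,p}([0,T])}\le\|\psi\|_{L^p([0,T])}+C\,(1+[K]_{\eta,p,T})\big(1+|\mu|([0,T])+\|\psi\|_{L^2([0,T])}^2\big).$$ (c) If $p\ge3$, then $\psi(\cdot,\mu)$, taken as the representative for which the equation holds at every $t\ge0$, is continuous at each $t_0\ge0$ at which $K*\mu$ is continuous. -/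

import Mathlib

open MeasureTheory Set
open scoped ENNReal NNReal

noncomputable section

namespace VolterraRiccati

/-- The space `ℂ^m` with its Euclidean norm. -/
abbrev Cvec (m : ℕ) : Type := EuclideanSpace ℂ (Fin m)

/-- Complex `m × m` matrices, as operators on Euclidean `ℂ^m`; the norm is the operator norm
`‖A‖₂ = sup_{|v| = 1} |A v|` and `*` is matrix multiplication. -/
abbrev Cmat (m : ℕ) : Type := Cvec m →L[ℂ] Cvec m

/-- The operator on `ℂ^m` given by a real matrix. -/
def realMat {m : ℕ} (A : Matrix (Fin m) (Fin m) ℝ) : Cmat m :=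
  Matrix.toEuclideanCLM (n := Fin m) (𝕜 := ℂ) (A.map Complex.ofReal)

/-- The diagonal kernel `K(t) = diag(K₁(t), …, K_m(t))`. -/
def diagKernel {m : ℕ} (K : Fin m → ℝ → ℝ) (t : ℝ) : Cmat m :=
  realMat (Matrix.diagonal fun i => K i t)

/-- `f ∈ L^2_loc(ℝ₊)`: `f` is square integrable on `[0,T]` for every `T > 0`. -/
def MemL2Loc {E : Type*} [NormedAddCommGroup E] (f : ℝ → E) : Prop :=
  ∀ T : ℝ, 0 < T → MemLp f 2 (volume.restrict (Icc 0 T))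

/-- `L` is a nonnegative resolvent of the first kind of the scalar kernel `k`: a nonnegative
locally finite measure on `ℝ₊` with `k ∗ L = 1` on `(0, ∞)`. -/
structure IsNonnegResolventFirstKind (k : ℝ → ℝ) (L : Measure ℝ) : Prop where
  locallyFinite : IsLocallyFiniteMeasure L
  supported : L (Iio 0) = 0
  conv_eq_one : ∀ t : ℝ, 0 < t → ∫ s in Ico 0 t, k (t - s) ∂L = 1

/-- Admissible parameters `(b, β, σ, K)` with `K = diag(K₁, …, K_m)`. -/
structure Admissible {m : ℕ} (b : Fin m → ℝ) (β : Matrix (Fin m) (Fin m) ℝ) (σ : Fin m → ℝ)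
    (K : Fin m → ℝ → ℝ) : Prop where
  b_nonneg : ∀ i, 0 ≤ b i
  β_offdiag_nonneg : ∀ i j, i ≠ j → 0 ≤ β i j
  σ_nonneg : ∀ i, 0 ≤ σ i
  K_memL2Loc : ∀ i, MemL2Loc (K i)
  K_increments : ∃ γ : ℝ, 0 < γ ∧ γ ≤ 2 ∧
    (∃ C₁ : ℝ, 0 < C₁ ∧ ∀ h ∈ Icc (0 : ℝ) 1, ∀ i,
      ∫ r in (0 : ℝ)..h, |K i r| ^ 2 ≤ C₁ * h ^ γ) ∧
    (∀ T : ℝ, 0 < T → ∃ C₂ : ℝ, 0 < C₂ ∧ ∀ h ∈ Icc (0 : ℝ) 1, ∀ i,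
      ∫ r in (0 : ℝ)..T, |K i (r + h) - K i r| ^ 2 ≤ C₂ * h ^ γ)
  K_shift_nonneg : ∀ i, ∀ h ∈ Icc (0 : ℝ) 1, ∀ t : ℝ, 0 < t → 0 ≤ K i (t + h)
  K_shift_ne_zero : ∀ i, ∀ h ∈ Icc (0 : ℝ) 1, ∃ t : ℝ, 0 < t ∧ K i (t + h) ≠ 0
  K_shift_antitone : ∀ i, ∀ h ∈ Icc (0 : ℝ) 1, AntitoneOn (fun t => K i (t + h)) (Ioi 0)
  K_shift_continuous : ∀ i, ∀ h ∈ Icc (0 : ℝ) 1, ContinuousOn (fun t => K i (t + h)) (Ioi 0)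
  K_shift_resolvent : ∀ i, ∀ h ∈ Icc (0 : ℝ) 1, ∃ L : Measure ℝ,
    IsNonnegResolventFirstKind (fun t => K i (t + h)) L ∧
    ∀ t : ℝ, 0 ≤ t → AntitoneOn (fun s => L (Icc s (s + t))) (Ici 0)

/-- `R_i(u) = ⟨u, β^i⟩ + (σ_i² / 2) u_i²`, where `β^i` is the `i`-th column of `β` and
`⟨z, w⟩ = ∑ z_j w_j` (no conjugation). -/
def riccatiR {m : ℕ} (β : Matrix (Fin m) (Fin m) ℝ) (σ : Fin m → ℝ) (u : Cvec m) : Cvec m :=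
  WithLp.toLp 2 fun i => (∑ j, u j * (β j i : ℂ)) + ((σ i ^ 2 / 2 : ℝ) : ℂ) * u i ^ 2

/-- A locally finite `ℂ^m`-valued measure `μ` on `ℝ₊`, given through its restrictions
`μ|_{[0,T]}`, `T ≥ 0`, which are (finite, countably additive) `ℂ^m`-valued measures concentrated
on `[0,T]` and compatible with each other. The value of `μ` at a Borel set `A ⊆ [0,T]` is
`μ.onIcc T A`; as usual there need be no value at unbounded sets. -/
structure LocFinMeasure (m : ℕ) where
  onIcc : ℝ → VectorMeasure ℝ (Cvec m)
  restrict_onIcc : ∀ S T : ℝ, 0 ≤ S → S ≤ T → (onIcc T).restrict (Icc 0 S) = onIcc S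

namespace LocFinMeasure

variable {m : ℕ}

/-- The total variation `|μ|([0,T])` with respect to the Euclidean norm on `ℂ^m`. -/
def totalVar (μ : LocFinMeasure m) (T : ℝ) : ℝ≥0∞ :=
  (μ.onIcc T).variation (Icc 0 T)

/-- The `i`-th component `μ_i` of `μ` on `[0,T]`, a complex measure. -/
def coord (μ : LocFinMeasure m) (T : ℝ) (i : Fin m) : VectorMeasure ℝ ℂ :=
  (μ.onIcc T).mapRange
    (EuclideanSpace.proj (𝕜 := ℂ) i : Cvec m →L[ℂ] ℂ).toLinearMap.toAddMonoidHom
    (EuclideanSpace.proj (𝕜 := ℂ) i : Cvec m →L[ℂ] ℂ).continuous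

theorem coord_apply (μ : LocFinMeasure m) (T : ℝ) (i : Fin m) (A : Set ℝ) :
    μ.coord T i A = μ.onIcc T A i := rfl

/-- `Re μ ≤ 0`, componentwise. -/
def ReNonpos (μ : LocFinMeasure m) : Prop :=
  ∀ T : ℝ, 0 ≤ T → ∀ A : Set ℝ, MeasurableSet A → ∀ i, (μ.onIcc T A i).re ≤ 0

/-- `Im μ = 0`, componentwise. -/
def ImZero (μ : LocFinMeasure m) : Prop :=
  ∀ T : ℝ, 0 ≤ T → ∀ A : Set ℝ, MeasurableSet A → ∀ i, (μ.onIcc T A i).im = 0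

end LocFinMeasure

/-- `(K ∗ μ)(t) = ∫_{[0,t)} K(t-s) μ(ds)` for the diagonal kernel `K = diag(K₁, …, K_m)`. -/
def convMeasure {m : ℕ} (K : Fin m → ℝ → ℝ) (μ : LocFinMeasure m) (t : ℝ) : Cvec m :=
  WithLp.toLp 2 fun i =>
    ((μ.coord t i).restrict (Ico 0 t)).integral (fun s => K i (t - s))
      (ContinuousLinearMap.lsmul ℝ ℝ)

/-- `∫_0^t K(t-s) g(s) ds` for the diagonal kernel `K = diag(K₁, …, K_m)`. -/
def convFun {m : ℕ} (K : Fin m → ℝ → ℝ) (g : ℝ → Cvec m) (t : ℝ) : Cvec m :=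
  WithLp.toLp 2 fun i => ∫ s in (0 : ℝ)..t, (K i (t - s) : ℂ) * g s i

/-- The right-hand side `(K ∗ μ)(t) + (K ∗ R(ψ))(t)` of the Riccati–Volterra equation. -/
def riccatiRHS {m : ℕ} (β : Matrix (Fin m) (Fin m) ℝ) (σ : Fin m → ℝ) (K : Fin m → ℝ → ℝ)
    (μ : LocFinMeasure m) (ψ : ℝ → Cvec m) (t : ℝ) : Cvec m :=
  convMeasure K μ t + convFun K (fun s => riccatiR β σ (ψ s)) t

/-- `ψ ∈ L^2_loc(ℝ₊; ℂ^m_-)` solves `ψ(t) = (K ∗ μ)(t) + (K ∗ R(ψ))(t)`, `t ≥ 0`. The equation is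
required at every `t ≥ 0`, which singles out one representative of the almost everywhere
equivalence class. -/
structure IsRiccatiSolution {m : ℕ} (β : Matrix (Fin m) (Fin m) ℝ) (σ : Fin m → ℝ)
    (K : Fin m → ℝ → ℝ) (μ : LocFinMeasure m) (ψ : ℝ → Cvec m) : Prop where
  memL2Loc : MemL2Loc ψ
  re_nonpos : ∀ᵐ t ∂(volume.restrict (Ici (0 : ℝ))), ∀ i, (ψ t i).re ≤ 0
  eq_rhs : ∀ t : ℝ, 0 ≤ t → ψ t = riccatiRHS β σ K μ ψ t

/-- The convolution `(f ∗ g)(t) = ∫_0^t f(t-s) g(s) ds` of matrix-valued functions. -/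
def convMat {m : ℕ} (f g : ℝ → Cmat m) (t : ℝ) : Cmat m :=
  ∫ s in (0 : ℝ)..t, f (t - s) * g s

/-- `r ∈ L^1_loc` is a resolvent of the second kind of `k`: `r ∗ k = k ∗ r = k - r`. -/
structure IsResolventSecondKind {m : ℕ} (k r : ℝ → Cmat m) : Prop where
  integrable : ∀ T : ℝ, 0 < T → IntegrableOn r (Icc 0 T)
  conv_right : ∀ᵐ t ∂(volume.restrict (Ici (0 : ℝ))), convMat r k t = k t - r t
  conv_left : ∀ᵐ t ∂(volume.restrict (Ici (0 : ℝ))), convMat k r t = k t - r t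

open Classical in
/-- The resolvent `R_B` of the second kind of the kernel `K_B(t) = -K(t) B`. For locally
integrable `K` it exists and is unique up to null sets. -/
def resolventR {m : ℕ} (K : ℝ → Cmat m) (B : Cmat m) : ℝ → Cmat m :=
  if h : ∃ r, IsResolventSecondKind (fun t => -(K t * B)) r then h.choose else 0

/-- `E_B = K - R_B ∗ K`. -/
def kernelE {m : ℕ} (K : ℝ → Cmat m) (B : Cmat m) (t : ℝ) : Cmat m :=
  K t - convMat (resolventR K B) K t

/-- `‖f‖_{L^q([0,T])}`, with values in `[0, ∞]`. -/
def lpNorm {E : Type*} [NormedAddCommGroup E] (f : ℝ → E) (q T : ℝ) : ℝ≥0∞ :=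
  eLpNorm f (ENNReal.ofReal q) (volume.restrict (Icc 0 T))

/-- The double integral `∫_0^T ∫_0^T |f(t) - f(s)|^p / |t - s|^{1 + η p} ds dt`. -/
def gagliardo {E : Type*} [NormedAddCommGroup E] (f : ℝ → E) (η p T : ℝ) : ℝ≥0∞ :=
  ∫⁻ t in Icc 0 T, ∫⁻ s in Icc 0 T, ‖f t - f s‖ₑ ^ p / ENNReal.ofReal (|t - s| ^ (1 + η * p))

/-- The norm `‖g‖_{W^{η,p}([0,T])}`, with values in `[0, ∞]`. -/
def sobolevNorm {E : Type*} [NormedAddCommGroup E] (g : ℝ → E) (η p T : ℝ) : ℝ≥0∞ :=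
  ((∫⁻ t in Icc 0 T, ‖g t‖ₑ ^ p) + gagliardo g η p T) ^ (1 / p)

/-- `[K]_{η,p,T}`, with values in `[0, ∞]`. -/
def kernelBracket {m : ℕ} (K : ℝ → Cmat m) (η p T : ℝ) : ℝ≥0∞ :=
  ((∫⁻ t in Icc 0 T, ENNReal.ofReal (t ^ (-(η * p))) * ‖K t‖ₑ ^ p) + gagliardo K η p T) ^ (1 / p)

end VolterraRiccati

end

/-!
The idea is to compare the Riccati equation `ψ = K ∗ μ + K ∗ R(ψ)` with the linear equation
`u = K ∗ |μ| + K ∗ (βᵀ u)`, whose solution is `u = E ∗ |μ|` (`exists_majorant`).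

The condition on the resolvents of the first kind of the shifted kernels is used in only one way: it
makes each `K_i` completely positive, that is, the resolvent of the second kind of `l K_i` is
nonnegative for every `l > 0`. For a shifted kernel, which is continuous on `[0,∞)`, this follows by
looking at a negative minimum of the resolvent (`resolvent_nonneg`); the shift is then
removed by stability of resolvents in `L¹` (`completelyPositive_of_shift`). Completely positive
kernels have a maximum principle (`ae_nonpos_of_le_resolvent_conv`): rewrite the equation with the
resolvent of `l K_i`, so that the diagonal linear term `B_ii` becomes `l + B_ii`, which is positive
for large `l`, and let `l → ∞`. If a diagonal term `z_i χ_i` with `Re z_i ≤ 0` is added to the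
equation, then `|l + B_ii + z_i| ≤ l + B_ii + O(1/l)`, so that in the limit the modulus of a
solution is dominated by the solution without this term (`norm_le_of_conv_equation`). Since the
quadratic term of the Riccati equation is `(σ_i²/2 ψ_i) ψ_i`, with `Re ψ_i ≤ 0`, one obtains
`|ψ_i| ≤ u_i`, and Young's inequality gives `‖ψ‖_q ≤ |μ|([0,T]) ‖E‖_q`. No reality of `μ` is
needed for this bound; the estimate with the additional quadratic term is weaker.

The same comparison yields existence. Truncate `ψ_i` in the quadratic term at radius `u_i` and
project one of the factors to `Re x ≤ 0`. The nonlinearity is then Lipschitz with an `L²` constant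
in time, so that a fixed point in an exponentially weighted `L¹` space exists
(`exists_volterra_solution`). The quadratic term still has the form `z_i ψ_i` with `Re z_i ≤ 0`,
hence `|ψ_i| ≤ u_i` and the truncation is inactive; a second comparison, for real parts
(`nonneg_of_conv_equation`), shows `Re ψ_i ≤ 0`, so that the projection is inactive too
(`exists_local_solution`). Uniqueness is a Gronwall argument in `L²`.

For the fractional regularity, `ψ = K ∗ π` for the vector measure `π = μ + R(ψ) dt`. By Jensen's
inequality and translation invariance the Gagliardo seminorm of `ψ` on `[0,T]` is at most
`|π|([0,T])` times that of the extension of `K` by zero to `(-∞,T]`; the part of the latter that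
involves the negative half-line is `∫ t^(-ηp) ‖K(t)‖^p dt`, up to the constant `2/(ηp)`
(`gagliardo_conv_le`, `lintegral_gagIntegrand_indicator_le`).

For continuity, `K` and hence `ψ` is in `L³` on bounded intervals, so that `R(ψ)` is in `L^(3/2)`
and `K ∗ R(ψ)` is continuous by Hölder's inequality (`continuousOn_vconv_of_holder`).

Vector measures are handled on each `[0,T]` through a density `v` with respect to a finite measure
`ν` (`IsDensity`), so that all convolutions are Bochner integrals (`vconv`).
-/

noncomputable section

namespace VolterraRiccati

/-! ### Causal convolution against a measure -/

section Lintegral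

/-- The causal convolution `∫_{[0,t)} k(t-s) w(s) ρ(ds)` of `[0, ∞]`-valued functions. -/
def lconv (k w : ℝ → ℝ≥0∞) (ρ : Measure ℝ) (t : ℝ) : ℝ≥0∞ :=
  ∫⁻ s in Ico 0 t, k (t - s) * w s ∂ρ

theorem lconv_eq_indicator (k w : ℝ → ℝ≥0∞) (ρ : Measure ℝ) {t T : ℝ} (ht : t ≤ T) :
    lconv k w ρ t =
      ∫⁻ s, (Ioc 0 T).indicator k (t - s) * (Ico 0 T).indicator w s ∂ρ := by
  rw [lconv, ← lintegral_indicator measurableSet_Ico]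
  congr 1 with s
  by_cases hs : s ∈ Ico 0 t
  · have h1 : t - s ∈ Ioc 0 T := ⟨by linarith [hs.2], by linarith [hs.1]⟩
    have h2 : s ∈ Ico 0 T := ⟨hs.1, hs.2.trans_le ht⟩
    simp [hs, h1, h2]
  · rw [indicator_of_notMem hs]
    by_cases h0 : 0 ≤ s
    · have : t - s ∉ Ioc 0 T := fun h => hs ⟨h0, by linarith [h.1]⟩
      simp [this]
    · have : s ∉ Ico 0 T := fun h => h0 h.1
      simp [this]

theorem quasiMeasurePreserving_sub_prod (ρ : Measure ℝ) [SFinite ρ] :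
    Measure.QuasiMeasurePreserving (fun p : ℝ × ℝ => p.1 - p.2)
      ((volume : Measure ℝ).prod ρ) volume :=
  quasiMeasurePreserving_sub_of_right_invariant volume ρ

theorem aemeasurable_indicator_Ioc {k : ℝ → ℝ≥0∞} {T : ℝ}
    (hk : AEMeasurable k (volume.restrict (Icc 0 T))) :
    AEMeasurable ((Ioc 0 T).indicator k) := by
  rw [aemeasurable_indicator_iff measurableSet_Ioc]
  exact hk.mono_measure (Measure.restrict_mono Ioc_subset_Icc_self le_rfl)

theorem aemeasurable_indicator_Ico {w : ℝ → ℝ≥0∞} {T : ℝ} {ρ : Measure ℝ}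
    (hw : AEMeasurable w (ρ.restrict (Icc 0 T))) :
    AEMeasurable ((Ico 0 T).indicator w) ρ := by
  rw [aemeasurable_indicator_iff measurableSet_Ico]
  exact hw.mono_measure (Measure.restrict_mono Ico_subset_Icc_self le_rfl)

theorem aemeasurable_conv_integrand {k w : ℝ → ℝ≥0∞} {ρ : Measure ℝ} [SFinite ρ]
    (hk : AEMeasurable k) (hw : AEMeasurable w ρ) :
    AEMeasurable (fun p : ℝ × ℝ => k (p.1 - p.2) * w p.2) ((volume : Measure ℝ).prod ρ) :=
  (hk.comp_quasiMeasurePreserving (quasiMeasurePreserving_sub_prod ρ)).mul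
    (hw.comp_quasiMeasurePreserving Measure.quasiMeasurePreserving_snd)

theorem aemeasurable_lconv {k w : ℝ → ℝ≥0∞} {ρ : Measure ℝ} [SFinite ρ] {T : ℝ}
    (hk : AEMeasurable k (volume.restrict (Icc 0 T)))
    (hw : AEMeasurable w (ρ.restrict (Icc 0 T))) :
    AEMeasurable (lconv k w ρ) (volume.restrict (Icc 0 T)) := by
  have := (aemeasurable_conv_integrand (aemeasurable_indicator_Ioc hk)
    (aemeasurable_indicator_Ico hw)).lintegral_prod_right'
  refine (this.mono_measure Measure.restrict_le_self).congr ?_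
  filter_upwards [ae_restrict_mem measurableSet_Icc] with t ht
  exact (lconv_eq_indicator k w ρ ht.2).symm

/-- Tonelli's theorem for a causal convolution tested against `a`. -/
theorem lintegral_mul_lconv_le {a k w : ℝ → ℝ≥0∞} {ρ : Measure ℝ} [SFinite ρ] {T : ℝ}
    {C : ℝ≥0∞} (ha : AEMeasurable a (volume.restrict (Icc 0 T)))
    (hk : AEMeasurable k (volume.restrict (Icc 0 T)))
    (hw : AEMeasurable w (ρ.restrict (Icc 0 T)))
    (hC : ∀ s, ∫⁻ t, (Ioc 0 T).indicator a t * (Ioc 0 T).indicator k (t - s) ≤ C) :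
    ∫⁻ t in Icc 0 T, a t * lconv k w ρ t ≤ C * ∫⁻ s in Icc 0 T, w s ∂ρ := by
  have hA := aemeasurable_indicator_Ioc ha
  have hK := aemeasurable_indicator_Ioc hk
  have hW := aemeasurable_indicator_Ico hw
  have hm := aemeasurable_conv_integrand hK hW
  calc ∫⁻ t in Icc 0 T, a t * lconv k w ρ t
      = ∫⁻ t, (Ioc 0 T).indicator a t *
          ∫⁻ s, (Ioc 0 T).indicator k (t - s) * (Ico 0 T).indicator w s ∂ρ := by
        rw [← Measure.restrict_congr_set Ioc_ae_eq_Icc, ← lintegral_indicator measurableSet_Ioc]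
        congr 1 with t
        by_cases ht : t ∈ Ioc 0 T
        · simp [ht, lconv_eq_indicator k w ρ ht.2]
        · simp [ht]
    _ ≤ ∫⁻ t, ∫⁻ s, (Ioc 0 T).indicator a t *
          ((Ioc 0 T).indicator k (t - s) * (Ico 0 T).indicator w s) ∂ρ := by
        refine lintegral_mono fun t => lintegral_const_mul_le _ _
    _ = ∫⁻ s, (∫⁻ t, (Ioc 0 T).indicator a t *
          ((Ioc 0 T).indicator k (t - s) * (Ico 0 T).indicator w s)) ∂ρ :=
        lintegral_lintegral_swap
          ((hA.comp_quasiMeasurePreserving Measure.quasiMeasurePreserving_fst).mul hm)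
    _ ≤ ∫⁻ s, C * (Ico 0 T).indicator w s ∂ρ := by
        refine lintegral_mono fun s => ?_
        simp_rw [← mul_assoc]
        have h1 : AEMeasurable fun t => (Ioc 0 T).indicator k (t - s) :=
          hK.comp_quasiMeasurePreserving
            (measurePreserving_sub_right volume s).quasiMeasurePreserving
        refine (lintegral_mul_const'' _ (hA.mul h1)).trans_le ?_
        exact mul_le_mul_left (hC s) _
    _ ≤ C * ∫⁻ s in Icc 0 T, w s ∂ρ := by
        rw [lintegral_const_mul'' _ hW, lintegral_indicator measurableSet_Ico]
        exact mul_le_mul_right (lintegral_mono_set Ico_subset_Icc_self) _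

theorem lintegral_indicator_Ioc_eq (k : ℝ → ℝ≥0∞) (T : ℝ) :
    ∫⁻ t, (Ioc 0 T).indicator k t = ∫⁻ t in Icc 0 T, k t := by
  rw [lintegral_indicator measurableSet_Ioc, Measure.restrict_congr_set Ioc_ae_eq_Icc]

/-- Young's inequality in `L¹`. -/
theorem lintegral_lconv_le {k w : ℝ → ℝ≥0∞} {ρ : Measure ℝ} [SFinite ρ] {T : ℝ}
    (hk : AEMeasurable k (volume.restrict (Icc 0 T)))
    (hw : AEMeasurable w (ρ.restrict (Icc 0 T))) :
    ∫⁻ t in Icc 0 T, lconv k w ρ t ≤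
      (∫⁻ t in Icc 0 T, k t) * ∫⁻ s in Icc 0 T, w s ∂ρ := by
  have := lintegral_mul_lconv_le (a := 1) (C := ∫⁻ t in Icc 0 T, k t) aemeasurable_const hk hw ?_
  · simpa using this
  intro s
  calc ∫⁻ t, (Ioc 0 T).indicator 1 t * (Ioc 0 T).indicator k (t - s)
      ≤ ∫⁻ t, (Ioc 0 T).indicator k (t - s) := by
        refine lintegral_mono fun t => ?_
        by_cases h : t ∈ Ioc 0 T <;> simp [h]
    _ = ∫⁻ t, (Ioc 0 T).indicator k t := lintegral_sub_right_eq_self _ s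
    _ = _ := lintegral_indicator_Ioc_eq k T

/-- The Schur-type bound `∫ a (k ∗ w) ≤ ‖a‖_2 ‖k‖_2 ‖w‖_1`. -/
theorem lintegral_mul_lconv_le_L2 {a k w : ℝ → ℝ≥0∞} {ρ : Measure ℝ} [SFinite ρ] {T : ℝ}
    (ha : AEMeasurable a (volume.restrict (Icc 0 T)))
    (hk : AEMeasurable k (volume.restrict (Icc 0 T)))
    (hw : AEMeasurable w (ρ.restrict (Icc 0 T))) :
    ∫⁻ t in Icc 0 T, a t * lconv k w ρ t ≤
      ((∫⁻ t in Icc 0 T, a t ^ (2 : ℝ)) ^ (1 / 2 : ℝ) *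
        (∫⁻ t in Icc 0 T, k t ^ (2 : ℝ)) ^ (1 / 2 : ℝ)) * ∫⁻ s in Icc 0 T, w s ∂ρ := by
  refine lintegral_mul_lconv_le ha hk hw fun s => ?_
  have hK := aemeasurable_indicator_Ioc hk
  have h1 : AEMeasurable fun t => (Ioc 0 T).indicator k (t - s) :=
    hK.comp_quasiMeasurePreserving (measurePreserving_sub_right volume s).quasiMeasurePreserving
  have h2 : ∀ f : ℝ → ℝ≥0∞, ∫⁻ t, (Ioc 0 T).indicator f t ^ (2 : ℝ) =
      ∫⁻ t in Icc 0 T, f t ^ (2 : ℝ) := fun f => by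
    rw [← lintegral_indicator_Ioc_eq]
    congr 1 with t
    by_cases h : t ∈ Ioc 0 T <;> simp [h]
  refine (ENNReal.lintegral_mul_le_Lp_mul_Lq volume Real.HolderConjugate.two_two
    (aemeasurable_indicator_Ioc ha) h1).trans ?_
  rw [h2, lintegral_sub_right_eq_self (fun t => (Ioc 0 T).indicator k t ^ (2 : ℝ)) s, h2]

/-- Jensen's inequality for a power of an integral. -/
theorem lintegral_rpow_le {α : Type*} [MeasurableSpace α] {ρ : Measure α} {f : α → ℝ≥0∞}
    (hf : AEMeasurable f ρ) {q : ℝ} (hq : 1 ≤ q) :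
    (∫⁻ x, f x ∂ρ) ^ q ≤ ρ univ ^ (q - 1) * ∫⁻ x, f x ^ q ∂ρ := by
  have hq0 : 0 < q := by linarith
  have h := eLpNorm_le_eLpNorm_mul_rpow_measure_univ (μ := ρ) (f := f)
    (p := 1) (q := ENNReal.ofReal q) (by simpa using hq) hf.aestronglyMeasurable
  rw [eLpNorm_one_eq_lintegral_enorm, eLpNorm_eq_lintegral_rpow_enorm_toReal (by simpa using hq0)
    (by simp)] at h
  simp only [enorm_eq_self, ENNReal.toReal_ofReal hq0.le, ENNReal.toReal_one] at h
  calc (∫⁻ x, f x ∂ρ) ^ q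
      ≤ ((∫⁻ x, f x ^ q ∂ρ) ^ (1 / q) * ρ univ ^ (1 / 1 - 1 / q)) ^ q := by gcongr
    _ = ρ univ ^ (q - 1) * ∫⁻ x, f x ^ q ∂ρ := by
      rw [ENNReal.mul_rpow_of_nonneg _ _ hq0.le, ← ENNReal.rpow_mul, ← ENNReal.rpow_mul, mul_comm]
      congr 2
      · field_simp
      · rw [one_div_mul_cancel hq0.ne', ENNReal.rpow_one]

/-- Young's inequality `‖k ∗ wρ‖_q ≤ ‖w‖_{L¹(ρ)} ‖k‖_q`. -/
theorem lintegral_lconv_rpow_le {k w : ℝ → ℝ≥0∞} {ρ : Measure ℝ} [SFinite ρ] {T q : ℝ}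
    (hq : 1 ≤ q) (hk : AEMeasurable k (volume.restrict (Icc 0 T)))
    (hw : AEMeasurable w (ρ.restrict (Icc 0 T))) :
    ∫⁻ t in Icc 0 T, lconv k w ρ t ^ q ≤
      (∫⁻ s in Icc 0 T, w s ∂ρ) ^ q * ∫⁻ t in Icc 0 T, k t ^ q := by
  have hK := aemeasurable_indicator_Ioc hk
  have hW := aemeasurable_indicator_Ico hw
  set W := ∫⁻ s in Icc 0 T, w s ∂ρ with hWdef
  have hq0 : 0 ≤ q - 1 := by linarith
  have key : ∀ᵐ t ∂(volume.restrict (Icc 0 T)), lconv k w ρ t ^ q ≤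
      W ^ (q - 1) * lconv (fun u => k u ^ q) w ρ t := by
    have hm : ∀ᵐ t : ℝ, AEMeasurable (fun s => (Ioc 0 T).indicator k (t - s))
        (ρ.withDensity ((Ico 0 T).indicator w)) := by
      have h1 : AEMeasurable (fun p : ℝ × ℝ => (Ioc 0 T).indicator k (p.1 - p.2))
          ((volume : Measure ℝ).prod ρ) :=
        hK.comp_quasiMeasurePreserving (quasiMeasurePreserving_sub_prod ρ)
      obtain ⟨g, hg, hgk⟩ := h1
      filter_upwards [Measure.ae_ae_of_ae_prod hgk] with t ht
      refine AEMeasurable.mono_ac ⟨fun s => g (t, s), hg.comp measurable_prodMk_left, ht⟩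
        (withDensity_absolutelyContinuous _ _)
    filter_upwards [ae_restrict_of_ae hm, ae_restrict_mem measurableSet_Icc] with t hmt ht
    have e1 : ∀ f : ℝ → ℝ≥0∞, AEMeasurable (fun s => f s)
        (ρ.withDensity ((Ico 0 T).indicator w)) →
        ∫⁻ s, f s * (Ico 0 T).indicator w s ∂ρ =
          ∫⁻ s, f s ∂(ρ.withDensity ((Ico 0 T).indicator w)) := by
      intro f hf
      rw [lintegral_withDensity_eq_lintegral_mul₀' hW hf]
      simp [mul_comm]
    rw [lconv_eq_indicator _ _ _ ht.2, lconv_eq_indicator _ _ _ ht.2]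
    have e2 : ∀ s, (Ioc 0 T).indicator (fun u => k u ^ q) (t - s) =
        (Ioc 0 T).indicator k (t - s) ^ q := by
      intro s
      by_cases h : t - s ∈ Ioc 0 T
      · simp [h]
      · simp [h, show (0 : ℝ) < q by linarith]
    simp_rw [e2]
    rw [e1 _ hmt, e1 _ (hmt.pow_const q)]
    refine (lintegral_rpow_le hmt hq).trans ?_
    gcongr
    rw [withDensity_apply _ MeasurableSet.univ, Measure.restrict_univ,
      lintegral_indicator measurableSet_Ico]
    exact lintegral_mono_set Ico_subset_Icc_self
  calc ∫⁻ t in Icc 0 T, lconv k w ρ t ^ q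
      ≤ ∫⁻ t in Icc 0 T, W ^ (q - 1) * lconv (fun u => k u ^ q) w ρ t := lintegral_mono_ae key
    _ = W ^ (q - 1) * ∫⁻ t in Icc 0 T, lconv (fun u => k u ^ q) w ρ t :=
        lintegral_const_mul'' _ (aemeasurable_lconv (hk.pow_const q) hw)
    _ ≤ W ^ (q - 1) * ((∫⁻ t in Icc 0 T, k t ^ q) * W) := by
        gcongr
        exact lintegral_lconv_le (hk.pow_const q) hw
    _ = W ^ q * ∫⁻ t in Icc 0 T, k t ^ q := by
        have : W ^ q = W ^ (q - 1) * W := by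
          conv_lhs => rw [show q = (q - 1) + 1 by ring]
          rw [ENNReal.rpow_add_of_nonneg _ _ hq0 zero_le_one, ENNReal.rpow_one]
        rw [this]; ring

end Lintegral

section Indicator

variable {V : Type*} [NormedAddCommGroup V]

theorem integrable_indicator_Ioc {f : ℝ → V} {T : ℝ} (hf : IntegrableOn f (Icc 0 T)) :
    Integrable ((Ioc 0 T).indicator f) :=
  (hf.mono_set Ioc_subset_Icc_self).integrable_indicator measurableSet_Ioc

theorem integrable_indicator_Ico {h : ℝ → V} {ρ : Measure ℝ} {T : ℝ}
    (hh : IntegrableOn h (Icc 0 T) ρ) : Integrable ((Ico 0 T).indicator h) ρ :=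
  (hh.mono_set Ico_subset_Icc_self).integrable_indicator measurableSet_Ico

theorem aestronglyMeasurable_indicator_Ioc {f : ℝ → V} {T : ℝ}
    (hf : AEStronglyMeasurable f (volume.restrict (Icc 0 T))) :
    AEStronglyMeasurable ((Ioc 0 T).indicator f) := by
  rw [aestronglyMeasurable_indicator_iff measurableSet_Ioc]
  exact hf.mono_measure (Measure.restrict_mono Ioc_subset_Icc_self le_rfl)

theorem aestronglyMeasurable_indicator_Ico {h : ℝ → V} {ρ : Measure ℝ} {T : ℝ}
    (hh : AEStronglyMeasurable h (ρ.restrict (Icc 0 T))) :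
    AEStronglyMeasurable ((Ico 0 T).indicator h) ρ := by
  rw [aestronglyMeasurable_indicator_iff measurableSet_Ico]
  exact hh.mono_measure (Measure.restrict_mono Ico_subset_Icc_self le_rfl)

end Indicator

section Vconv

variable {A A' C V W X : Type*} [NormedAddCommGroup A] [NormedSpace ℝ A]
  [NormedAddCommGroup A'] [NormedSpace ℝ A'] [NormedAddCommGroup C] [NormedSpace ℝ C]
  [NormedAddCommGroup V] [NormedSpace ℝ V] [NormedAddCommGroup W] [NormedSpace ℝ W]
  [NormedAddCommGroup X] [NormedSpace ℝ X]

/-- The causal convolution `∫_{[0,t)} B (f (t-s)) (h s) ρ(ds)` of a kernel `f` with the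
vector-valued measure `h ρ`, formed with the bilinear map `B`. -/
def vconv (B : A →L[ℝ] V →L[ℝ] W) (f : ℝ → A) (h : ℝ → V) (ρ : Measure ℝ) (t : ℝ) : W :=
  ∫ s in Ico 0 t, B (f (t - s)) (h s) ∂ρ

theorem indicator_conv_integrand (B : A →L[ℝ] V →L[ℝ] W) (f : ℝ → A) (h : ℝ → V) {t T : ℝ}
    (ht : t ≤ T) (s : ℝ) :
    (Ico 0 t).indicator (fun s => B (f (t - s)) (h s)) s =
      B ((Ioc 0 T).indicator f (t - s)) ((Ico 0 T).indicator h s) := by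
  by_cases hs : s ∈ Ico 0 t
  · have h1 : t - s ∈ Ioc 0 T := ⟨by linarith [hs.2], by linarith [hs.1]⟩
    have h2 : s ∈ Ico 0 T := ⟨hs.1, hs.2.trans_le ht⟩
    simp [hs, h1, h2]
  · rw [indicator_of_notMem hs]
    by_cases h0 : 0 ≤ s
    · have : t - s ∉ Ioc 0 T := fun h => hs ⟨h0, by linarith [h.1]⟩
      simp [this]
    · have : s ∉ Ico 0 T := fun h => h0 h.1
      simp [this]

theorem vconv_eq_indicator (B : A →L[ℝ] V →L[ℝ] W) (f : ℝ → A) (h : ℝ → V) (ρ : Measure ℝ)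
    {t T : ℝ} (ht : t ≤ T) :
    vconv B f h ρ t = ∫ s, B ((Ioc 0 T).indicator f (t - s)) ((Ico 0 T).indicator h s) ∂ρ := by
  rw [vconv, ← integral_indicator measurableSet_Ico]
  exact integral_congr_ae (.of_forall fun s => indicator_conv_integrand B f h ht s)

theorem integrable_conv_prod (B : A →L[ℝ] V →L[ℝ] W) {f : ℝ → A} {h : ℝ → V} {ρ : Measure ℝ}
    [SFinite ρ] {T : ℝ} (hf : IntegrableOn f (Icc 0 T)) (hh : IntegrableOn h (Icc 0 T) ρ) :
    Integrable (fun p : ℝ × ℝ =>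
      B ((Ioc 0 T).indicator f (p.1 - p.2)) ((Ico 0 T).indicator h p.2)) (volume.prod ρ) :=
  Integrable.convolution_integrand B.flip (integrable_indicator_Ico hh)
    (integrable_indicator_Ioc hf)

theorem ae_integrableOn_conv (B : A →L[ℝ] V →L[ℝ] W) {f : ℝ → A} {h : ℝ → V} {ρ : Measure ℝ}
    [SFinite ρ] {T : ℝ} (hf : IntegrableOn f (Icc 0 T)) (hh : IntegrableOn h (Icc 0 T) ρ) :
    ∀ᵐ t ∂(volume.restrict (Icc 0 T)),
      IntegrableOn (fun s => B (f (t - s)) (h s)) (Ico 0 t) ρ := by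
  filter_upwards [ae_restrict_of_ae (integrable_conv_prod B hf hh).prod_right_ae,
    ae_restrict_mem measurableSet_Icc] with t h1 ht
  rw [← integrable_indicator_iff measurableSet_Ico]
  exact h1.congr (.of_forall fun s => (indicator_conv_integrand B f h ht.2 s).symm)

theorem integrableOn_vconv (B : A →L[ℝ] V →L[ℝ] W) {f : ℝ → A} {h : ℝ → V} {ρ : Measure ℝ}
    [SFinite ρ] {T : ℝ} (hf : IntegrableOn f (Icc 0 T)) (hh : IntegrableOn h (Icc 0 T) ρ) :
    IntegrableOn (vconv B f h ρ) (Icc 0 T) := by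
  refine ((integrable_conv_prod B hf hh).integral_prod_left.integrableOn (s := Icc 0 T)).congr ?_
  filter_upwards [ae_restrict_mem measurableSet_Icc] with t ht
  exact (vconv_eq_indicator B f h ρ ht.2).symm

theorem enorm_vconv_le (B : A →L[ℝ] V →L[ℝ] W) (f : ℝ → A) (h : ℝ → V) (ρ : Measure ℝ) (t : ℝ) :
    ‖vconv B f h ρ t‖ₑ ≤ ‖B‖ₑ * lconv (fun s => ‖f s‖ₑ) (fun s => ‖h s‖ₑ) ρ t := by
  rw [lconv, ← lintegral_const_mul' _ _ enorm_ne_top]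
  refine (enorm_integral_le_lintegral_enorm _).trans (lintegral_mono fun s => ?_)
  rw [← mul_assoc]
  refine (ContinuousLinearMap.le_opENorm _ _).trans ?_
  gcongr
  exact ContinuousLinearMap.le_opENorm _ _

theorem vconv_congr_right (B : A →L[ℝ] V →L[ℝ] W) (f : ℝ → A) {h h' : ℝ → V} {ρ : Measure ℝ}
    {t T : ℝ} (ht : t ≤ T) (hh : h =ᵐ[ρ.restrict (Icc 0 T)] h') :
    vconv B f h ρ t = vconv B f h' ρ t := by
  have h1 : h =ᵐ[ρ.restrict (Ico 0 t)] h' :=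
    ae_mono (Measure.restrict_mono (Ico_subset_Icc_self.trans (Icc_subset_Icc_right ht)) le_rfl) hh
  exact integral_congr_ae (h1.mono fun s hs => by simp only [hs])

theorem vconv_congr_left (B : A →L[ℝ] V →L[ℝ] W) {f f' : ℝ → A} (h : ℝ → V) (ρ : Measure ℝ)
    [SFinite ρ] {T : ℝ} (hf : f =ᵐ[volume.restrict (Icc 0 T)] f') :
    ∀ᵐ t ∂(volume.restrict (Icc 0 T)), vconv B f h ρ t = vconv B f' h ρ t := by
  have h1 : (Ioc 0 T).indicator f =ᵐ[volume] (Ioc 0 T).indicator f' := by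
    have := ae_mono (Measure.restrict_mono Ioc_subset_Icc_self le_rfl) hf
    filter_upwards [(ae_restrict_iff' measurableSet_Ioc).1 this] with s hs
    by_cases h : s ∈ Ioc 0 T
    · simp [h, hs h]
    · simp [h]
  have h2 := Measure.ae_ae_of_ae_prod ((quasiMeasurePreserving_sub_prod ρ).ae h1)
  filter_upwards [ae_restrict_of_ae h2, ae_restrict_mem measurableSet_Icc] with t ht htT
  rw [vconv_eq_indicator B f h ρ htT.2, vconv_eq_indicator B f' h ρ htT.2]
  exact integral_congr_ae (ht.mono fun s hs => by simp only [hs])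

theorem vconv_add_right (B : A →L[ℝ] V →L[ℝ] W) {f : ℝ → A} {h h' : ℝ → V} {ρ : Measure ℝ}
    [SFinite ρ] {T : ℝ} (hf : IntegrableOn f (Icc 0 T)) (hh : IntegrableOn h (Icc 0 T) ρ)
    (hh' : IntegrableOn h' (Icc 0 T) ρ) :
    ∀ᵐ t ∂(volume.restrict (Icc 0 T)),
      vconv B f (fun s => h s + h' s) ρ t = vconv B f h ρ t + vconv B f h' ρ t := by
  filter_upwards [ae_integrableOn_conv B hf hh, ae_integrableOn_conv B hf hh'] with t h1 h2
  simp only [vconv, map_add]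
  exact integral_add h1 h2

theorem vconv_sub_right (B : A →L[ℝ] V →L[ℝ] W) {f : ℝ → A} {h h' : ℝ → V} {ρ : Measure ℝ}
    [SFinite ρ] {T : ℝ} (hf : IntegrableOn f (Icc 0 T)) (hh : IntegrableOn h (Icc 0 T) ρ)
    (hh' : IntegrableOn h' (Icc 0 T) ρ) :
    ∀ᵐ t ∂(volume.restrict (Icc 0 T)),
      vconv B f (fun s => h s - h' s) ρ t = vconv B f h ρ t - vconv B f h' ρ t := by
  filter_upwards [ae_integrableOn_conv B hf hh, ae_integrableOn_conv B hf hh'] with t h1 h2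
  simp only [vconv, map_sub]
  exact integral_sub h1 h2

theorem vconv_add_left (B : A →L[ℝ] V →L[ℝ] W) {f f' : ℝ → A} {h : ℝ → V} {ρ : Measure ℝ}
    [SFinite ρ] {T : ℝ} (hf : IntegrableOn f (Icc 0 T)) (hf' : IntegrableOn f' (Icc 0 T))
    (hh : IntegrableOn h (Icc 0 T) ρ) :
    ∀ᵐ t ∂(volume.restrict (Icc 0 T)),
      vconv B (fun s => f s + f' s) h ρ t = vconv B f h ρ t + vconv B f' h ρ t := by
  filter_upwards [ae_integrableOn_conv B hf hh, ae_integrableOn_conv B hf' hh] with t h1 h2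
  simp only [vconv, map_add, add_apply]
  exact integral_add h1 h2

theorem vconv_sub_left (B : A →L[ℝ] V →L[ℝ] W) {f f' : ℝ → A} {h : ℝ → V} {ρ : Measure ℝ}
    [SFinite ρ] {T : ℝ} (hf : IntegrableOn f (Icc 0 T)) (hf' : IntegrableOn f' (Icc 0 T))
    (hh : IntegrableOn h (Icc 0 T) ρ) :
    ∀ᵐ t ∂(volume.restrict (Icc 0 T)),
      vconv B (fun s => f s - f' s) h ρ t = vconv B f h ρ t - vconv B f' h ρ t := by
  filter_upwards [ae_integrableOn_conv B hf hh, ae_integrableOn_conv B hf' hh] with t h1 h2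
  simp only [vconv, map_sub, sub_apply]
  exact integral_sub h1 h2

theorem vconv_smul_right (B : A →L[ℝ] V →L[ℝ] W) (f : ℝ → A) (h : ℝ → V) (ρ : Measure ℝ)
    (c t : ℝ) : vconv B f (fun s => c • h s) ρ t = c • vconv B f h ρ t := by
  simp only [vconv, map_smul]
  exact integral_smul c _

theorem vconv_smul_left (B : A →L[ℝ] V →L[ℝ] W) (f : ℝ → A) (h : ℝ → V) (ρ : Measure ℝ)
    (c t : ℝ) : vconv B (fun s => c • f s) h ρ t = c • vconv B f h ρ t := by
  simp only [vconv, map_smul, smul_apply]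
  exact integral_smul c _

/-- Associativity of causal convolutions at a point where everything converges absolutely. -/
theorem vconv_assoc_of_lt_top [CompleteSpace C] [CompleteSpace W] [CompleteSpace X]
    (B₁ : A →L[ℝ] W →L[ℝ] X) (B₂ : A' →L[ℝ] V →L[ℝ] W)
    (M : A →L[ℝ] A' →L[ℝ] C) (B₃ : C →L[ℝ] V →L[ℝ] X)
    (hB : ∀ a b v, B₁ a (B₂ b v) = B₃ (M a b) v) {f : ℝ → A} {g : ℝ → A'} {h : ℝ → V}
    {ρ : Measure ℝ} [SFinite ρ] {t T : ℝ} (ht : t ≤ T)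
    (hf : AEStronglyMeasurable f (volume.restrict (Icc 0 T)))
    (hg : AEStronglyMeasurable g (volume.restrict (Icc 0 T)))
    (hh : AEStronglyMeasurable h (ρ.restrict (Icc 0 T)))
    (hfin : lconv (fun s => ‖f s‖ₑ) (lconv (fun s => ‖g s‖ₑ) (fun s => ‖h s‖ₑ) ρ) volume t < ⊤) :
    vconv B₁ f (vconv B₂ g h ρ) volume t = vconv B₃ (vconv M f g volume) h ρ t := by
  set F := (Ioc 0 T).indicator f with hF
  set G := (Ioc 0 T).indicator g with hG
  set H := (Ico 0 T).indicator h with hH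
  have mF : AEStronglyMeasurable F := aestronglyMeasurable_indicator_Ioc hf
  have mG : AEStronglyMeasurable G := aestronglyMeasurable_indicator_Ioc hg
  have mH : AEStronglyMeasurable H ρ := aestronglyMeasurable_indicator_Ico hh
  have mFt : AEStronglyMeasurable (fun s => F (t - s)) :=
    mF.comp_quasiMeasurePreserving (quasiMeasurePreserving_sub_left volume t)
  have mGp : AEStronglyMeasurable (fun p : ℝ × ℝ => G (p.1 - p.2)) (volume.prod ρ) :=
    mG.comp_quasiMeasurePreserving (quasiMeasurePreserving_sub_prod ρ)
  have mHp : AEStronglyMeasurable (fun p : ℝ × ℝ => H p.2) (volume.prod ρ) :=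
    mH.comp_quasiMeasurePreserving Measure.quasiMeasurePreserving_snd
  have mFp : AEStronglyMeasurable (fun p : ℝ × ℝ => F (t - p.1)) (volume.prod ρ) :=
    mFt.comp_quasiMeasurePreserving Measure.quasiMeasurePreserving_fst
  -- the inner convolution, with all functions extended by zero
  set Φ : ℝ → ℝ≥0∞ := fun s => ∫⁻ r, ‖G (s - r)‖ₑ * ‖H r‖ₑ ∂ρ with hΦ
  have mΦ : AEMeasurable Φ := (mGp.enorm.mul mHp.enorm).lintegral_prod_right'
  have hΦ0 : ∀ s, s < 0 → ∀ r, G (s - r) = 0 ∨ H r = 0 := by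
    intro s hs r
    by_cases hr : 0 ≤ r
    · left
      exact indicator_of_notMem (fun h => by linarith [h.1]) _
    · right
      exact indicator_of_notMem (fun h => hr h.1) _
  have hlt : ∀ s, F (t - s) = 0 ∨ s < t := by
    intro s
    by_cases hs : s < t
    · exact Or.inr hs
    · exact Or.inl (indicator_of_notMem (fun h => by linarith [h.1]) _)
  have hfin' : ∫⁻ s, ‖F (t - s)‖ₑ * Φ s < ⊤ := by
    rw [lconv_eq_indicator _ _ _ ht] at hfin
    refine lt_of_eq_of_lt (lintegral_congr fun s => ?_) hfin
    rw [← enorm_indicator_eq_indicator_enorm]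
    rcases hlt s with h0 | hst
    · rw [← hF, h0]; simp
    by_cases hs : 0 ≤ s
    · congr 1
      rw [indicator_of_mem (show s ∈ Ico 0 T from ⟨hs, hst.trans_le ht⟩),
        lconv_eq_indicator _ _ _ (hst.le.trans ht)]
      simp only [← enorm_indicator_eq_indicator_enorm, hΦ, hG, hH]
    · rw [indicator_of_notMem (show s ∉ Ico 0 T from fun h => hs h.1)]
      have : Φ s = 0 := by
        simp only [hΦ]
        refine (lintegral_congr fun r => ?_).trans lintegral_zero
        rcases hΦ0 s (not_le.1 hs) r with h | h <;> simp [h]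
      simp [this]
  -- absolute integrability of the triple product
  have hint : Integrable (fun p : ℝ × ℝ => B₁ (F (t - p.1)) (B₂ (G (p.1 - p.2)) (H p.2)))
      (volume.prod ρ) := by
    refine ⟨B₁.aestronglyMeasurable_comp₂ mFp (B₂.aestronglyMeasurable_comp₂ mGp mHp), ?_⟩
    have hle : ∀ p : ℝ × ℝ, ‖B₁ (F (t - p.1)) (B₂ (G (p.1 - p.2)) (H p.2))‖ₑ ≤
        (‖B₁‖ₑ * ‖B₂‖ₑ) * (‖F (t - p.1)‖ₑ * (‖G (p.1 - p.2)‖ₑ * ‖H p.2‖ₑ)) := by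
      intro p
      calc _ ≤ ‖B₁‖ₑ * ‖F (t - p.1)‖ₑ * (‖B₂‖ₑ * ‖G (p.1 - p.2)‖ₑ * ‖H p.2‖ₑ) := by
            refine (ContinuousLinearMap.le_opENorm _ _).trans ?_
            gcongr
            · exact ContinuousLinearMap.le_opENorm _ _
            · refine (ContinuousLinearMap.le_opENorm _ _).trans ?_
              gcongr
              exact ContinuousLinearMap.le_opENorm _ _
        _ = _ := by ring
    refine (lintegral_mono hle).trans_lt ?_
    refine (lintegral_const_mul'' _ (mFp.enorm.mul (mGp.enorm.mul mHp.enorm))).trans_lt ?_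
    refine ENNReal.mul_lt_top (ENNReal.mul_lt_top enorm_lt_top enorm_lt_top) ?_
    refine (lintegral_prod _ (mFp.enorm.mul (mGp.enorm.mul mHp.enorm))).trans_lt ?_
    simp only [Pi.mul_apply]
    simp_rw [lintegral_const_mul' _ _ (enorm_ne_top (x := F _))]
    exact hfin'
  have hfinT : ∫⁻ r, (∫⁻ s, ‖F (t - s)‖ₑ * ‖G (s - r)‖ₑ) * ‖H r‖ₑ ∂ρ < ⊤ := by
    have e := lintegral_lintegral_swap (μ := volume) (ν := ρ)
      (f := fun s r => ‖F (t - s)‖ₑ * (‖G (s - r)‖ₑ * ‖H r‖ₑ))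
      (mFp.enorm.mul (mGp.enorm.mul mHp.enorm))
    simp_rw [lintegral_const_mul' _ _ (enorm_ne_top (x := F _))] at e
    rw [e] at hfin'
    refine lt_of_eq_of_lt (lintegral_congr fun r => ?_) hfin'
    rw [← lintegral_mul_const' _ _ enorm_ne_top]
    simp_rw [mul_assoc]
  have mGr : ∀ r, AEStronglyMeasurable (fun s => G (s - r)) := fun r =>
    mG.comp_quasiMeasurePreserving (measurePreserving_sub_right volume r).quasiMeasurePreserving
  calc vconv B₁ f (vconv B₂ g h ρ) volume t
      = ∫ s, B₁ (F (t - s)) ((Ico 0 T).indicator (vconv B₂ g h ρ) s) :=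
        vconv_eq_indicator _ _ _ _ ht
    _ = ∫ s, (∫ r, B₁ (F (t - s)) (B₂ (G (s - r)) (H r)) ∂ρ) := by
        refine integral_congr_ae ?_
        have hae : ∀ᵐ s : ℝ, ‖F (t - s)‖ₑ * Φ s < ⊤ :=
          ae_lt_top' (mFt.enorm.mul mΦ) hfin'.ne
        have hmeas : ∀ᵐ s : ℝ, AEStronglyMeasurable (fun r => B₂ (G (s - r)) (H r)) ρ :=
          (B₂.aestronglyMeasurable_comp₂ mGp mHp).prodMk_left
        filter_upwards [hae, hmeas] with s hs hms
        rcases hlt s with h0 | hst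
        · simp [h0]
        by_cases hs0 : 0 ≤ s
        · rw [indicator_of_mem (show s ∈ Ico 0 T from ⟨hs0, hst.trans_le ht⟩),
            vconv_eq_indicator _ _ _ _ (hst.le.trans ht)]
          by_cases hz : F (t - s) = 0
          · simp [hz]
          have hΦs : Φ s < ⊤ := by
            by_contra hcon
            rw [not_lt, top_le_iff] at hcon
            rw [hcon, ENNReal.mul_top (by simpa using hz)] at hs
            exact lt_irrefl _ hs
          have hi : Integrable (fun r => B₂ (G (s - r)) (H r)) ρ := by
            refine ⟨hms, ?_⟩
            have : ∀ r, ‖B₂ (G (s - r)) (H r)‖ₑ ≤ ‖B₂‖ₑ * (‖G (s - r)‖ₑ * ‖H r‖ₑ) := by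
              intro r
              rw [← mul_assoc]
              refine (ContinuousLinearMap.le_opENorm _ _).trans ?_
              gcongr
              exact ContinuousLinearMap.le_opENorm _ _
            refine (lintegral_mono this).trans_lt ?_
            rw [lintegral_const_mul' _ _ enorm_ne_top]
            exact ENNReal.mul_lt_top enorm_lt_top hΦs
          exact ((B₁ (F (t - s))).integral_comp_comm hi).symm
        · rw [indicator_of_notMem (show s ∉ Ico 0 T from fun h => hs0 h.1)]
          rw [map_zero]
          symm
          refine (integral_congr_ae (.of_forall fun r => ?_)).trans (integral_zero _ _)
          rcases hΦ0 s (not_le.1 hs0) r with h | h <;> simp [h]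
    _ = ∫ r, (∫ s, B₁ (F (t - s)) (B₂ (G (s - r)) (H r))) ∂ρ := integral_integral_swap hint
    _ = ∫ r, B₃ ((Ioc 0 T).indicator (vconv M f g volume) (t - r)) (H r) ∂ρ := by
        refine integral_congr_ae ?_
        have hae : ∀ᵐ r ∂ρ, (∫⁻ s, ‖F (t - s)‖ₑ * ‖G (s - r)‖ₑ) * ‖H r‖ₑ < ⊤ := by
          refine ae_lt_top' ?_ hfinT.ne
          have := (mFp.enorm.mul mGp.enorm).prod_swap.lintegral_prod_right'
          exact this.mul mH.enorm
        filter_upwards [hae] with r hr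
        by_cases hz : H r = 0
        · simp [hz]
        have hr0 : r ∈ Ico 0 T := by
          by_contra hcon
          exact hz (indicator_of_notMem hcon _)
        have hfin2 : ∫⁻ s, ‖F (t - s)‖ₑ * ‖G (s - r)‖ₑ < ⊤ := by
          by_contra hcon
          rw [not_lt, top_le_iff] at hcon
          rw [hcon, ENNReal.top_mul (by simpa using hz)] at hr
          exact lt_irrefl _ hr
        have hi : Integrable (fun s => M (F (t - s)) (G (s - r))) := by
          refine ⟨M.aestronglyMeasurable_comp₂ mFt (mGr r), ?_⟩
          have : ∀ s, ‖M (F (t - s)) (G (s - r))‖ₑ ≤ ‖M‖ₑ * (‖F (t - s)‖ₑ * ‖G (s - r)‖ₑ) := by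
            intro s
            rw [← mul_assoc]
            refine (ContinuousLinearMap.le_opENorm _ _).trans ?_
            gcongr
            exact ContinuousLinearMap.le_opENorm _ _
          refine (lintegral_mono this).trans_lt ?_
          rw [lintegral_const_mul' _ _ enorm_ne_top]
          exact ENNReal.mul_lt_top enorm_lt_top hfin2
        have e1 : ∫ s, B₁ (F (t - s)) (B₂ (G (s - r)) (H r)) =
            B₃ (∫ s, M (F (t - s)) (G (s - r))) (H r) := by
          have := ((B₃.flip (H r)).integral_comp_comm hi)
          simp only [ContinuousLinearMap.flip_apply] at this
          rw [← this]
          simp_rw [hB]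
        rw [e1]
        congr 2
        by_cases hrt : r < t
        · rw [indicator_of_mem (show t - r ∈ Ioc 0 T from ⟨by linarith, by linarith [hr0.1]⟩),
            vconv_eq_indicator _ _ _ _ (show t - r ≤ T by linarith [hr0.1]),
            ← integral_sub_right_eq_self (fun u =>
              M ((Ioc 0 T).indicator f (t - r - u)) ((Ico 0 T).indicator g u)) r]
          refine integral_congr_ae ?_
          have : ∀ᵐ s : ℝ, s ≠ r ∧ s ≠ T + r := by
            have h1 : ∀ x : ℝ, ∀ᵐ s : ℝ, s ≠ x := fun x => by
              simp [ae_iff, measure_singleton]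
            exact (h1 r).and (h1 (T + r))
          filter_upwards [this] with s hs
          have e2 : t - r - (s - r) = t - s := by ring
          rw [e2]
          congr 1
          by_cases hsr : s - r ∈ Ioc 0 T
          · rw [hG, indicator_of_mem hsr, indicator_of_mem]
            refine ⟨hsr.1.le, lt_of_le_of_ne hsr.2 fun h => hs.2 (by linarith)⟩
          · rw [hG, indicator_of_notMem hsr, indicator_of_notMem]
            intro hcon
            exact hsr ⟨lt_of_le_of_ne hcon.1 fun h => hs.1 (by linarith), hcon.2.le⟩
        · rw [indicator_of_notMem (fun h => hrt (by linarith [h.1]))]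
          refine (integral_congr_ae (.of_forall fun s => ?_)).trans (integral_zero _ _)
          rcases hlt s with h | h
          · simp [h]
          · have : G (s - r) = 0 := indicator_of_notMem (fun h' => by linarith [h'.1]) _
            simp [this]
    _ = vconv B₃ (vconv M f g volume) h ρ t := (vconv_eq_indicator _ _ _ _ ht).symm

/-- Associativity of causal convolutions of integrable kernels, almost everywhere. -/
theorem vconv_assoc [CompleteSpace C] [CompleteSpace W] [CompleteSpace X]
    (B₁ : A →L[ℝ] W →L[ℝ] X) (B₂ : A' →L[ℝ] V →L[ℝ] W)
    (M : A →L[ℝ] A' →L[ℝ] C) (B₃ : C →L[ℝ] V →L[ℝ] X)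
    (hB : ∀ a b v, B₁ a (B₂ b v) = B₃ (M a b) v) {f : ℝ → A} {g : ℝ → A'} {h : ℝ → V}
    {ρ : Measure ℝ} [SFinite ρ] {T : ℝ} (hf : IntegrableOn f (Icc 0 T))
    (hg : IntegrableOn g (Icc 0 T)) (hh : IntegrableOn h (Icc 0 T) ρ) :
    ∀ᵐ t ∂(volume.restrict (Icc 0 T)),
      vconv B₁ f (vconv B₂ g h ρ) volume t = vconv B₃ (vconv M f g volume) h ρ t := by
  have hm := aemeasurable_lconv hg.aestronglyMeasurable.enorm hh.aestronglyMeasurable.enorm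
  have hfin : ∫⁻ t in Icc 0 T,
      lconv (fun s => ‖f s‖ₑ) (lconv (fun s => ‖g s‖ₑ) (fun s => ‖h s‖ₑ) ρ) volume t < ⊤ := by
    refine (lintegral_lconv_le hf.aestronglyMeasurable.enorm hm).trans_lt
      (ENNReal.mul_lt_top hf.2 ?_)
    exact (lintegral_lconv_le hg.aestronglyMeasurable.enorm
      hh.aestronglyMeasurable.enorm).trans_lt (ENNReal.mul_lt_top hg.2 hh.2)
  filter_upwards [ae_lt_top' (aemeasurable_lconv hf.aestronglyMeasurable.enorm hm) hfin.ne,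
    ae_restrict_mem measurableSet_Icc] with t h1 ht
  exact vconv_assoc_of_lt_top B₁ B₂ M B₃ hB ht.2 hf.aestronglyMeasurable hg.aestronglyMeasurable
    hh.aestronglyMeasurable h1

end Vconv

/-! ### Exponential weights, Gronwall's inequality and fixed points -/

/-- The weight `e^{-n t}`, with values in `[0, ∞]`. -/
def expWeight (n : ℕ) (t : ℝ) : ℝ≥0∞ := ENNReal.ofReal (Real.exp (-(n * t)))

theorem measurable_expWeight (n : ℕ) : Measurable (expWeight n) := by
  unfold expWeight; fun_prop

theorem expWeight_ne_top (n : ℕ) (t : ℝ) : expWeight n t ≠ ⊤ := ENNReal.ofReal_ne_top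

theorem expWeight_ne_zero (n : ℕ) (t : ℝ) : expWeight n t ≠ 0 := by
  simp [expWeight, Real.exp_pos]

theorem expWeight_le_one (n : ℕ) {t : ℝ} (ht : 0 ≤ t) : expWeight n t ≤ 1 := by
  rw [expWeight, ENNReal.ofReal_le_one, Real.exp_le_one_iff]
  have : 0 ≤ (n : ℝ) * t := by positivity
  linarith

theorem expWeight_mul (n : ℕ) (t s : ℝ) :
    expWeight n (t - s) * expWeight n s = expWeight n t := by
  rw [expWeight, expWeight, expWeight, ← ENNReal.ofReal_mul (Real.exp_pos _).le, ← Real.exp_add]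
  congr 2; ring

/-- Exponential weights pass through causal convolutions. -/
theorem expWeight_mul_lconv (n : ℕ) (k w : ℝ → ℝ≥0∞) (ρ : Measure ℝ) (t : ℝ) :
    expWeight n t * lconv k w ρ t =
      lconv (fun s => expWeight n s * k s) (fun s => expWeight n s * w s) ρ t := by
  rw [lconv, lconv, ← lintegral_const_mul' _ _ (expWeight_ne_top n t)]
  refine lintegral_congr fun s => ?_
  rw [← expWeight_mul n t s]; ring

/-- A weighted `L^q` norm on `[0,T]` becomes arbitrarily small for a large exponential weight. -/
theorem tendsto_lintegral_expWeight {k : ℝ → ℝ≥0∞} {T q : ℝ} (hq : 1 ≤ q)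
    (hk : AEMeasurable k (volume.restrict (Icc 0 T))) (hfin : ∫⁻ t in Icc 0 T, k t ^ q ≠ ⊤) :
    Filter.Tendsto (fun n : ℕ => ∫⁻ t in Icc 0 T, (expWeight n t * k t) ^ q)
      Filter.atTop (nhds 0) := by
  have hq0 : 0 < q := by linarith
  have h0 : (0 : ℝ≥0∞) = ∫⁻ t in Icc 0 T, (0 : ℝ≥0∞) := by simp
  rw [h0]
  refine tendsto_lintegral_of_dominated_convergence' (fun t => k t ^ q)
    (fun n => ((measurable_expWeight n).aemeasurable.mul hk).pow_const q) (fun n => ?_) hfin ?_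
  · filter_upwards [ae_restrict_mem measurableSet_Icc] with t ht
    exact ENNReal.rpow_le_rpow (mul_le_of_le_one_left' (expWeight_le_one n ht.1)) hq0.le
  · have hne : ∀ᵐ t ∂(volume.restrict (Icc 0 T)), t ≠ (0 : ℝ) := by
      refine ae_restrict_of_ae ?_
      simp [ae_iff, measure_singleton]
    filter_upwards [ae_restrict_mem measurableSet_Icc, hne,
      ae_lt_top' (hk.pow_const q) hfin] with t ht hne hlt
    have ht0 : 0 < t := lt_of_le_of_ne ht.1 (Ne.symm hne)
    have hkt : k t ≠ ⊤ := by
      intro h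
      rw [h, ENNReal.top_rpow_of_pos hq0] at hlt
      exact lt_irrefl _ hlt
    have h1 : Filter.Tendsto (fun n : ℕ => expWeight n t) Filter.atTop (nhds 0) := by
      have : Filter.Tendsto (fun n : ℕ => Real.exp (-((n : ℝ) * t))) Filter.atTop (nhds 0) :=
        Real.tendsto_exp_neg_atTop_nhds_zero.comp
          (tendsto_natCast_atTop_atTop.atTop_mul_const ht0)
      have h := (ENNReal.continuous_ofReal.tendsto 0).comp this
      rw [ENNReal.ofReal_zero] at h
      exact h
    have h2 : Filter.Tendsto (fun n : ℕ => expWeight n t * k t) Filter.atTop (nhds (0 * k t)) :=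
      ENNReal.Tendsto.mul_const h1 (Or.inr hkt)
    have h3 := (ENNReal.continuous_rpow_const (y := q)).tendsto (0 * k t) |>.comp h2
    rw [zero_mul, ENNReal.zero_rpow_of_pos hq0] at h3
    exact h3

/-- A Gronwall inequality for convolution inequalities with square integrable data: if
`y ≤ k ∗ (c y + e_n)` with `e_n → 0` in `L¹`, then `y = 0`. -/
theorem ae_eq_zero_of_le_lconv {k c y : ℝ → ℝ≥0∞} {e : ℕ → ℝ → ℝ≥0∞} {T : ℝ}
    (hk : AEMeasurable k (volume.restrict (Icc 0 T)))
    (hk2 : ∫⁻ t in Icc 0 T, k t ^ (2 : ℝ) ≠ ⊤)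
    (hc : AEMeasurable c (volume.restrict (Icc 0 T)))
    (hc2 : ∫⁻ t in Icc 0 T, c t ^ (2 : ℝ) ≠ ⊤) (hc1 : ∀ t, 1 ≤ c t)
    (hy : AEMeasurable y (volume.restrict (Icc 0 T)))
    (hcy : ∫⁻ t in Icc 0 T, c t * y t ≠ ⊤)
    (he : ∀ n, AEMeasurable (e n) (volume.restrict (Icc 0 T)))
    (he0 : Filter.Tendsto (fun n => ∫⁻ t in Icc 0 T, e n t) Filter.atTop (nhds 0))
    (h : ∀ n, ∀ᵐ t ∂(volume.restrict (Icc 0 T)),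
      y t ≤ lconv k (fun s => c s * y s + e n s) volume t) :
    ∀ᵐ t ∂(volume.restrict (Icc 0 T)), y t = 0 := by
  set D := (∫⁻ t in Icc 0 T, c t ^ (2 : ℝ)) ^ (1 / 2 : ℝ) with hD
  have hDtop : D ≠ ⊤ := ENNReal.rpow_ne_top_of_nonneg (by norm_num) hc2
  -- a weight for which the convolution operator has norm at most `1/2`
  obtain ⟨N, hN⟩ : ∃ N : ℕ,
      D * (∫⁻ t in Icc 0 T, (expWeight N t * k t) ^ (2 : ℝ)) ^ (1 / 2 : ℝ) ≤ 1 / 2 := by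
    have h1 := tendsto_lintegral_expWeight (by norm_num) hk hk2
    have h2 := (ENNReal.continuous_rpow_const (y := (1 / 2 : ℝ))).tendsto 0 |>.comp h1
    have h3 := ENNReal.Tendsto.const_mul (a := D) h2 (Or.inr hDtop)
    have h4 : D * (0 : ℝ≥0∞) ^ (1 / 2 : ℝ) = 0 := by
      rw [ENNReal.zero_rpow_of_pos (by norm_num), mul_zero]
    rw [h4] at h3
    exact (h3.eventually_le_const (by simp)).exists
  set Y := ∫⁻ t in Icc 0 T, expWeight N t * (c t * y t) with hY
  have hYtop : Y ≠ ⊤ := by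
    refine ne_top_of_le_ne_top hcy (lintegral_mono_ae ?_)
    filter_upwards [ae_restrict_mem measurableSet_Icc] with t ht
    exact mul_le_of_le_one_left' (expWeight_le_one N ht.1)
  have hmw := (measurable_expWeight N).aemeasurable (μ := volume.restrict (Icc 0 T))
  have mwcy : AEMeasurable (fun t => expWeight N t * (c t * y t))
      (volume.restrict (Icc 0 T)) := hmw.mul (hc.mul hy)
  have mwk : AEMeasurable (fun t => expWeight N t * k t) (volume.restrict (Icc 0 T)) :=
    hmw.mul hk
  have hstep : ∀ n, Y ≤ 1 / 2 * (Y + ∫⁻ t in Icc 0 T, e n t) := by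
    intro n
    calc Y ≤ ∫⁻ t in Icc 0 T, c t * lconv (fun s => expWeight N s * k s)
          (fun s => expWeight N s * (c s * y s + e n s)) volume t := by
          refine lintegral_mono_ae ((h n).mono fun t ht => ?_)
          rw [← expWeight_mul_lconv, mul_left_comm]
          gcongr
      _ ≤ 1 / 2 * ∫⁻ t in Icc 0 T, expWeight N t * (c t * y t + e n t) := by
          have mw : AEMeasurable (fun s => expWeight N s * (c s * y s + e n s))
              (volume.restrict (Icc 0 T)) := hmw.mul ((hc.mul hy).add (he n))
          refine (lintegral_mul_lconv_le_L2 hc mwk mw).trans ?_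
          gcongr
      _ ≤ 1 / 2 * (Y + ∫⁻ t in Icc 0 T, e n t) := by
          gcongr
          rw [hY, ← lintegral_add_left' mwcy]
          refine lintegral_mono_ae ?_
          filter_upwards [ae_restrict_mem measurableSet_Icc] with t ht
          rw [mul_add]
          gcongr
          exact mul_le_of_le_one_left' (expWeight_le_one N ht.1)
  have hlim : Y ≤ 1 / 2 * (Y + 0) :=
    ge_of_tendsto' (ENNReal.Tendsto.const_mul (tendsto_const_nhds.add he0)
      (Or.inr (by simp))) hstep
  have hY0 : Y = 0 := by
    by_contra hne
    have : (1 / 2 : ℝ≥0∞) * (Y + 0) < Y := by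
      rw [add_zero, mul_comm, one_div, ← div_eq_mul_inv]
      exact ENNReal.half_lt_self hne hYtop
    exact absurd hlim (not_le.2 this)
  rw [hY, lintegral_eq_zero_iff' mwcy] at hY0
  filter_upwards [hY0] with t ht
  simp only [Pi.zero_apply, mul_eq_zero] at ht
  rcases ht with h1 | h1 | h1
  · exact absurd h1 (expWeight_ne_zero N t)
  · exact absurd (h1 ▸ hc1 t) (by simp)
  · exact h1

/-- A map on `L¹([0,T])` that is a contraction for an exponentially weighted norm has a fixed
point. -/
theorem exists_fixedPoint_of_weighted_contraction {V : Type*} [NormedAddCommGroup V]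
    [CompleteSpace V] {T : ℝ} (N : ℕ) (Φ : (ℝ → V) → ℝ → V)
    (hΦ : ∀ Z, IntegrableOn Z (Icc 0 T) → IntegrableOn (Φ Z) (Icc 0 T))
    (hc : ∀ Z Z', IntegrableOn Z (Icc 0 T) → IntegrableOn Z' (Icc 0 T) →
      ∫⁻ t in Icc 0 T, expWeight N t * ‖Φ Z t - Φ Z' t‖ₑ ≤
        1 / 2 * ∫⁻ t in Icc 0 T, expWeight N t * ‖Z t - Z' t‖ₑ) :
    ∃ Z, IntegrableOn Z (Icc 0 T) ∧ Z =ᵐ[volume.restrict (Icc 0 T)] Φ Z := by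
  set m := (volume.restrict (Icc 0 T)).withDensity (expWeight N) with hm
  have hmw := (measurable_expWeight N).aemeasurable (μ := volume.restrict (Icc 0 T))
  have hle : m ≤ volume.restrict (Icc 0 T) := by
    rw [hm]
    conv_rhs => rw [← withDensity_one (μ := volume.restrict (Icc 0 T))]
    refine withDensity_mono ?_
    filter_upwards [ae_restrict_mem measurableSet_Icc] with t ht
    exact expWeight_le_one N ht.1
  set c : ℝ≥0∞ := ENNReal.ofReal (Real.exp (N * T)) with hcdef
  have hge : volume.restrict (Icc 0 T) ≤ c • m := by
    rw [hm, ← withDensity_smul _ (measurable_expWeight N)]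
    conv_lhs => rw [← withDensity_one (μ := volume.restrict (Icc 0 T))]
    refine withDensity_mono ?_
    filter_upwards [ae_restrict_mem measurableSet_Icc] with t ht
    simp only [Pi.one_apply, Pi.smul_apply, smul_eq_mul, expWeight, hcdef]
    rw [← ENNReal.ofReal_mul (Real.exp_pos _).le, ← Real.exp_add, ENNReal.one_le_ofReal,
      Real.one_le_exp_iff]
    have : (N : ℝ) * t ≤ N * T := by gcongr; exact ht.2
    linarith
  have hint : ∀ f : ℝ → V, Integrable f m ↔ IntegrableOn f (Icc 0 T) := fun f =>
    ⟨fun h => h.of_measure_le_smul ENNReal.ofReal_ne_top hge,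
      fun h => Integrable.mono_measure h hle⟩
  have hac : volume.restrict (Icc 0 T) ≪ m :=
    Measure.absolutelyContinuous_of_le_smul hge
  have hlint : ∀ f : ℝ → V, IntegrableOn f (Icc 0 T) →
      ∫⁻ t, ‖f t‖ₑ ∂m = ∫⁻ t in Icc 0 T, expWeight N t * ‖f t‖ₑ := fun f hf => by
    rw [hm, lintegral_withDensity_eq_lintegral_mul₀ hmw hf.aestronglyMeasurable.enorm]
    rfl
  have hI : ∀ f : Lp V 1 m, Integrable (Φ f) m := fun f =>
    (hint _).2 (hΦ _ ((hint _).1 (L1.integrable_coeFn f)))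
  have hcontr : ContractingWith (1 / 2 : ℝ≥0) (fun f : Lp V 1 m => (hI f).toL1 (Φ f)) := by
    refine ⟨by rw [← NNReal.coe_lt_coe]; norm_num, fun f g => ?_⟩
    rw [Integrable.edist_toL1_toL1, L1.edist_def]
    simp only [edist_eq_enorm_sub]
    have h1 := (hint _).1 (hI f)
    have h2 := (hint _).1 (hI g)
    have h3 := (hint _).1 (L1.integrable_coeFn f)
    have h4 := (hint _).1 (L1.integrable_coeFn g)
    have e1 := hlint (fun t => Φ f t - Φ g t) (h1.sub h2)
    have e2 := hlint (fun t => f t - g t) (h3.sub h4)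
    rw [e1, e2]
    refine (hc _ _ h3 h4).trans (le_of_eq ?_)
    simp
  obtain ⟨f, hf, -⟩ := hcontr.exists_fixedPoint 0 (edist_ne_top _ _)
  refine ⟨f, (hint _).1 (L1.integrable_coeFn f), hac.ae_le ?_⟩
  have h1 := (hI f).coeFn_toL1
  have h2 : (hI f).toL1 (Φ f) = f := hf
  rw [h2] at h1
  exact h1

/-! ### Resolvents of the second kind -/

section ExpWeight

variable {A : Type*} [NormedAddCommGroup A]

theorem exists_expWeight_le {k : ℝ → A} {T : ℝ} (hk : IntegrableOn k (Icc 0 T)) {c ε : ℝ≥0∞}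
    (hc : c ≠ ⊤) (hε : ε ≠ 0) :
    ∃ N : ℕ, c * ∫⁻ t in Icc 0 T, expWeight N t * ‖k t‖ₑ ≤ ε := by
  have h1 := tendsto_lintegral_expWeight (q := 1) le_rfl hk.aestronglyMeasurable.enorm
    (by simpa using hk.2.ne)
  simp only [ENNReal.rpow_one] at h1
  have h2 := ENNReal.Tendsto.const_mul (a := c) h1 (Or.inr hc)
  rw [mul_zero] at h2
  exact (h2.eventually_le_const (pos_iff_ne_zero.2 hε)).exists

theorem lintegral_expWeight_ne_top {f : ℝ → A} {T : ℝ} (N : ℕ) (hf : IntegrableOn f (Icc 0 T)) :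
    ∫⁻ t in Icc 0 T, expWeight N t * ‖f t‖ₑ ≠ ⊤ := by
  refine ne_top_of_le_ne_top hf.2.ne (lintegral_mono_ae ?_)
  filter_upwards [ae_restrict_mem measurableSet_Icc] with t ht
  exact mul_le_of_le_one_left' (expWeight_le_one N ht.1)

theorem ae_eq_zero_of_lintegral_expWeight_le_half {f : ℝ → A} {T : ℝ} (N : ℕ)
    (hf : IntegrableOn f (Icc 0 T))
    (h : ∫⁻ t in Icc 0 T, expWeight N t * ‖f t‖ₑ ≤
      1 / 2 * ∫⁻ t in Icc 0 T, expWeight N t * ‖f t‖ₑ) :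
    f =ᵐ[volume.restrict (Icc 0 T)] 0 := by
  set Y := ∫⁻ t in Icc 0 T, expWeight N t * ‖f t‖ₑ with hY
  have hmw := (measurable_expWeight N).aemeasurable (μ := volume.restrict (Icc 0 T))
  have m1 : AEMeasurable (fun t => expWeight N t * ‖f t‖ₑ) (volume.restrict (Icc 0 T)) :=
    hmw.mul hf.aestronglyMeasurable.enorm
  have hY0 : Y = 0 := by
    by_contra hne
    have : (1 / 2 : ℝ≥0∞) * Y < Y := by
      rw [mul_comm, one_div, ← div_eq_mul_inv]
      exact ENNReal.half_lt_self hne (lintegral_expWeight_ne_top N hf)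
    exact absurd h (not_le.2 this)
  rw [hY, lintegral_eq_zero_iff' m1] at hY0
  filter_upwards [hY0] with t ht
  simpa [expWeight_ne_zero] using ht

end ExpWeight

section Resolvent

variable {A V W : Type*} [NormedAddCommGroup A] [NormedSpace ℝ A]
  [NormedAddCommGroup V] [NormedSpace ℝ V] [NormedAddCommGroup W] [NormedSpace ℝ W]

theorem lintegral_expWeight_vconv_le (B : A →L[ℝ] V →L[ℝ] W) {f : ℝ → A} {h : ℝ → V} {T : ℝ}
    (N : ℕ) (hf : IntegrableOn f (Icc 0 T)) (hh : IntegrableOn h (Icc 0 T)) :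
    ∫⁻ t in Icc 0 T, expWeight N t * ‖vconv B f h volume t‖ₑ ≤
      ‖B‖ₑ * ((∫⁻ t in Icc 0 T, expWeight N t * ‖f t‖ₑ) *
        ∫⁻ t in Icc 0 T, expWeight N t * ‖h t‖ₑ) := by
  have hmw := (measurable_expWeight N).aemeasurable (μ := volume.restrict (Icc 0 T))
  have m1 : AEMeasurable (fun t => expWeight N t * ‖f t‖ₑ) (volume.restrict (Icc 0 T)) :=
    hmw.mul hf.aestronglyMeasurable.enorm
  have m2 : AEMeasurable (fun t => expWeight N t * ‖h t‖ₑ) (volume.restrict (Icc 0 T)) :=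
    hmw.mul hh.aestronglyMeasurable.enorm
  calc _ ≤ ∫⁻ t in Icc 0 T, ‖B‖ₑ * lconv (fun s => expWeight N s * ‖f s‖ₑ)
          (fun s => expWeight N s * ‖h s‖ₑ) volume t := by
        refine lintegral_mono fun t => ?_
        rw [← expWeight_mul_lconv, mul_left_comm]
        gcongr
        exact enorm_vconv_le B f h volume t
    _ ≤ _ := by
        rw [lintegral_const_mul' _ _ enorm_ne_top]
        gcongr
        exact lintegral_lconv_le m1 m2

/-- A kernel that is integrable on `[0,T]` has a two-sided resolvent of the second kind there. -/
theorem exists_resolvent [CompleteSpace A] (M : A →L[ℝ] A →L[ℝ] A)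
    (hM : ∀ a b c, M a (M b c) = M (M a b) c)
    {k : ℝ → A} {T : ℝ} (hk : IntegrableOn k (Icc 0 T)) :
    ∃ r : ℝ → A, IntegrableOn r (Icc 0 T) ∧
      (∀ᵐ t ∂(volume.restrict (Icc 0 T)), r t = k t - vconv M k r volume t) ∧
      ∀ᵐ t ∂(volume.restrict (Icc 0 T)), r t = k t - vconv M r k volume t := by
  obtain ⟨N, hN⟩ := exists_expWeight_le hk (enorm_ne_top (x := M)) (ε := 1 / 2) (by simp)
  obtain ⟨r, hr, hr1⟩ := exists_fixedPoint_of_weighted_contraction (T := T) N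
    (fun Z t => k t - vconv M k Z volume t)
    (fun Z hZ => hk.sub (integrableOn_vconv M hk hZ)) (fun Z Z' hZ hZ' => by
      have : ∀ᵐ t ∂(volume.restrict (Icc 0 T)),
          expWeight N t * ‖(k t - vconv M k Z volume t) - (k t - vconv M k Z' volume t)‖ₑ =
            expWeight N t * ‖vconv M k (fun s => Z s - Z' s) volume t‖ₑ := by
        filter_upwards [vconv_sub_right M hk hZ hZ'] with t ht
        rw [ht, sub_sub_sub_cancel_left, ← enorm_neg, neg_sub]
      rw [lintegral_congr_ae this]
      refine (lintegral_expWeight_vconv_le M N hk (hZ.sub hZ')).trans ?_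
      rw [← mul_assoc]
      gcongr
      rfl)
  obtain ⟨r', hr', hr2⟩ := exists_fixedPoint_of_weighted_contraction (T := T) N
    (fun Z t => k t - vconv M Z k volume t)
    (fun Z hZ => hk.sub (integrableOn_vconv M hZ hk)) (fun Z Z' hZ hZ' => by
      have : ∀ᵐ t ∂(volume.restrict (Icc 0 T)),
          expWeight N t * ‖(k t - vconv M Z k volume t) - (k t - vconv M Z' k volume t)‖ₑ =
            expWeight N t * ‖vconv M (fun s => Z s - Z' s) k volume t‖ₑ := by
        filter_upwards [vconv_sub_left M hZ hZ' hk] with t ht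
        rw [ht, sub_sub_sub_cancel_left, ← enorm_neg, neg_sub]
      rw [lintegral_congr_ae this]
      refine (lintegral_expWeight_vconv_le M N (hZ.sub hZ') hk).trans ?_
      rw [mul_comm (lintegral _ _), ← mul_assoc]
      gcongr
      rfl)
  have heq : r =ᵐ[volume.restrict (Icc 0 T)] r' := by
    have a1 := vconv_assoc M M M M hM hr' hk hr
    have a2 := vconv_sub_right M hr' hk (integrableOn_vconv M hk hr)
    have a3 := vconv_sub_left M hk hr' hr
    have a4 : ∀ᵐ t ∂(volume.restrict (Icc 0 T)),
        vconv M (vconv M r' k volume) r volume t =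
          vconv M (fun s => k s - r' s) r volume t :=
      vconv_congr_left M r volume (hr2.mono fun t ht => by
        simp only at ht ⊢; rw [ht]; abel)
    filter_upwards [a1, a2, a3, a4, hr1, hr2, ae_restrict_mem measurableSet_Icc] with
      t a1 a2 a3 a4 h1 h2 ht
    have a5 : vconv M r' r volume t =
        vconv M r' (fun s => k s - vconv M k r volume s) volume t :=
      vconv_congr_right M r' ht.2 hr1
    rw [a2, a1, a4, a3] at a5
    rw [h1]
    have a6 : vconv M r' k volume t = vconv M k r volume t := by
      have : vconv M r' k volume t - vconv M k r volume t = 0 := by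
        have := congrArg (fun x => x - vconv M r' r volume t) a5
        simp only [sub_self] at this
        rw [this]; abel
      exact sub_eq_zero.1 this
    rw [h2, a6]
  refine ⟨r, hr, hr1, ?_⟩
  have c1 := vconv_congr_left M k volume heq
  filter_upwards [heq, hr2, c1] with t h1 h2 h3
  rw [h3, h1]; exact h2

/-- Uniqueness of the resolvent of the second kind on `[0,T]`. -/
theorem resolvent_unique (M : A →L[ℝ] A →L[ℝ] A) {k r r' : ℝ → A} {T : ℝ}
    (hk : IntegrableOn k (Icc 0 T)) (hr : IntegrableOn r (Icc 0 T))
    (hr' : IntegrableOn r' (Icc 0 T))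
    (h : ∀ᵐ t ∂(volume.restrict (Icc 0 T)), r t = k t - vconv M k r volume t)
    (h' : ∀ᵐ t ∂(volume.restrict (Icc 0 T)), r' t = k t - vconv M k r' volume t) :
    r =ᵐ[volume.restrict (Icc 0 T)] r' := by
  obtain ⟨N, hN⟩ := exists_expWeight_le hk (enorm_ne_top (x := M)) (ε := 1 / 2) (by simp)
  have hd := ae_eq_zero_of_lintegral_expWeight_le_half N (hr.sub hr') (by
    calc ∫⁻ t in Icc 0 T, expWeight N t * ‖(r - r') t‖ₑ
        = ∫⁻ t in Icc 0 T, expWeight N t * ‖vconv M k (fun s => r s - r' s) volume t‖ₑ := by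
          refine lintegral_congr_ae ?_
          filter_upwards [h, h', vconv_sub_right M hk hr hr'] with t h1 h2 h3
          rw [h3, Pi.sub_apply, h1, h2, sub_sub_sub_cancel_left, ← enorm_neg, neg_sub]
      _ ≤ _ := by
          refine (lintegral_expWeight_vconv_le M N hk (hr.sub hr')).trans ?_
          rw [← mul_assoc]
          gcongr)
  filter_upwards [hd] with t ht
  exact sub_eq_zero.1 ht

end Resolvent

/-! ### From bounded intervals to the half-line -/

theorem ae_restrict_Ici_of_forall_Icc {P : ℝ → Prop}
    (h : ∀ n : ℕ, ∀ᵐ t ∂(volume.restrict (Icc (0 : ℝ) n)), P t) :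
    ∀ᵐ t ∂(volume.restrict (Ici (0 : ℝ))), P t := by
  have hU : Ici (0 : ℝ) ⊆ ⋃ n : ℕ, Icc (0 : ℝ) n := fun t ht =>
    mem_iUnion.2 ⟨⌈t⌉₊, ht, Nat.le_ceil t⟩
  exact ae_mono (Measure.restrict_mono hU le_rfl) (ae_restrict_iUnion_iff _ _ |>.2 h)

theorem ae_restrict_Icc_of_Ici {P : ℝ → Prop} (h : ∀ᵐ t ∂(volume.restrict (Ici (0 : ℝ))), P t)
    (T : ℝ) : ∀ᵐ t ∂(volume.restrict (Icc (0 : ℝ) T)), P t :=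
  ae_mono (Measure.restrict_mono Icc_subset_Ici_self le_rfl) h

theorem ae_restrict_Icc_mono {P : ℝ → Prop} {S T : ℝ} (hST : S ≤ T)
    (h : ∀ᵐ t ∂(volume.restrict (Icc (0 : ℝ) T)), P t) :
    ∀ᵐ t ∂(volume.restrict (Icc (0 : ℝ) S)), P t :=
  ae_mono (Measure.restrict_mono (Icc_subset_Icc_right hST) le_rfl) h

/-- Compatible functions on the intervals `[0,n]` glue to a function on the half-line. -/
theorem exists_glue {V : Type*} (Z : ℕ → ℝ → V)
    (h : ∀ n : ℕ, Z n =ᵐ[volume.restrict (Icc (0 : ℝ) n)] Z (n + 1)) :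
    ∃ Y : ℝ → V, ∀ n : ℕ, Y =ᵐ[volume.restrict (Icc (0 : ℝ) n)] Z n := by
  refine ⟨fun t => Z ⌈t⌉₊ t, fun n => ?_⟩
  have h1 : ∀ k : ℕ, ∀ᵐ t : ℝ, t ∈ Icc (0 : ℝ) k → Z k t = Z (k + 1) t := fun k =>
    (ae_restrict_iff' measurableSet_Icc).1 (h k)
  rw [Filter.EventuallyEq, ae_restrict_iff' measurableSet_Icc]
  filter_upwards [ae_all_iff.2 h1] with t ht htn
  have key : ∀ j : ℕ, ⌈t⌉₊ ≤ j → Z j t = Z ⌈t⌉₊ t := by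
    intro j hj
    induction j, hj using Nat.le_induction with
    | base => rfl
    | succ j hj ih =>
      rw [← ih, ht j ⟨htn.1, (Nat.le_ceil t).trans (by exact_mod_cast hj)⟩]
  exact (key n (Nat.ceil_le.2 htn.2)).symm

/-! ### Matrix kernels -/

theorem real_smul_cvec {m : ℕ} (c : ℝ) (v : Cvec m) : c • v = (c : ℂ) • v := by
  ext i; simp

/-- Multiplication of matrices as a real bilinear map. -/
def mulB (m : ℕ) : Cmat m →L[ℝ] Cmat m →L[ℝ] Cmat m :=
  LinearMap.mkContinuous₂ (LinearMap.mk₂ ℝ (fun a b : Cmat m => a * b)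
    (fun a b c => add_mul a b c)
    (fun c a b => by ext v i; simp)
    (fun a b c => mul_add a b c)
    (fun c a b => by
      ext v i
      have h : (c • b) v = (c : ℂ) • b v := by ext i; simp
      simp [h])) 1 (fun a b => by simpa using norm_mul_le a b)

/-- The action of matrices on vectors as a real bilinear map. -/
def applyB (m : ℕ) : Cmat m →L[ℝ] Cvec m →L[ℝ] Cvec m :=
  LinearMap.mkContinuous₂ (LinearMap.mk₂ ℝ (fun (a : Cmat m) (v : Cvec m) => a v)
    (fun a b v => rfl)
    (fun c a v => by ext i; simp)
    (fun a v w => map_add a v w)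
    (fun c a v => by
      rw [real_smul_cvec, real_smul_cvec]
      exact map_smul a _ _)) 1 (fun a v => by simpa using a.le_opNorm v)

@[simp] theorem applyB_apply {m : ℕ} (a : Cmat m) (v : Cvec m) : applyB m a v = a v := rfl

theorem convMat_eq_vconv {m : ℕ} (f g : ℝ → Cmat m) {t : ℝ} (ht : 0 ≤ t) :
    convMat f g t = vconv (mulB m) f g volume t := by
  rw [convMat, vconv, intervalIntegral.integral_of_le ht, integral_Ioc_eq_integral_Ioo,
    integral_Ico_eq_integral_Ioo]
  rfl

/-- Locally integrable matrix kernels have a resolvent of the second kind. -/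
theorem exists_isResolventSecondKind {m : ℕ} {k : ℝ → Cmat m}
    (hk : ∀ T : ℝ, 0 < T → IntegrableOn k (Icc 0 T)) : ∃ r, IsResolventSecondKind k r := by
  have hk' : ∀ n : ℕ, IntegrableOn k (Icc (0 : ℝ) n) := fun n =>
    (hk (n + 1) (by positivity)).mono_set (Icc_subset_Icc_right (by linarith))
  have hassoc : ∀ a b c, mulB m a (mulB m b c) = mulB m (mulB m a b) c := fun a b c =>
    (mul_assoc a b c).symm
  choose r hr h1 h2 using fun n : ℕ => exists_resolvent (mulB m) hassoc (hk' n)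
  obtain ⟨Y, hY⟩ := exists_glue r (fun n => by
    refine resolvent_unique (mulB m) (hk' n) (hr n) ?_ (h1 n) ?_
    · exact (hr (n + 1)).mono_set (Icc_subset_Icc_right (by simp))
    · exact ae_restrict_Icc_mono (by simp) (h1 (n + 1)))
  have hYi : ∀ n : ℕ, IntegrableOn Y (Icc (0 : ℝ) n) := fun n => (hr n).congr (hY n).symm
  refine ⟨Y, fun T hT => (hYi ⌈T⌉₊).mono_set (Icc_subset_Icc_right (Nat.le_ceil T)), ?_, ?_⟩
  · refine ae_restrict_Ici_of_forall_Icc fun n => ?_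
    filter_upwards [h2 n, hY n, vconv_congr_left (mulB m) k volume (hY n),
      ae_restrict_mem measurableSet_Icc] with t e1 e2 e3 ht
    rw [convMat_eq_vconv _ _ ht.1, e2, e3, e1]; abel
  · refine ae_restrict_Ici_of_forall_Icc fun n => ?_
    filter_upwards [h1 n, hY n, ae_restrict_mem measurableSet_Icc] with t e1 e2 ht
    rw [convMat_eq_vconv _ _ ht.1, e2, vconv_congr_right (mulB m) k ht.2 (hY n), e1]; abel

theorem resolventR_spec {m : ℕ} {K : ℝ → Cmat m} {B : Cmat m}
    (hK : ∀ T : ℝ, 0 < T → IntegrableOn K (Icc 0 T)) :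
    IsResolventSecondKind (fun t => -(K t * B)) (resolventR K B) := by
  have h : ∃ r, IsResolventSecondKind (fun t => -(K t * B)) r :=
    exists_isResolventSecondKind fun T hT => ((mulB m).flip B).integrable_comp (hK T hT) |>.neg
  rw [resolventR, dif_pos h]
  exact h.choose_spec

/-! ### Completely positive kernels -/

/-- Multiplication of vectors by real scalars, as a bilinear map. -/
abbrev smulB (V : Type*) [NormedAddCommGroup V] [NormedSpace ℝ V] : ℝ →L[ℝ] V →L[ℝ] V :=
  ContinuousLinearMap.lsmul ℝ ℝ

/-- A scalar kernel is completely positive on `[0,T]` if for each `l > 0` the resolvent of the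
second kind of `l k` exists and is nonnegative there. -/
def CompletelyPositive (k : ℝ → ℝ) (T : ℝ) : Prop :=
  ∀ l : ℝ, 0 < l → ∃ r : ℝ → ℝ, IntegrableOn r (Icc 0 T) ∧
    (∀ᵐ t ∂(volume.restrict (Icc 0 T)), 0 ≤ r t) ∧
    (∀ᵐ t ∂(volume.restrict (Icc 0 T)), r t = l * k t - l * vconv (smulB ℝ) k r volume t) ∧
    ∀ᵐ t ∂(volume.restrict (Icc 0 T)), r t = l * k t - l * vconv (smulB ℝ) r k volume t

theorem exists_scalar_resolvent {k : ℝ → ℝ} {T : ℝ} (hk : IntegrableOn k (Icc 0 T)) (l : ℝ) :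
    ∃ r : ℝ → ℝ, IntegrableOn r (Icc 0 T) ∧
    (∀ᵐ t ∂(volume.restrict (Icc 0 T)), r t = l * k t - l * vconv (smulB ℝ) k r volume t) ∧
    ∀ᵐ t ∂(volume.restrict (Icc 0 T)), r t = l * k t - l * vconv (smulB ℝ) r k volume t := by
  have hlk : IntegrableOn (fun t => l • k t) (Icc 0 T) := hk.smul l
  obtain ⟨r, h1, h2, h3⟩ := exists_resolvent (smulB ℝ)
    (fun a b c => by simp [mul_assoc]) hlk
  refine ⟨r, h1, ?_, ?_⟩
  · filter_upwards [h2] with t ht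
    rw [ht, vconv_smul_left]; rfl
  · filter_upwards [h3] with t ht
    rw [ht, vconv_smul_right]; rfl

/-- The convolution of an integrable function with a bounded kernel that is continuous on
`(0, ∞)` is continuous. -/
theorem continuousWithinAt_vconv {V : Type*} [NormedAddCommGroup V] [NormedSpace ℝ V]
    {k : ℝ → ℝ} {g : ℝ → V} {C T t₀ : ℝ} (hk : ContinuousOn k (Ioi 0))
    (hC : ∀ t, 0 < t → |k t| ≤ C) (hg : IntegrableOn g (Icc 0 T)) :
    ContinuousWithinAt (vconv (smulB V) k g volume) (Iic T) t₀ := by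
  by_cases ht₀ : t₀ ≤ T
  swap
  · refine (continuousWithinAt_of_notMem_closure ?_)
    simpa using not_le.1 ht₀
  set κ := (Ioi (0 : ℝ)).indicator k with hκ
  set H := (Ico 0 T).indicator g with hH
  have hHi : Integrable H := integrable_indicator_Ico hg
  have mκ : AEStronglyMeasurable κ :=
    (aestronglyMeasurable_indicator_iff measurableSet_Ioi).2
      (hk.aestronglyMeasurable measurableSet_Ioi)
  have hκC : ∀ x, ‖κ x‖ ≤ |C| := by
    intro x
    by_cases hx : x ∈ Ioi (0 : ℝ)
    · rw [hκ, indicator_of_mem hx]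
      exact (hC x hx).trans (le_abs_self C)
    · rw [hκ, indicator_of_notMem hx]; simp
  have heq : ∀ t ∈ Iic T, vconv (smulB V) k g volume t = ∫ s, κ (t - s) • H s := by
    intro t ht
    rw [vconv_eq_indicator _ _ _ _ ht]
    refine integral_congr_ae (.of_forall fun s => ?_)
    simp only [ContinuousLinearMap.lsmul_apply]
    by_cases hs : s ∈ Ico 0 T
    · congr 1
      by_cases h1 : t - s ∈ Ioi (0 : ℝ)
      · rw [hκ, indicator_of_mem h1, indicator_of_mem (show t - s ∈ Ioc 0 T from
          ⟨h1, by linarith [hs.1, mem_Iic.1 ht]⟩)]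
      · rw [hκ, indicator_of_notMem h1, indicator_of_notMem (fun h => h1 h.1)]
    · simp [hH, hs]
  refine ContinuousWithinAt.congr (f := fun t => ∫ s, κ (t - s) • H s) ?_ heq (heq t₀ ht₀)
  refine ContinuousAt.continuousWithinAt ?_
  refine continuousAt_of_dominated (bound := fun s => |C| * ‖H s‖) (.of_forall fun t => ?_)
    (.of_forall fun t => .of_forall fun s => ?_) (hHi.norm.const_mul _) ?_
  · exact (mκ.comp_quasiMeasurePreserving (quasiMeasurePreserving_sub_left volume t)).smul
      hHi.aestronglyMeasurable
  · rw [norm_smul]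
    gcongr
    exact hκC _
  · have hne : ∀ᵐ s : ℝ, s ≠ t₀ := by simp [ae_iff, measure_singleton]
    filter_upwards [hne] with s hs
    refine ContinuousAt.smul ?_ continuousAt_const
    have hc : ContinuousAt κ (t₀ - s) := by
      rcases lt_or_gt_of_ne (sub_ne_zero.2 (Ne.symm hs)) with h | h
      · refine (continuousAt_const (y := (0 : ℝ))).congr ?_
        filter_upwards [Iio_mem_nhds h] with x hx
        rw [hκ, indicator_of_notMem (by simpa using le_of_lt hx)]
      · refine (hk.continuousAt (Ioi_mem_nhds h)).congr ?_
        filter_upwards [Ioi_mem_nhds h] with x hx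
        rw [hκ, indicator_of_mem hx]
    exact ContinuousAt.comp (f := fun t => t - s) hc (by fun_prop)

/-- A comparison of two measures on half-open intervals passes to integrals of nonnegative
bounded continuous functions. -/
theorem lintegral_le_of_forall_Ioc {α β : Measure ℝ} [IsFiniteMeasure α] [IsFiniteMeasure β]
    (h : ∀ a b, α (Ioc a b) ≤ β (Ioc a b)) {φ : ℝ → ℝ≥0∞} {C : ℝ≥0∞} (hφ : Continuous φ)
    (hC : C ≠ ⊤) (hφC : ∀ x, φ x ≤ C) : ∫⁻ x, φ x ∂α ≤ ∫⁻ x, φ x ∂β := by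
  -- step functions that are constant on the intervals `(j/(n+1), (j+1)/(n+1)]`
  set c : ℕ → ℝ → ℤ := fun n x => ⌈((n : ℝ) + 1) * x⌉ with hc
  have mc : ∀ n, Measurable (c n) := fun n => Int.measurable_ceil.comp (by fun_prop)
  set g : ℕ → ℤ → ℝ≥0∞ := fun n j => φ ((j : ℝ) / ((n : ℝ) + 1)) with hg
  have hpre : ∀ n j, c n ⁻¹' {j} = Ioc (((j : ℝ) - 1) / (n + 1)) ((j : ℝ) / (n + 1)) := by
    intro n j
    have hn : (0 : ℝ) < (n : ℝ) + 1 := by positivity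
    ext x
    simp only [hc, mem_preimage, mem_singleton_iff, Int.ceil_eq_iff, mem_Ioc, div_lt_iff₀ hn,
      le_div_iff₀ hn, mul_comm x]
  have hmap : ∀ n, α.map (c n) ≤ β.map (c n) := by
    intro n
    refine Measure.le_iff.2 fun s hs => ?_
    rw [← lintegral_indicator_one hs, ← lintegral_indicator_one hs, lintegral_countable',
      lintegral_countable']
    refine ENNReal.tsum_le_tsum fun j => ?_
    refine mul_le_mul_right ?_ _
    rw [Measure.map_apply (mc n) (measurableSet_singleton j),
      Measure.map_apply (mc n) (measurableSet_singleton j), hpre]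
    exact h _ _
  have hstep : ∀ n, ∫⁻ x, g n (c n x) ∂α ≤ ∫⁻ x, g n (c n x) ∂β := by
    intro n
    rw [← lintegral_map (measurable_of_countable (g n)) (mc n),
      ← lintegral_map (measurable_of_countable (g n)) (mc n)]
    exact lintegral_mono' (hmap n) le_rfl
  have hlim : ∀ x, Filter.Tendsto (fun n => g n (c n x)) Filter.atTop (nhds (φ x)) := by
    intro x
    refine (hφ.tendsto x).comp ?_
    have h0 : Filter.Tendsto (fun n : ℕ => 1 / ((n : ℝ) + 1)) Filter.atTop (nhds 0) :=
      tendsto_one_div_add_atTop_nhds_zero_nat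
    have h1 : Filter.Tendsto (fun n : ℕ => x + 1 / ((n : ℝ) + 1)) Filter.atTop (nhds x) := by
      simpa using h0.const_add x
    refine tendsto_of_tendsto_of_tendsto_of_le_of_le tendsto_const_nhds h1 (fun n => ?_)
      (fun n => ?_)
    · have hn : (0 : ℝ) < (n : ℝ) + 1 := by positivity
      rw [le_div_iff₀ hn, mul_comm]
      exact Int.le_ceil _
    · have hn : (0 : ℝ) < (n : ℝ) + 1 := by positivity
      have := (Int.ceil_lt_add_one (((n : ℝ) + 1) * x)).le
      simp only [hc]
      rw [div_le_iff₀ hn]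
      calc _ ≤ _ := this
        _ = _ := by field_simp
  have hdct : ∀ (γ : Measure ℝ) [IsFiniteMeasure γ],
      Filter.Tendsto (fun n => ∫⁻ x, g n (c n x) ∂γ) Filter.atTop (nhds (∫⁻ x, φ x ∂γ)) := by
    intro γ _
    refine tendsto_lintegral_of_dominated_convergence (fun _ => C)
      (fun n => (measurable_of_countable (g n)).comp (mc n))
      (fun n => .of_forall fun x => hφC _) ?_ (.of_forall hlim)
    rw [lintegral_const]
    exact ENNReal.mul_ne_top hC (measure_ne_top γ _)
  exact le_of_tendsto_of_tendsto' (hdct α) (hdct β) hstep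

/-- Under the monotonicity property of resolvents of the first kind, shifting an interval to the
left inside `(0, ∞)` does not decrease its measure. -/
theorem measure_Ioc_inter_Ioo_shift_le {L : Measure ℝ}
    (hL : ∀ t : ℝ, 0 ≤ t → AntitoneOn (fun s => L (Icc s (s + t))) (Ici 0))
    {δ τ a b : ℝ} (hδ : 0 ≤ δ) :
    L (Ioc (a + δ) (b + δ) ∩ Ioo δ (τ + δ)) ≤ L (Ioc a b ∩ Ioo 0 τ) := by
  have hicc : ∀ x y : ℝ, 0 ≤ x → L (Icc (x + δ) (y + δ)) ≤ L (Icc x y) := by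
    intro x y hx
    by_cases hxy : x ≤ y
    · have := hL (y - x) (by linarith) (mem_Ici.2 hx) (show x + δ ∈ Ici (0 : ℝ) by
        simp only [mem_Ici]; linarith) (by linarith : x ≤ x + δ)
      have e1 : x + (y - x) = y := by ring
      have e2 : x + δ + (y - x) = y + δ := by ring
      simp only [e1, e2] at this
      exact this
    · rw [Icc_eq_empty (by linarith)]; simp
  have hunion : ∀ e : ℝ, Ioc (a + e) (b + e) ∩ Ioo e (τ + e) =
      ⋃ n : ℕ, Icc (max a 0 + 1 / ((n : ℝ) + 1) + e) (min b (τ - 1 / ((n : ℝ) + 1)) + e) := by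
    intro e
    ext x
    simp only [mem_inter_iff, mem_Ioc, mem_Ioo, mem_iUnion, mem_Icc]
    constructor
    · rintro ⟨⟨h1, h2⟩, h3, h4⟩
      have hpos : 0 < min (x - e - max a 0) (τ - (x - e)) := by
        refine lt_min (sub_pos.2 (max_lt (by linarith) (by linarith))) (by linarith)
      obtain ⟨n, hn⟩ := exists_nat_one_div_lt hpos
      have h5 := hn.trans_le (min_le_left _ _)
      have h6 := hn.trans_le (min_le_right _ _)
      refine ⟨n, by linarith, ?_⟩
      have : x - e ≤ min b (τ - 1 / ((n : ℝ) + 1)) := le_min (by linarith) (by linarith)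
      linarith
    · rintro ⟨n, h1, h2⟩
      have hn : 0 < 1 / ((n : ℝ) + 1) := by positivity
      have h3 := le_max_left a 0
      have h4 := le_max_right a 0
      have h5 := min_le_left b (τ - 1 / ((n : ℝ) + 1))
      have h6 := min_le_right b (τ - 1 / ((n : ℝ) + 1))
      exact ⟨⟨by linarith, by linarith⟩, by linarith, by linarith⟩
  have hmono : ∀ e : ℝ, Monotone fun n : ℕ =>
      Icc (max a 0 + 1 / ((n : ℝ) + 1) + e) (min b (τ - 1 / ((n : ℝ) + 1)) + e) := by
    intro e n n' hnn
    have : 1 / ((n' : ℝ) + 1) ≤ 1 / ((n : ℝ) + 1) := by gcongr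
    exact Icc_subset_Icc (by linarith)
      (by gcongr)
  have h0 := hunion 0
  simp only [add_zero] at h0
  have hm0 := hmono 0
  simp only [add_zero] at hm0
  rw [hunion δ, h0, (hmono δ).measure_iUnion, hm0.measure_iUnion]
  refine iSup_mono fun n => hicc _ _ ?_
  have hn : 0 < 1 / ((n : ℝ) + 1) := by positivity
  linarith [le_max_right a 0]

theorem setIntegral_Ioo_shift_le {L : Measure ℝ} [IsLocallyFiniteMeasure L]
    (hL : ∀ t : ℝ, 0 ≤ t → AntitoneOn (fun s => L (Icc s (s + t))) (Ici 0))
    {δ τ : ℝ} (hδ : 0 ≤ δ) {φ : ℝ → ℝ} {C : ℝ} (hφ : Continuous φ) (hφ0 : ∀ x, 0 ≤ φ x)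
    (hφC : ∀ x, φ x ≤ C) :
    ∫ s in Ioo δ (τ + δ), φ (s - δ) ∂L ≤ ∫ s in Ioo 0 τ, φ s ∂L := by
  have hfin : ∀ a b : ℝ, L (Ioo a b) < ⊤ := fun a b =>
    (measure_mono Ioo_subset_Icc_self).trans_lt isCompact_Icc.measure_lt_top
  have : IsFiniteMeasure (L.restrict (Ioo δ (τ + δ))) := ⟨by simpa using hfin _ _⟩
  have : IsFiniteMeasure (L.restrict (Ioo 0 τ)) := ⟨by simpa using hfin _ _⟩
  have hsub : Measurable fun s : ℝ => s - δ := by fun_prop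
  have key := lintegral_le_of_forall_Ioc
    (α := (L.restrict (Ioo δ (τ + δ))).map (fun s => s - δ)) (β := L.restrict (Ioo 0 τ))
    (φ := fun x => ENNReal.ofReal (φ x)) (C := ENNReal.ofReal C) ?_
    (ENNReal.continuous_ofReal.comp hφ) ENNReal.ofReal_ne_top
    (fun x => ENNReal.ofReal_le_ofReal (hφC x))
  · have hm : Measurable fun x => ENNReal.ofReal (φ x) :=
      (ENNReal.continuous_ofReal.comp hφ).measurable
    rw [lintegral_map hm hsub] at key
    rw [integral_eq_lintegral_of_nonneg_ae (.of_forall fun x => hφ0 _)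
        (by fun_prop), integral_eq_lintegral_of_nonneg_ae (.of_forall fun x => hφ0 _)
        (by fun_prop)]
    refine ENNReal.toReal_mono ?_ key
    refine ne_top_of_le_ne_top ?_ (lintegral_mono fun x => ENNReal.ofReal_le_ofReal (hφC x))
    rw [lintegral_const]
    exact ENNReal.mul_ne_top ENNReal.ofReal_ne_top (measure_ne_top _ _)
  · intro a b
    rw [Measure.map_apply hsub measurableSet_Ioc, Measure.restrict_apply
      (hsub measurableSet_Ioc), Measure.restrict_apply measurableSet_Ioc]
    have : (fun s : ℝ => s - δ) ⁻¹' Ioc a b = Ioc (a + δ) (b + δ) := by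
      ext x; simp
    rw [this]
    exact measure_Ioc_inter_Ioo_shift_le hL hδ

theorem tendsto_measure_Ioc_zero {L : Measure ℝ} [IsLocallyFiniteMeasure L] {c : ℝ} (hc : 0 < c) :
    ∃ δ₀ : ℝ, 0 < δ₀ ∧ ∀ δ ≤ δ₀, L.real (Ioc 0 δ) < c := by
  have hfin : ∀ a b : ℝ, L (Ioc a b) ≠ ⊤ := fun a b =>
    ((measure_mono Ioc_subset_Icc_self).trans_lt isCompact_Icc.measure_lt_top).ne
  have hanti : Antitone fun n : ℕ => Ioc (0 : ℝ) (1 / ((n : ℝ) + 1)) := fun n n' h =>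
    Ioc_subset_Ioc_right (by gcongr)
  have h := tendsto_measure_iInter_atTop (μ := L)
    (fun n : ℕ => (measurableSet_Ioc (a := (0 : ℝ)) (b := 1 / ((n : ℝ) + 1))).nullMeasurableSet)
    hanti ⟨0, hfin _ _⟩
  have hempty : ⋂ n : ℕ, Ioc (0 : ℝ) (1 / ((n : ℝ) + 1)) = ∅ := by
    rw [eq_empty_iff_forall_notMem]
    intro x hx
    have h0 := (mem_iInter.1 hx 0).1
    obtain ⟨n, hn⟩ := exists_nat_one_div_lt h0
    exact absurd (mem_iInter.1 hx n).2 (not_le.2 hn)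
  rw [hempty, measure_empty] at h
  obtain ⟨n, hn⟩ := (h.eventually_lt_const (ENNReal.ofReal_pos.2 hc)).exists
  refine ⟨1 / ((n : ℝ) + 1), by positivity, fun δ hδ => ?_⟩
  have h1 : L (Ioc 0 δ) < ENNReal.ofReal c :=
    (measure_mono (Ioc_subset_Ioc_right hδ)).trans_lt hn
  rw [Measure.real]
  exact (ENNReal.lt_ofReal_iff_toReal_lt (hfin _ _)).1 h1

theorem vconv_smulB_comm (f g : ℝ → ℝ) (t : ℝ) :
    vconv (smulB ℝ) f g volume t = vconv (smulB ℝ) g f volume t := by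
  rcases le_or_gt t 0 with ht | ht
  · simp [vconv, Ico_eq_empty (not_lt.2 ht)]
  · simp only [vconv, ContinuousLinearMap.lsmul_apply, smul_eq_mul]
    rw [integral_Ico_eq_integral_Ioc, integral_Ico_eq_integral_Ioc,
      ← intervalIntegral.integral_of_le ht.le, ← intervalIntegral.integral_of_le ht.le]
    have := intervalIntegral.integral_comp_sub_left (a := 0) (b := t)
      (fun s => f (t - s) * g s) t
    simp only [sub_sub_cancel, sub_self, sub_zero] at this
    rw [← this]
    refine intervalIntegral.integral_congr fun s _ => ?_
    exact mul_comm _ _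

theorem lconv_lconv_lt_top {f g : ℝ → ℝ≥0∞} {L : Measure ℝ} [IsLocallyFiniteMeasure L]
    {C D : ℝ≥0∞} {t : ℝ} (hC : C ≠ ⊤) (hD : D ≠ ⊤) (hf : ∀ s ∈ Icc 0 t, f s ≤ C)
    (hg : ∀ s ∈ Icc 0 t, g s ≤ D) :
    lconv f (lconv g (fun _ => 1) L) volume t < ⊤ := by
  have h1 : ∀ s ∈ Icc 0 t, lconv g (fun _ => 1) L s ≤ D * L (Icc 0 t) := by
    intro s hs
    refine (setLIntegral_mono (g := fun _ => D) measurable_const fun u hu => ?_).trans ?_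
    · rw [mul_one]
      exact hg _ ⟨by linarith [hu.2], by linarith [hu.1, hs.2]⟩
    · rw [setLIntegral_const]
      gcongr
      exact Ico_subset_Icc_self.trans (Icc_subset_Icc_right hs.2)
  refine lt_of_le_of_lt (setLIntegral_mono (g := fun _ => C * (D * L (Icc 0 t)))
    measurable_const fun s hs => ?_) ?_
  · exact mul_le_mul' (hf _ ⟨by linarith [hs.2], by linarith [hs.1]⟩)
      (h1 s (Ico_subset_Icc_self hs))
  · rw [setLIntegral_const]
    have : L (Icc 0 t) ≠ ⊤ := isCompact_Icc.measure_lt_top.ne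
    exact (ENNReal.mul_ne_top (ENNReal.mul_ne_top hC (ENNReal.mul_ne_top hD this))
      (by simp)).lt_top

/-- Convolving the resolvent of the second kind with that of the first kind gives an
integral of the former. -/
theorem resolvent_conv_first_kind {k ρ : ℝ → ℝ} {L : Measure ℝ} {l T : ℝ}
    (hL : IsNonnegResolventFirstKind k L) (hk : ContinuousOn k (Icc 0 T))
    (hρ : ContinuousOn ρ (Icc 0 T))
    (h : ∀ t ∈ Icc 0 T, ρ t = l * k t - l * vconv (smulB ℝ) k ρ volume t) {t : ℝ}
    (ht : t ∈ Ioc 0 T) :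
    ∫ s in Ico 0 t, ρ (t - s) ∂L = l - l * ∫ s in Ico 0 t, ρ s := by
  have := hL.locallyFinite
  have hsub : ∀ φ : ℝ → ℝ, ContinuousOn φ (Icc 0 T) →
      IntegrableOn (fun s => φ (t - s)) (Ico 0 t) L := by
    intro φ hφ
    refine IntegrableOn.mono_set (t := Icc 0 t) ?_ Ico_subset_Icc_self
    refine ContinuousOn.integrableOn_compact isCompact_Icc ?_
    refine hφ.comp (by fun_prop) fun s hs => ⟨by linarith [hs.2], by linarith [hs.1, ht.2]⟩
  obtain ⟨C, hC⟩ := isCompact_Icc.exists_bound_of_continuousOn hρ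
  obtain ⟨D, hD⟩ := isCompact_Icc.exists_bound_of_continuousOn hk
  have hle : Icc 0 t ⊆ Icc 0 T := Icc_subset_Icc_right ht.2
  have hfin : lconv (fun s => ‖ρ s‖ₑ) (lconv (fun s => ‖k s‖ₑ) (fun _ => ‖(1 : ℝ)‖ₑ) L)
      volume t < ⊤ := by
    have e1 : ‖(1 : ℝ)‖ₑ = 1 := by simp
    rw [e1]
    refine lconv_lconv_lt_top (C := ENNReal.ofReal C) (D := ENNReal.ofReal D)
      ENNReal.ofReal_ne_top ENNReal.ofReal_ne_top (fun s hs => ?_) (fun s hs => ?_)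
    · rw [← ofReal_norm]; exact ENNReal.ofReal_le_ofReal (hC s (hle hs))
    · rw [← ofReal_norm]; exact ENNReal.ofReal_le_ofReal (hD s (hle hs))
  have hassoc := vconv_assoc_of_lt_top (smulB ℝ) (smulB ℝ) (smulB ℝ) (smulB ℝ)
    (fun a b c => by simp [mul_assoc]) (ρ := L) (h := fun _ => (1 : ℝ)) (T := T) ht.2
    (hρ.aestronglyMeasurable measurableSet_Icc) (hk.aestronglyMeasurable measurableSet_Icc)
    aestronglyMeasurable_const hfin
  have hone : vconv (smulB ℝ) ρ (vconv (smulB ℝ) k (fun _ => (1 : ℝ)) L) volume t =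
      vconv (smulB ℝ) ρ (fun _ => (1 : ℝ)) volume t := by
    refine vconv_congr_right _ _ (T := t) le_rfl ?_
    have hne : ∀ᵐ s ∂(volume.restrict (Icc 0 t)), s ≠ (0 : ℝ) :=
      ae_restrict_of_ae (by simp [ae_iff, measure_singleton])
    filter_upwards [hne, ae_restrict_mem measurableSet_Icc] with s hs hs2
    have := hL.conv_eq_one s (lt_of_le_of_ne hs2.1 (Ne.symm hs))
    simpa [vconv] using this
  rw [hone, vconv_smulB_comm] at hassoc
  have hI : ∫ s in Ico 0 t, ρ (t - s) ∂L =
      ∫ s in Ico 0 t, (l * k (t - s) - l * vconv (smulB ℝ) ρ k volume (t - s)) ∂L := by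
    refine setIntegral_congr_fun measurableSet_Ico fun s hs => ?_
    rw [h (t - s) ⟨by linarith [hs.2], by linarith [hs.1, ht.2]⟩, vconv_smulB_comm k ρ]
  have hi2 : IntegrableOn (fun s => l * vconv (smulB ℝ) ρ k volume (t - s)) (Ico 0 t) L := by
    refine (((hsub k hk).const_mul l).sub (hsub ρ hρ)).congr ?_
    filter_upwards [ae_restrict_mem measurableSet_Ico] with s hs
    simp only [Pi.sub_apply]
    rw [h (t - s) ⟨by linarith [hs.2], by linarith [hs.1, ht.2]⟩, vconv_smulB_comm k ρ]
    ring
  rw [hI, integral_sub ((hsub k hk).const_mul l) hi2, integral_const_mul, integral_const_mul,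
    hL.conv_eq_one t ht.1, mul_one]
  congr 2
  simp only [vconv, ContinuousLinearMap.lsmul_apply, smul_eq_mul, one_mul, mul_one] at hassoc ⊢
  exact hassoc.symm

/-- The resolvents of the second kind of a continuous, nonincreasing kernel whose resolvent of
the first kind is nonnegative and nonincreasing are nonnegative: at a negative minimum `t` of the
continuous representative, comparison of the identity of `resolvent_conv_first_kind` at `t` and at
a slightly smaller time gives a contradiction. -/
theorem resolvent_nonneg {k r : ℝ → ℝ} {L : Measure ℝ} {l T : ℝ} (hl : 0 < l)
    (hk : ContinuousOn k (Ici 0)) (hk0 : ∀ t, 0 ≤ t → 0 ≤ k t) (hka : AntitoneOn k (Ici 0))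
    (hL : IsNonnegResolventFirstKind k L)
    (hLa : ∀ t : ℝ, 0 ≤ t → AntitoneOn (fun s => L (Icc s (s + t))) (Ici 0))
    (hr : IntegrableOn r (Icc 0 T))
    (h : ∀ᵐ t ∂(volume.restrict (Icc 0 T)), r t = l * k t - l * vconv (smulB ℝ) k r volume t) :
    ∀ᵐ t ∂(volume.restrict (Icc 0 T)), 0 ≤ r t := by
  have := hL.locallyFinite
  rcases lt_or_ge T 0 with hT | hT
  · simp [Icc_eq_empty (not_le.2 hT)]
  set ρ : ℝ → ℝ := fun t => l * k t - l * vconv (smulB ℝ) k r volume t with hρdef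
  have hkb : ∀ t, 0 ≤ t → |k t| ≤ k 0 := fun t ht => by
    rw [abs_of_nonneg (hk0 t ht)]
    exact hka (mem_Ici.2 le_rfl) ht ht
  have hρc : ContinuousOn ρ (Icc 0 T) := by
    refine ContinuousOn.sub (continuousOn_const.mul (hk.mono Icc_subset_Ici_self))
      (continuousOn_const.mul fun t ht => ?_)
    exact (continuousWithinAt_vconv (hk.mono Ioi_subset_Ici_self)
      (fun t ht => hkb t ht.le) hr).mono Icc_subset_Iic_self
  suffices hpos : ∀ t ∈ Icc 0 T, 0 ≤ ρ t by
    filter_upwards [h, ae_restrict_mem measurableSet_Icc] with t ht ht2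
    rw [ht]; exact hpos t ht2
  have hρeq : ∀ t ∈ Icc 0 T, ρ t = l * k t - l * vconv (smulB ℝ) k ρ volume t := by
    intro t ht
    rw [vconv_congr_right (smulB ℝ) k (h := ρ) (h' := r) ht.2]
    filter_upwards [h] with s hs using hs.symm
  have hid := fun t (ht : t ∈ Ioc 0 T) =>
    resolvent_conv_first_kind hL (hk.mono Icc_subset_Ici_self) hρc hρeq ht
  have hLfin : ∀ a b : ℝ, L (Icc a b) ≠ ⊤ := fun a b => isCompact_Icc.measure_lt_top.ne
  have hL0 : 0 < L.real {0} := by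
    by_contra hcon
    have hz : L.real {0} = 0 := le_antisymm (not_lt.1 hcon) measureReal_nonneg
    have hbd : ∀ s : ℝ, 0 < s → 1 ≤ k 0 * L.real (Ioc 0 s) := by
      intro s hs
      have hi : IntegrableOn (fun u => k (s - u)) (Ico 0 s) L := by
        refine IntegrableOn.mono_set (t := Icc 0 s) ?_ Ico_subset_Icc_self
        refine ContinuousOn.integrableOn_compact isCompact_Icc ?_
        exact hk.comp (by fun_prop) fun u hu => by simpa using hu.2
      calc (1 : ℝ) = ∫ u in Ico 0 s, k (s - u) ∂L := (hL.conv_eq_one s hs).symm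
        _ ≤ ∫ u in Ico 0 s, k 0 ∂L := by
            refine setIntegral_mono_on hi ?_ measurableSet_Ico fun u hu => ?_
            · exact integrableOn_const
                (ne_top_of_le_ne_top (hLfin 0 s) (measure_mono Ico_subset_Icc_self))
            · exact (le_abs_self _).trans (hkb _ (by linarith [hu.2]))
        _ = k 0 * L.real (Ico 0 s) := by
            rw [setIntegral_const, smul_eq_mul, mul_comm]
        _ ≤ k 0 * L.real (Ioc 0 s) := by
            have h1 : L.real (Ico 0 s) ≤ L.real ({0} ∪ Ioc 0 s) := by
              refine measureReal_mono (fun u hu => ?_) ?_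
              · rcases eq_or_lt_of_le hu.1 with h | h
                · exact Or.inl h.symm
                · exact Or.inr ⟨h, hu.2.le⟩
              · refine ne_top_of_le_ne_top (hLfin 0 s) (measure_mono ?_)
                rintro u (rfl | hu)
                · exact ⟨le_rfl, hs.le⟩
                · exact Ioc_subset_Icc_self hu
            have h2 := measureReal_union_le (μ := L) {0} (Ioc 0 s)
            have h3 := hk0 0 le_rfl
            have h4 : L.real (Ico 0 s) ≤ L.real (Ioc 0 s) := by linarith
            exact mul_le_mul_of_nonneg_left h4 h3
    have hk0pos : 0 < k 0 := by
      rcases (hk0 0 le_rfl).lt_or_eq with h | h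
      · exact h
      · have := hbd 1 one_pos
        rw [← h] at this; norm_num at this
    obtain ⟨δ₀, hδ₀, hδ⟩ := tendsto_measure_Ioc_zero (L := L) (c := 1 / k 0) (by positivity)
    have h1 := hbd δ₀ hδ₀
    have h2 := hδ δ₀ le_rfl
    rw [lt_div_iff₀ hk0pos] at h2
    linarith [mul_comm (k 0) (L.real (Ioc 0 δ₀))]
  obtain ⟨t, ht, htmin⟩ := isCompact_Icc.exists_isMinOn (nonempty_Icc.2 hT) hρc
  by_contra! hcon
  obtain ⟨t', ht', hneg'⟩ := hcon
  have hneg : ρ t < 0 := (htmin ht').trans_lt hneg'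
  have hρ0 : 0 ≤ ρ 0 := by
    simp only [hρdef, vconv, Ico_self, Measure.restrict_empty, integral_zero_measure]
    have := mul_nonneg hl.le (hk0 0 le_rfl)
    linarith
  have ht0 : 0 < t := lt_of_le_of_ne ht.1 (by rintro rfl; linarith)
  -- a left neighbourhood of `t` on which `ρ < 0`
  obtain ⟨δ₁, hδ₁, hδ₁t, hnegδ⟩ : ∃ δ₁ > 0, δ₁ < t ∧ ∀ s ∈ Icc (t - δ₁) t, ρ s < 0 := by
    have hev := (hρc t ht).eventually_lt_const hneg
    obtain ⟨ε, hε, hball⟩ := Metric.mem_nhdsWithin_iff.1 hev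
    refine ⟨min (ε / 2) (t / 2), by positivity,
      (min_le_right _ _).trans_lt (by linarith), fun s hs => hball ⟨?_, ?_⟩⟩
    · rw [Metric.mem_ball, Real.dist_eq, abs_lt]
      have := min_le_left (ε / 2) (t / 2)
      constructor <;> linarith [hs.1, hs.2]
    · have := min_le_right (ε / 2) (t / 2)
      exact ⟨by linarith [hs.1], hs.2.trans ht.2⟩
  obtain ⟨δ₀, hδ₀, hLδ⟩ := tendsto_measure_Ioc_zero (L := L) hL0
  set δ₂ := min δ₁ δ₀ with hδ₂
  have hδ₂0 : 0 < δ₂ := lt_min hδ₁ hδ₀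
  have hδ₂1 : δ₂ ≤ δ₁ := min_le_left _ _
  have hδ₂2 : δ₂ ≤ δ₀ := min_le_right _ _
  have hsubT : Icc (t - δ₂) t ⊆ Icc 0 T := Icc_subset_Icc (by linarith) ht.2
  obtain ⟨x, hx, hxt, hxmax⟩ : ∃ x ∈ Icc (t - δ₂) t, x < t ∧ ∀ s ∈ Icc (t - δ₂) t, ρ s ≤ ρ x := by
    obtain ⟨x, hx, hxm⟩ := isCompact_Icc.exists_isMaxOn (nonempty_Icc.2 (by linarith))
      (hρc.mono hsubT)
    rcases hx.2.lt_or_eq with h1 | h1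
    · exact ⟨x, hx, h1, fun s hs => hxm hs⟩
    · have hmem : t - δ₂ ∈ Icc (t - δ₂) t := ⟨le_rfl, by linarith⟩
      refine ⟨t - δ₂, hmem, by linarith, fun s hs => ?_⟩
      have h2 : ρ s ≤ ρ x := hxm hs
      rw [h1] at h2
      exact h2.trans (htmin (hsubT hmem))
  have hxT : x ∈ Icc 0 T := hsubT hx
  have hx0 : 0 < x := by linarith [hx.1]
  set δ := t - x with hδdef
  have hδ0 : 0 < δ := by linarith
  have hδδ₀ : δ ≤ δ₀ := by linarith [hx.1]
  -- the nonnegative function `ρ - ρ t`, extended continuously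
  set F : ℝ → ℝ := fun s => ρ (projIcc 0 T hT s) - ρ t with hF
  have hFc : Continuous F :=
    (hρc.comp_continuous (continuous_subtype_val.comp continuous_projIcc)
      fun s => (projIcc 0 T hT s).2).sub continuous_const
  have hFeq : ∀ s ∈ Icc 0 T, F s = ρ s - ρ t := fun s hs => by
    simp only [hF, projIcc_of_mem hT hs]
  have hF0 : ∀ s, 0 ≤ F s := fun s => sub_nonneg.2 (htmin (projIcc 0 T hT s).2)
  obtain ⟨C, hC⟩ := isCompact_Icc.exists_bound_of_continuousOn hρc
  have hFC : ∀ s, F s ≤ C + |ρ t| := fun s => by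
    have := hC _ (projIcc 0 T hT s).2
    rw [Real.norm_eq_abs] at this
    have h1 := le_abs_self (ρ (projIcc 0 T hT s))
    have h2 := neg_abs_le (ρ t)
    simp only [hF]
    linarith
  have hint : ∀ τ a b, IntegrableOn (fun s => F (τ - s)) (Icc a b) L := fun τ a b =>
    (hFc.comp (by fun_prop : Continuous fun s => τ - s)).continuousOn.integrableOn_compact
      isCompact_Icc
  have hJ : ∀ τ ∈ Icc 0 T, ∫ s in Ico 0 τ, ρ (τ - s) ∂L =
      (∫ s in Ico 0 τ, F (τ - s) ∂L) + ρ t * L.real (Ico 0 τ) := by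
    intro τ hτ
    have e1 : ∫ s in Ico 0 τ, ρ (τ - s) ∂L = ∫ s in Ico 0 τ, (F (τ - s) + ρ t) ∂L := by
      refine setIntegral_congr_fun measurableSet_Ico fun s hs => ?_
      rw [hFeq _ ⟨by linarith [hs.2], by linarith [hs.1, hτ.2]⟩]; ring
    rw [e1, integral_add ((hint τ 0 τ).mono_set Ico_subset_Icc_self)
      (integrableOn_const (ne_top_of_le_ne_top (hLfin 0 τ) (measure_mono Ico_subset_Icc_self))),
      setIntegral_const, smul_eq_mul, mul_comm (ρ t)]
  -- decompositions of the two convolutions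
  have hJx : ∫ s in Ico 0 x, F (x - s) ∂L =
      F x * L.real {0} + ∫ s in Ioo 0 x, F (x - s) ∂L := by
    have e : Ico 0 x = {0} ∪ Ioo 0 x := by
      rw [union_comm]; exact (Ioo_union_left hx0).symm
    rw [e, setIntegral_union (by simp) measurableSet_Ioo
      ((hint x 0 x).mono_set (by simp [hx0.le])) ((hint x 0 x).mono_set Ioo_subset_Icc_self)]
    simp [mul_comm, Measure.real]
  have hJt : ∫ s in Ico 0 t, F (t - s) ∂L ≤
      F x * L.real (Ioc 0 δ) + ∫ s in Ioo δ t, F (t - s) ∂L := by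
    have e : Ico 0 t = {0} ∪ (Ioc 0 δ ∪ Ioo δ t) := by
      ext s
      simp only [mem_Ico, mem_union, mem_singleton_iff, mem_Ioc, mem_Ioo]
      constructor
      · rintro ⟨h1, h2⟩
        rcases h1.eq_or_lt with h | h
        · exact Or.inl h.symm
        · rcases le_or_gt s δ with h' | h'
          · exact Or.inr (Or.inl ⟨h, h'⟩)
          · exact Or.inr (Or.inr ⟨h', h2⟩)
      · rintro (rfl | ⟨h1, h2⟩ | ⟨h1, h2⟩)
        · exact ⟨le_rfl, ht0⟩
        · exact ⟨h1.le, by linarith⟩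
        · exact ⟨by linarith, h2⟩
    have hFt : F t = 0 := by rw [hFeq t ht, sub_self]
    have hle : ∫ s in Ioc 0 δ, F (t - s) ∂L ≤ F x * L.real (Ioc 0 δ) := by
      have : ∫ s in Ioc 0 δ, F (t - s) ∂L ≤ ∫ s in Ioc 0 δ, F x ∂L := by
        refine setIntegral_mono_on ((hint t 0 δ).mono_set Ioc_subset_Icc_self)
          (integrableOn_const
            (ne_top_of_le_ne_top (hLfin 0 δ) (measure_mono Ioc_subset_Icc_self)))
          measurableSet_Ioc fun s hs => ?_
        have hmem : t - s ∈ Icc (t - δ₂) t := ⟨by linarith [hs.2, hx.1], by linarith [hs.1]⟩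
        rw [hFeq _ (hsubT hmem), hFeq _ hxT]
        linarith [hxmax _ hmem]
      rwa [setIntegral_const, smul_eq_mul, mul_comm] at this
    rw [e, setIntegral_union (by simp [hδ0.le]) (measurableSet_Ioc.union measurableSet_Ioo)
      ((hint t 0 t).mono_set (by simp [ht0.le]))
      ((hint t 0 t).mono_set ?_), setIntegral_union ?_ measurableSet_Ioo
      ((hint t 0 δ).mono_set Ioc_subset_Icc_self) ((hint t δ t).mono_set Ioo_subset_Icc_self)]
    · simp only [integral_singleton, sub_zero, hFt, smul_zero, zero_add]
      linarith
    · rw [Set.disjoint_left]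
      intro s hs hs'
      linarith [hs.2, hs'.1]
    · rintro s (hs | hs)
      · exact ⟨hs.1.le, by linarith [hs.2]⟩
      · exact ⟨by linarith [hs.1], hs.2.le⟩
  have hshift : ∫ s in Ioo δ t, F (t - s) ∂L ≤ ∫ s in Ioo 0 x, F (x - s) ∂L := by
    have := setIntegral_Ioo_shift_le hLa hδ0.le (τ := x) (φ := fun s => F (x - s))
      (C := C + |ρ t|) (by fun_prop) (fun s => hF0 _) (fun s => hFC _)
    have e1 : x + δ = t := by rw [hδdef]; ring
    have e2 : ∀ s, x - (s - δ) = t - s := fun s => by rw [hδdef]; ring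
    simpa only [e1, e2] using this
  have hFx : 0 ≤ F x := hF0 x
  have hLle : F x * L.real (Ioc 0 δ) ≤ F x * L.real {0} := by
    exact mul_le_mul_of_nonneg_left (hLδ δ hδδ₀).le hFx
  have hLmono : L.real (Ico 0 x) ≤ L.real (Ico 0 t) :=
    measureReal_mono (Ico_subset_Ico_right hxt.le)
      (ne_top_of_le_ne_top (hLfin 0 t) (measure_mono Ico_subset_Icc_self))
  have h1 := hid t ⟨ht0, ht.2⟩
  have h2 := hid x ⟨hx0, hxT.2⟩
  rw [hJ t ht] at h1
  rw [hJ x hxT] at h2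
  have hρint : IntegrableOn ρ (Icc 0 T) := hρc.integrableOn_compact isCompact_Icc
  have hsplit : ∫ s in Ico 0 t, ρ s = (∫ s in Ico 0 x, ρ s) + ∫ s in Ico x t, ρ s := by
    rw [← setIntegral_union (by simp) measurableSet_Ico
      (hρint.mono_set fun s hs => ⟨hs.1, by linarith [hs.2, hxT.2]⟩)
      (hρint.mono_set fun s hs => ⟨by linarith [hs.1], by linarith [hs.2, ht.2]⟩),
      Ico_union_Ico_eq_Ico hx0.le hxt.le]
  have hlast : ∫ s in Ico x t, ρ s < 0 := by
    have : ∫ s in Ico x t, ρ s ≤ ∫ s in Ico x t, ρ x := by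
      refine setIntegral_mono_on
        (hρint.mono_set fun s hs => ⟨by linarith [hs.1], by linarith [hs.2, ht.2]⟩)
        (integrableOn_const (by simp)) measurableSet_Ico fun s hs => ?_
      exact hxmax s ⟨by linarith [hs.1, hx.1], hs.2.le⟩
    rw [setIntegral_const, smul_eq_mul, Real.volume_real_Ico_of_le hxt.le] at this
    have hρx : ρ x < 0 := hnegδ x ⟨by linarith [hx.1], hx.2⟩
    nlinarith
  rw [hsplit] at h1
  nlinarith [mul_le_mul_of_nonneg_left hLmono (neg_nonneg.2 hneg.le)]

theorem enorm_smulB_le (V : Type*) [NormedAddCommGroup V] [NormedSpace ℝ V] :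
    ‖smulB V‖ₑ ≤ 1 := by
  rw [← ofReal_norm]
  exact (ENNReal.ofReal_le_ofReal ContinuousLinearMap.opNorm_lsmul_le).trans (by simp)

theorem lintegral_expWeight_smulB_le {V : Type*} [NormedAddCommGroup V] [NormedSpace ℝ V]
    {f : ℝ → ℝ} {h : ℝ → V} {T : ℝ} (N : ℕ) (hf : IntegrableOn f (Icc 0 T))
    (hh : IntegrableOn h (Icc 0 T)) :
    ∫⁻ t in Icc 0 T, expWeight N t * ‖vconv (smulB V) f h volume t‖ₑ ≤
      (∫⁻ t in Icc 0 T, expWeight N t * ‖f t‖ₑ) * ∫⁻ t in Icc 0 T, expWeight N t * ‖h t‖ₑ :=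
  (lintegral_expWeight_vconv_le (smulB V) N hf hh).trans
    ((mul_le_mul_left (enorm_smulB_le V) _).trans (one_mul _).le)

theorem le_two_mul_of_le_add_half {a e : ℝ≥0∞} (ha : a ≠ ⊤) (h : a ≤ e + 1 / 2 * a) :
    a ≤ 2 * e := by
  rcases eq_or_ne e ⊤ with rfl | he
  · simp
  lift a to ℝ≥0 using ha
  lift e to ℝ≥0 using he
  have h' : a ≤ e + 1 / 2 * a := by
    have : ((1 / 2 : ℝ≥0) : ℝ≥0∞) = 1 / 2 := by
      rw [ENNReal.coe_div two_ne_zero]; rfl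
    rw [← this] at h
    exact_mod_cast h
  have : a ≤ 2 * e := by
    rw [← NNReal.coe_le_coe] at h' ⊢
    push_cast at h' ⊢
    linarith
  exact_mod_cast this

theorem ae_pos_restrict_Icc (T : ℝ) : ∀ᵐ t ∂(volume.restrict (Icc (0 : ℝ) T)), 0 < t := by
  have hne : ∀ᵐ s ∂(volume.restrict (Icc (0 : ℝ) T)), s ≠ (0 : ℝ) :=
    ae_restrict_of_ae (by simp [ae_iff, measure_singleton])
  filter_upwards [hne, ae_restrict_mem measurableSet_Icc] with s hs hs2
  exact lt_of_le_of_ne hs2.1 (Ne.symm hs)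

/-- Stability of resolvents of the second kind: a kernel dominating a sequence of kernels that
converges to it in `L¹` is the limit of resolvents. -/
theorem tendsto_lintegral_resolvent_sub {k r : ℝ → ℝ} {kn rn : ℕ → ℝ → ℝ} {l T : ℝ}
    (hk : IntegrableOn k (Icc 0 T)) (hkn : ∀ n, IntegrableOn (kn n) (Icc 0 T))
    (hle : ∀ n, ∀ᵐ t ∂(volume.restrict (Icc 0 T)), ‖kn n t‖ₑ ≤ ‖k t‖ₑ)
    (hlim : Filter.Tendsto (fun n => ∫⁻ t in Icc 0 T, ‖k t - kn n t‖ₑ) Filter.atTop (nhds 0))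
    (hr : IntegrableOn r (Icc 0 T)) (hrn : ∀ n, IntegrableOn (rn n) (Icc 0 T))
    (h : ∀ᵐ t ∂(volume.restrict (Icc 0 T)), r t = l * k t - l * vconv (smulB ℝ) k r volume t)
    (hn : ∀ n, ∀ᵐ t ∂(volume.restrict (Icc 0 T)),
      rn n t = l * kn n t - l * vconv (smulB ℝ) (kn n) (rn n) volume t) :
    ∃ N : ℕ, Filter.Tendsto (fun n => ∫⁻ t in Icc 0 T, expWeight N t * ‖r t - rn n t‖ₑ)
      Filter.atTop (nhds 0) := by
  obtain ⟨N, hN⟩ := exists_expWeight_le hk (c := ‖l‖ₑ) (ε := 1 / 2) (by simp) (by simp)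
  refine ⟨N, ?_⟩
  have hw1 : ∀ {f : ℝ → ℝ}, ∫⁻ t in Icc 0 T, expWeight N t * ‖f t‖ₑ ≤ ∫⁻ t in Icc 0 T, ‖f t‖ₑ :=
    fun {f} => setLIntegral_mono' measurableSet_Icc fun t ht =>
      (mul_le_mul_left (expWeight_le_one N ht.1) _).trans (one_mul _).le
  set ρ := ∫⁻ t in Icc 0 T, expWeight N t * ‖r t‖ₑ with hρ
  have hρtop : ρ ≠ ⊤ := lintegral_expWeight_ne_top N hr
  have hbound : ∀ n, ∫⁻ t in Icc 0 T, expWeight N t * ‖r t - rn n t‖ₑ ≤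
      2 * (‖l‖ₑ * (1 + ρ) * ∫⁻ t in Icc 0 T, ‖k t - kn n t‖ₑ) := by
    intro n
    have hd : IntegrableOn (fun t => r t - rn n t) (Icc 0 T) := hr.sub (hrn n)
    have hkd : IntegrableOn (fun t => k t - kn n t) (Icc 0 T) := hk.sub (hkn n)
    refine le_two_mul_of_le_add_half (lintegral_expWeight_ne_top N hd) ?_
    have hpt : ∀ᵐ t ∂(volume.restrict (Icc 0 T)), expWeight N t * ‖r t - rn n t‖ₑ ≤
        ‖l‖ₑ * (expWeight N t * ‖k t - kn n t‖ₑ) +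
        (‖l‖ₑ * (expWeight N t * ‖vconv (smulB ℝ) (fun t => k t - kn n t) r volume t‖ₑ) +
        ‖l‖ₑ * (expWeight N t * ‖vconv (smulB ℝ) (kn n) (fun t => r t - rn n t) volume t‖ₑ)) := by
      filter_upwards [h, hn n, vconv_sub_left (smulB ℝ) hk (hkn n) hr,
        vconv_sub_right (smulB ℝ) (hkn n) hr (hrn n)] with t h1 h2 h3 h4
      have e : r t - rn n t = l * (k t - kn n t) -
          (l * vconv (smulB ℝ) (fun t => k t - kn n t) r volume t +
          l * vconv (smulB ℝ) (kn n) (fun t => r t - rn n t) volume t) := by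
        rw [h3, h4, h1, h2]; ring
      have e2 : ‖r t - rn n t‖ₑ ≤ ‖l‖ₑ * ‖k t - kn n t‖ₑ +
          (‖l‖ₑ * ‖vconv (smulB ℝ) (fun t => k t - kn n t) r volume t‖ₑ +
          ‖l‖ₑ * ‖vconv (smulB ℝ) (kn n) (fun t => r t - rn n t) volume t‖ₑ) := by
        rw [e]
        refine (enorm_sub_le).trans (add_le_add (enorm_mul _ _).le ((enorm_add_le _ _).trans ?_))
        exact add_le_add (enorm_mul _ _).le (enorm_mul _ _).le
      refine (mul_le_mul_right e2 _).trans (le_of_eq ?_)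
      ring
    have mw : ∀ {f : ℝ → ℝ}, IntegrableOn f (Icc 0 T) →
        AEMeasurable (fun t => expWeight N t * ‖f t‖ₑ) (volume.restrict (Icc 0 T)) := fun hf =>
      (measurable_expWeight N).aemeasurable.mul hf.aestronglyMeasurable.enorm
    refine (lintegral_mono_ae hpt).trans ?_
    rw [lintegral_add_left' ((mw hkd).const_mul _), lintegral_add_left'
      ((mw (integrableOn_vconv (smulB ℝ) hkd hr)).const_mul _), lintegral_const_mul'' _ (mw hkd),
      lintegral_const_mul'' _ (mw (integrableOn_vconv (smulB ℝ) hkd hr)),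
      lintegral_const_mul'' _ (mw (integrableOn_vconv (smulB ℝ) (hkn n) hd)), ← add_assoc]
    have hkk : ∫⁻ t in Icc 0 T, expWeight N t * ‖kn n t‖ₑ ≤
        ∫⁻ t in Icc 0 T, expWeight N t * ‖k t‖ₑ :=
      lintegral_mono_ae ((hle n).mono fun t ht => mul_le_mul_right ht _)
    refine add_le_add ?_ ?_
    · calc _ ≤ ‖l‖ₑ * (∫⁻ t in Icc 0 T, ‖k t - kn n t‖ₑ) +
            ‖l‖ₑ * ((∫⁻ t in Icc 0 T, ‖k t - kn n t‖ₑ) * ρ) := by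
            refine add_le_add (mul_le_mul_right hw1 _) (mul_le_mul_right ?_ _)
            exact (lintegral_expWeight_smulB_le N hkd hr).trans (mul_le_mul_left hw1 _)
        _ = _ := by ring
    · calc _ ≤ ‖l‖ₑ * ((∫⁻ t in Icc 0 T, expWeight N t * ‖kn n t‖ₑ) *
            ∫⁻ t in Icc 0 T, expWeight N t * ‖r t - rn n t‖ₑ) :=
            mul_le_mul_right (lintegral_expWeight_smulB_le N (hkn n) hd) _
        _ ≤ ‖l‖ₑ * (∫⁻ t in Icc 0 T, expWeight N t * ‖k t‖ₑ) *
            ∫⁻ t in Icc 0 T, expWeight N t * ‖r t - rn n t‖ₑ := by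
            rw [mul_assoc]; gcongr
        _ ≤ _ := mul_le_mul_left hN _
  refine tendsto_of_tendsto_of_tendsto_of_le_of_le tendsto_const_nhds ?_ (fun _ => zero_le)
    hbound
  have h0 : Filter.Tendsto (fun n => 2 * (‖l‖ₑ * (1 + ρ) * ∫⁻ t in Icc 0 T, ‖k t - kn n t‖ₑ))
      Filter.atTop (nhds (2 * (‖l‖ₑ * (1 + ρ) * 0))) := by
    refine ENNReal.Tendsto.const_mul (ENNReal.Tendsto.const_mul hlim (Or.inr ?_))
      (Or.inr (by simp))
    exact ENNReal.mul_ne_top (by simp) (by simp [hρtop])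
  simpa using h0

/-- A nonincreasing kernel, continuous on `(0, ∞)`, all of whose shifts have nonnegative and
nonincreasing resolvents of the first kind is completely positive. -/
theorem completelyPositive_of_shift {k : ℝ → ℝ} {T : ℝ} (hk : IntegrableOn k (Icc 0 T))
    (hk0 : ∀ t, 0 < t → 0 ≤ k t) (hka : AntitoneOn k (Ioi 0)) (hkc : ContinuousOn k (Ioi 0))
    (hL : ∀ h : ℝ, 0 < h → h ≤ 1 → ∃ L : Measure ℝ,
      IsNonnegResolventFirstKind (fun t => k (t + h)) L ∧
      ∀ t : ℝ, 0 ≤ t → AntitoneOn (fun s => L (Icc s (s + t))) (Ici 0)) :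
    CompletelyPositive k T := by
  intro l hl
  obtain ⟨r, hr, hr1, hr2⟩ := exists_scalar_resolvent hk l
  refine ⟨r, hr, ?_, hr1, hr2⟩
  set η : ℕ → ℝ := fun n => 1 / ((n : ℝ) + 1) with hη
  have hη0 : ∀ n, 0 < η n := fun n => by positivity
  have hη1 : ∀ n, η n ≤ 1 := fun n => by
    rw [hη, div_le_one (by positivity)]
    have : (0 : ℝ) ≤ n := by positivity
    linarith
  have hηlim : Filter.Tendsto η Filter.atTop (nhds 0) := tendsto_one_div_add_atTop_nhds_zero_nat
  have hmaps : ∀ n, MapsTo (fun t => t + η n) (Ici 0) (Ioi 0) := fun n t ht => by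
    have h1 := hη0 n
    have h2 : (0 : ℝ) ≤ t := ht
    exact (by linarith : (0 : ℝ) < t + η n)
  have hknc : ∀ n, ContinuousOn (fun t => k (t + η n)) (Ici 0) := fun n =>
    hkc.comp (by fun_prop) (hmaps n)
  have hkn : ∀ n, IntegrableOn (fun t => k (t + η n)) (Icc 0 T) := fun n =>
    ((hknc n).mono Icc_subset_Ici_self).integrableOn_compact isCompact_Icc
  have hex := fun n => exists_scalar_resolvent (hkn n) l
  choose rn hrn hrn1 hrn2 using hex
  have hrnpos : ∀ n, ∀ᵐ t ∂(volume.restrict (Icc 0 T)), 0 ≤ rn n t := by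
    intro n
    obtain ⟨L, hL1, hL2⟩ := hL (η n) (hη0 n) (hη1 n)
    refine resolvent_nonneg hl (hknc n) (fun t ht => hk0 _ (hmaps n ht)) ?_ hL1 hL2 (hrn n)
      (hrn1 n)
    intro s hs t ht hst
    exact hka (hmaps n hs) (hmaps n ht) (by linarith)
  have hmono : ∀ n, ∀ t, 0 < t → k (t + η n) ≤ k t := fun n t ht =>
    hka ht (hmaps n (le_of_lt ht)) (by linarith [hη0 n])
  have hkd : Filter.Tendsto (fun n => ∫⁻ t in Icc 0 T, ‖k t - k (t + η n)‖ₑ)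
      Filter.atTop (nhds 0) := by
    have := tendsto_lintegral_of_dominated_convergence' (μ := volume.restrict (Icc 0 T))
      (F := fun n t => ‖k t - k (t + η n)‖ₑ) (f := fun _ => 0) (fun t => ‖k t‖ₑ)
      (fun n => (hk.sub (hkn n)).aestronglyMeasurable.enorm) (fun n => ?_) hk.2.ne ?_
    · simpa using this
    · filter_upwards [ae_pos_restrict_Icc T] with t ht
      have h1 := hmono n t ht
      have h2 := hk0 _ (hmaps n (le_of_lt ht))
      rw [Real.enorm_of_nonneg (hk0 t ht), Real.enorm_of_nonneg (by linarith)]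
      exact ENNReal.ofReal_le_ofReal (by linarith)
    · filter_upwards [ae_pos_restrict_Icc T] with t ht
      have h1 : Filter.Tendsto (fun n => t + η n) Filter.atTop (nhds t) := by
        simpa using hηlim.const_add t
      have h2 := ((hkc.continuousAt (Ioi_mem_nhds ht)).tendsto.comp h1).const_sub (k t)
      have h3 := h2.enorm
      simpa using h3
  obtain ⟨N, hN⟩ := tendsto_lintegral_resolvent_sub hk hkn (fun n => by
      filter_upwards [ae_pos_restrict_Icc T] with t ht
      rw [Real.enorm_of_nonneg (hk0 t ht), Real.enorm_of_nonneg (hk0 _ (hmaps n ht.le))]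
      exact ENNReal.ofReal_le_ofReal (hmono n t ht)) hkd hr hrn hr1 hrn1
  · have hz : ∫⁻ t in Icc 0 T, expWeight N t * ENNReal.ofReal (-r t) = 0 := by
      refine le_antisymm (ge_of_tendsto' hN fun n => lintegral_mono_ae ?_) zero_le
      filter_upwards [hrnpos n] with t ht
      gcongr
      rw [← ofReal_norm, Real.norm_eq_abs]
      refine ENNReal.ofReal_le_ofReal ?_
      rw [abs_sub_comm]
      linarith [le_abs_self (rn n t - r t)]
    have hm : AEMeasurable (fun t => expWeight N t * ENNReal.ofReal (-r t))
        (volume.restrict (Icc 0 T)) := (measurable_expWeight N).aemeasurable.mul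
      hr.aestronglyMeasurable.aemeasurable.neg.ennreal_ofReal
    rw [lintegral_eq_zero_iff' hm] at hz
    filter_upwards [hz] with t ht
    simp only [Pi.zero_apply, mul_eq_zero, expWeight_ne_zero, false_or,
      ENNReal.ofReal_eq_zero] at ht
    linarith

/-! ### Comparison for completely positive kernels -/

section Order

variable {V : Type*} [NormedAddCommGroup V] [NormedSpace ℝ V]

theorem vconv_nonneg {f h : ℝ → ℝ} {ρ : Measure ℝ} {t T : ℝ} (ht : t ≤ T)
    (hf : ∀ s, 0 < s → 0 ≤ f s) (hh : ∀ᵐ s ∂(ρ.restrict (Icc 0 T)), 0 ≤ h s) :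
    0 ≤ vconv (smulB ℝ) f h ρ t := by
  have hh' : ∀ᵐ s ∂(ρ.restrict (Ico 0 t)), 0 ≤ h s := ae_mono (Measure.restrict_mono
    (Ico_subset_Icc_self.trans (Icc_subset_Icc_right ht)) le_rfl) hh
  refine integral_nonneg_of_ae ?_
  filter_upwards [hh', ae_restrict_mem measurableSet_Ico] with s hs hs2
  simpa using mul_nonneg (hf _ (sub_pos.2 hs2.2)) hs

theorem norm_vconv_le {f : ℝ → ℝ} (h : ℝ → V) (ρ : Measure ℝ) (t : ℝ)
    (hf : ∀ s, 0 < s → 0 ≤ f s) :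
    ‖vconv (smulB V) f h ρ t‖ ≤ vconv (smulB ℝ) f (fun s => ‖h s‖) ρ t := by
  refine (norm_integral_le_integral_norm _).trans (le_of_eq ?_)
  refine setIntegral_congr_fun measurableSet_Ico fun s hs => ?_
  simp [norm_smul, abs_of_nonneg (hf _ (sub_pos.2 hs.2))]

theorem vconv_mono {f h h' : ℝ → ℝ} {ρ : Measure ℝ} [SFinite ρ] {T : ℝ}
    (hfi : IntegrableOn f (Icc 0 T)) (hhi : IntegrableOn h (Icc 0 T) ρ)
    (hhi' : IntegrableOn h' (Icc 0 T) ρ) (hf : ∀ s, 0 < s → 0 ≤ f s)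
    (hh : ∀ᵐ s ∂(ρ.restrict (Icc 0 T)), h s ≤ h' s) :
    ∀ᵐ t ∂(volume.restrict (Icc 0 T)),
      vconv (smulB ℝ) f h ρ t ≤ vconv (smulB ℝ) f h' ρ t := by
  filter_upwards [vconv_sub_right (smulB ℝ) hfi hhi' hhi, ae_restrict_mem measurableSet_Icc]
    with t ht ht2
  have := vconv_nonneg (h := fun s => h' s - h s) ht2.2 hf
    (hh.mono fun s hs => sub_nonneg.2 hs)
  rw [ht] at this
  linarith

end Order

/-- The resolvents of a completely positive kernel can be chosen nonnegative everywhere. -/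
theorem CompletelyPositive.exists_nonneg {k : ℝ → ℝ} {T : ℝ} (h : CompletelyPositive k T)
    {l : ℝ} (hl : 0 < l) : ∃ r : ℝ → ℝ, IntegrableOn r (Icc 0 T) ∧ (∀ t, 0 ≤ r t) ∧
    (∀ᵐ t ∂(volume.restrict (Icc 0 T)), r t = l * k t - l * vconv (smulB ℝ) k r volume t) ∧
    ∀ᵐ t ∂(volume.restrict (Icc 0 T)), r t = l * k t - l * vconv (smulB ℝ) r k volume t := by
  obtain ⟨r, hr, hr0, h1, h2⟩ := h l hl
  have hae : r =ᵐ[volume.restrict (Icc 0 T)] fun t => max (r t) 0 := by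
    filter_upwards [hr0] with t ht using (max_eq_left ht).symm
  refine ⟨fun t => max (r t) 0, hr.congr hae, fun t => le_max_right _ _, ?_, ?_⟩
  · filter_upwards [hae, h1, ae_restrict_mem measurableSet_Icc] with t e1 e2 ht
    rw [← e1, ← vconv_congr_right (smulB ℝ) k ht.2 hae, e2]
  · filter_upwards [hae, h2, vconv_congr_left (smulB ℝ) k volume hae] with t e1 e2 e3
    rw [← e1, ← e3, e2]

/-- A solution `χ = k ∗ (f ρ) + k ∗ h` of a linear equation with kernel `k`, expressed through the
resolvent `r` of `l k`. -/
theorem eq_resolvent_conv {V : Type*} [NormedAddCommGroup V] [NormedSpace ℝ V] [CompleteSpace V]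
    {k r : ℝ → ℝ} {l T : ℝ} {ρ : Measure ℝ} [SFinite ρ] {f h χ : ℝ → V} (hl : 0 < l)
    (hk : IntegrableOn k (Icc 0 T)) (hr : IntegrableOn r (Icc 0 T))
    (hrk : ∀ᵐ t ∂(volume.restrict (Icc 0 T)), r t = l * k t - l * vconv (smulB ℝ) r k volume t)
    (hf : IntegrableOn f (Icc 0 T) ρ) (hh : IntegrableOn h (Icc 0 T))
    (hχ : ∀ᵐ t ∂(volume.restrict (Icc 0 T)),
      χ t = vconv (smulB V) k f ρ t + vconv (smulB V) k h volume t) :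
    ∀ᵐ t ∂(volume.restrict (Icc 0 T)),
      χ t = vconv (smulB V) r (fun s => χ s + l⁻¹ • h s) volume t +
        l⁻¹ • vconv (smulB V) r f ρ t := by
  have hkf := integrableOn_vconv (smulB V) hk hf
  have hkh := integrableOn_vconv (smulB V) hk hh
  have hχi : IntegrableOn χ (Icc 0 T) := by
    refine (hkf.add hkh).congr ?_
    filter_upwards [hχ] with t ht using ht.symm
  -- `r ∗ (k ∗ g) = k ∗ g - l⁻¹ (r ∗ g)` for both forcing terms
  have key : ∀ {ρ : Measure ℝ} [SFinite ρ] {g : ℝ → V}, IntegrableOn g (Icc 0 T) ρ →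
      ∀ᵐ t ∂(volume.restrict (Icc 0 T)),
        vconv (smulB V) r (vconv (smulB V) k g ρ) volume t =
          vconv (smulB V) k g ρ t - l⁻¹ • vconv (smulB V) r g ρ t := by
    intro ρ _ g hg
    have hrk2 : vconv (smulB ℝ) r k volume =ᵐ[volume.restrict (Icc 0 T)]
        fun t => k t - l⁻¹ • r t := by
      filter_upwards [hrk] with t ht
      rw [ht, smul_eq_mul]; field_simp; ring
    filter_upwards [vconv_assoc (smulB V) (smulB V) (smulB ℝ) (smulB V)
      (fun a b v => by simp [smul_smul, mul_comm]) hr hk hg, vconv_congr_left (smulB V) g ρ hrk2,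
      vconv_sub_left (smulB V) hk (hr.smul l⁻¹) hg] with t e1 e2 e3
    rw [e1, e2]
    exact e3.trans (by rw [← vconv_smul_left]; rfl)
  have hχr : ∀ t ∈ Icc 0 T, vconv (smulB V) r χ volume t =
      vconv (smulB V) r (fun s => vconv (smulB V) k f ρ s + vconv (smulB V) k h volume s)
        volume t := fun t ht => vconv_congr_right _ _ ht.2 hχ
  filter_upwards [hχ, key hf, key hh, vconv_add_right (smulB V) hr hkf hkh,
    vconv_add_right (smulB V) hr hχi (hh.smul l⁻¹), ae_restrict_mem measurableSet_Icc]
    with t e1 e2 e3 e4 e5 ht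
  have e6 : vconv (smulB V) r (l⁻¹ • h) volume t = l⁻¹ • vconv (smulB V) r h volume t :=
    vconv_smul_right (smulB V) r h volume l⁻¹ t
  have e7 : vconv (smulB V) r (fun s => χ s + l⁻¹ • h s) volume t =
      vconv (smulB V) r χ volume t + l⁻¹ • vconv (smulB V) r h volume t := e5.trans (by rw [e6])
  rw [e7, hχr t ht, e4, e2, e3, e1]
  abel

/-- If `p ≤ r ∗ (p + w / l)` for the resolvent `r` of `l k`, then `p ≤ k ∗ w`. -/
theorem le_conv_of_le_resolvent_conv {k r p w : ℝ → ℝ} {l T : ℝ} (hl : 0 < l)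
    (hk : IntegrableOn k (Icc 0 T)) (hk0 : ∀ t, 0 < t → 0 ≤ k t)
    (hr : IntegrableOn r (Icc 0 T))
    (hrk : ∀ᵐ t ∂(volume.restrict (Icc 0 T)), r t = l * k t - l * vconv (smulB ℝ) k r volume t)
    (hp : IntegrableOn p (Icc 0 T)) (hw : IntegrableOn w (Icc 0 T))
    (h : ∀ᵐ t ∂(volume.restrict (Icc 0 T)),
      p t ≤ vconv (smulB ℝ) r (fun s => p s + l⁻¹ * w s) volume t) :
    ∀ᵐ t ∂(volume.restrict (Icc 0 T)), p t ≤ vconv (smulB ℝ) k w volume t := by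
  set g : ℝ → ℝ := fun s => p s + l⁻¹ * w s with hg
  have hgi : IntegrableOn g (Icc 0 T) := hp.add (hw.const_mul _)
  set q := vconv (smulB ℝ) r g volume with hq
  have hqi : IntegrableOn q (Icc 0 T) := integrableOn_vconv _ hr hgi
  have hkr2 : vconv (smulB ℝ) k r volume =ᵐ[volume.restrict (Icc 0 T)]
      fun t => k t - l⁻¹ • r t := by
    filter_upwards [hrk] with t ht
    rw [ht, smul_eq_mul]; field_simp; ring
  filter_upwards [h, vconv_assoc (smulB ℝ) (smulB ℝ) (smulB ℝ) (smulB ℝ)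
      (fun a b v => by simp [mul_assoc]) hk hr hgi, vconv_congr_left (smulB ℝ) g volume hkr2,
      vconv_sub_left (smulB ℝ) hk (hr.smul l⁻¹) hgi,
      vconv_add_right (smulB ℝ) hk hp (hw.const_mul l⁻¹), vconv_sub_right (smulB ℝ) hk hqi hp,
      ae_restrict_mem measurableSet_Icc] with t h1 e1 e2 e3 e4 e5 ht
  have e6 : vconv (smulB ℝ) (l⁻¹ • r) g volume t = l⁻¹ * vconv (smulB ℝ) r g volume t :=
    vconv_smul_left (smulB ℝ) r g volume l⁻¹ t
  have e7 := vconv_smul_right (smulB ℝ) k w volume l⁻¹ t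
  have hd := vconv_nonneg (h := fun s => q s - p s) ht.2 hk0 (h.mono fun s hs => sub_nonneg.2 hs)
  simp only [smul_eq_mul] at e7
  rw [e5] at hd
  have e8 : vconv (smulB ℝ) k q volume t = vconv (smulB ℝ) k g volume t - l⁻¹ * q t := by
    rw [hq, e1, e2]
    exact e3.trans (by rw [e6])
  rw [e8, hg, e4, e7] at hd
  have hl' : 0 < l⁻¹ := inv_pos.2 hl
  have : l⁻¹ * q t ≤ l⁻¹ * vconv (smulB ℝ) k w volume t := by linarith
  exact h1.trans (le_of_mul_le_mul_left this hl')

theorem lintegral_enorm_rpow_two_ne_top {V : Type*} [NormedAddCommGroup V] {f : ℝ → V}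
    {μ : Measure ℝ} (hf : MemLp f 2 μ) : ∫⁻ t, ‖f t‖ₑ ^ (2 : ℝ) ∂μ ≠ ⊤ := by
  have := lintegral_rpow_enorm_lt_top_of_eLpNorm_lt_top (p := 2) (by simp) (by simp) hf.2
  simpa using this.ne

/-- The maximum principle for systems with completely positive kernels `k i`. The functions `v i`
are subsolutions, for each resolvent of `l (k i)` with `l = n + l₀`, up to errors `e n i` that
vanish as `n → ∞`. -/
theorem ae_nonpos_of_le_resolvent_conv {m : ℕ} {k : Fin m → ℝ → ℝ} {v : Fin m → ℝ → ℝ}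
    {e : ℕ → Fin m → ℝ → ℝ} {T c l₀ : ℝ} (hl₀ : 0 < l₀) (hc : 1 ≤ c)
    (hk : ∀ i, IntegrableOn (k i) (Icc 0 T))
    (hk2 : ∀ i, MemLp (k i) 2 (volume.restrict (Icc 0 T)))
    (hk0 : ∀ i t, 0 < t → 0 ≤ k i t) (hcp : ∀ i, CompletelyPositive (k i) T)
    (hv : ∀ i, IntegrableOn (v i) (Icc 0 T)) (he : ∀ n i, IntegrableOn (e n i) (Icc 0 T))
    (he0 : ∀ n i t, 0 ≤ e n i t)
    (helim : ∀ i, Filter.Tendsto (fun n => ∫⁻ t in Icc 0 T, ENNReal.ofReal (e n i t))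
      Filter.atTop (nhds 0))
    (h : ∀ (n : ℕ) (i : Fin m) (r : ℝ → ℝ), (∀ t, 0 ≤ r t) → IntegrableOn r (Icc 0 T) →
      (∀ᵐ t ∂(volume.restrict (Icc 0 T)),
        r t = (n + l₀) * k i t - (n + l₀) * vconv (smulB ℝ) r (k i) volume t) →
      ∃ g : ℝ → ℝ, IntegrableOn g (Icc 0 T) ∧
        (∀ᵐ t ∂(volume.restrict (Icc 0 T)), v i t ≤ vconv (smulB ℝ) r g volume t) ∧
        ∀ᵐ t ∂(volume.restrict (Icc 0 T)), g t ≤ max (v i t) 0 +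
          (n + l₀)⁻¹ * (c * ∑ j, max (v j t) 0 + e n i t)) :
    ∀ᵐ t ∂(volume.restrict (Icc 0 T)), ∀ i, v i t ≤ 0 := by
  set p : Fin m → ℝ → ℝ := fun i t => max (v i t) 0 with hp
  have hp0 : ∀ i t, 0 ≤ p i t := fun i t => le_max_right _ _
  have hpi : ∀ i, IntegrableOn (p i) (Icc 0 T) := fun i => (hv i).pos_part
  have hsum : IntegrableOn (fun t => ∑ j, p j t) (Icc 0 T) :=
    integrable_finsetSum _ fun j _ => hpi j
  set w : ℕ → Fin m → ℝ → ℝ := fun n i t => c * ∑ j, p j t + e n i t with hw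
  have hwi : ∀ n i, IntegrableOn (w n i) (Icc 0 T) := fun n i => (hsum.const_mul c).add (he n i)
  have hc0 : 0 ≤ c := by linarith
  have hw0 : ∀ n i t, 0 ≤ w n i t := fun n i t =>
    add_nonneg (mul_nonneg hc0 (Finset.sum_nonneg fun j _ => hp0 j t)) (he0 n i t)
  have hle : ∀ n i, ∀ᵐ t ∂(volume.restrict (Icc 0 T)),
      p i t ≤ vconv (smulB ℝ) (k i) (w n i) volume t := by
    intro n i
    have hl : 0 < (n : ℝ) + l₀ := by positivity
    obtain ⟨r, hr, hr0, hr1, hr2⟩ := (hcp i).exists_nonneg hl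
    obtain ⟨g, hg, hvg, hgle⟩ := h n i r hr0 hr hr2
    have hsi : IntegrableOn (fun t => p i t + ((n : ℝ) + l₀)⁻¹ * w n i t) (Icc 0 T) :=
      (hpi i).add ((hwi n i).const_mul _)
    refine le_conv_of_le_resolvent_conv hl (hk i) (hk0 i) hr hr1 (hpi i) (hwi n i) ?_
    filter_upwards [hvg, vconv_mono hr hg hsi (fun s _ => hr0 s) hgle,
      ae_restrict_mem measurableSet_Icc] with t h1 h2 ht
    refine max_le (h1.trans h2) (vconv_nonneg ht.2 (fun s _ => hr0 s) (.of_forall fun s => ?_))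
    exact add_nonneg (hp0 i s) (mul_nonneg (inv_pos.2 hl).le (hw0 n i s))
  set κ : ℝ → ℝ := fun t => m * ∑ j, |k j t| with hκ
  have hκ2 : MemLp κ 2 (volume.restrict (Icc 0 T)) :=
    (memLp_finsetSum Finset.univ fun j _ => (hk2 j).abs).const_mul _
  have hkκ : ∀ i t, m * ‖k i t‖ₑ ≤ ‖κ t‖ₑ := by
    intro i t
    have h1 : |k i t| ≤ ∑ j, |k j t| :=
      Finset.single_le_sum (f := fun j => |k j t|) (fun j _ => abs_nonneg _) (Finset.mem_univ i)
    rw [← ofReal_norm, ← ofReal_norm, ← ENNReal.ofReal_natCast,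
      ← ENNReal.ofReal_mul (by positivity)]
    refine ENNReal.ofReal_le_ofReal ?_
    rw [Real.norm_eq_abs, Real.norm_eq_abs, hκ]
    refine (mul_le_mul_of_nonneg_left h1 (by positivity)).trans (le_abs_self _)
  have hy := ae_eq_zero_of_le_lconv (T := T) (k := fun t => ‖κ t‖ₑ)
    (c := fun _ => ENNReal.ofReal c) (y := fun t => ∑ j, ENNReal.ofReal (p j t))
    (e := fun n t => ∑ i, ENNReal.ofReal (e n i t)) hκ2.1.enorm
    (lintegral_enorm_rpow_two_ne_top hκ2) aemeasurable_const ?_ ?_ ?_ ?_ ?_ ?_ ?_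
  · filter_upwards [hy] with t ht i
    rw [Finset.sum_eq_zero_iff] at ht
    have := ht i (Finset.mem_univ i)
    rw [ENNReal.ofReal_eq_zero] at this
    exact (le_max_left _ _).trans this
  · rw [lintegral_const]
    exact ENNReal.mul_ne_top (by simp) (by simp)
  · intro t; simpa using hc
  · exact Finset.aemeasurable_fun_sum _ fun i _ =>
      (hpi i).aestronglyMeasurable.aemeasurable.ennreal_ofReal
  · rw [lintegral_const_mul' _ _ ENNReal.ofReal_ne_top]
    refine ENNReal.mul_ne_top ENNReal.ofReal_ne_top ?_
    have e1 : ∀ t, ∑ j, ENNReal.ofReal (p j t) = ‖∑ j, p j t‖ₑ := fun t => by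
      rw [Real.enorm_of_nonneg (Finset.sum_nonneg fun j _ => hp0 j t),
        ENNReal.ofReal_sum_of_nonneg fun j _ => hp0 j t]
    simp_rw [e1]
    exact hsum.2.ne
  · exact fun n => Finset.aemeasurable_fun_sum _ fun i _ =>
      (he n i).aestronglyMeasurable.aemeasurable.ennreal_ofReal
  · have h1 := tendsto_finsetSum Finset.univ fun i _ => helim i
    simp only [Finset.sum_const_zero] at h1
    refine h1.congr fun n => ?_
    rw [lintegral_finsetSum' _ fun i _ =>
      (he n i).aestronglyMeasurable.aemeasurable.ennreal_ofReal]
  · intro n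
    filter_upwards [ae_all_iff.2 (hle n)] with t ht
    have hW : ∀ i s, ‖w n i s‖ₑ ≤ ENNReal.ofReal c * (∑ j, ENNReal.ofReal (p j s)) +
        ∑ i, ENNReal.ofReal (e n i s) := by
      intro i s
      rw [Real.enorm_of_nonneg (hw0 n i s), hw, ENNReal.ofReal_add
        (mul_nonneg hc0 (Finset.sum_nonneg fun j _ => hp0 j s)) (he0 n i s),
        ENNReal.ofReal_mul hc0, ENNReal.ofReal_sum_of_nonneg fun j _ => hp0 j s]
      gcongr
      exact Finset.single_le_sum (f := fun i => ENNReal.ofReal (e n i s))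
        (fun j _ => zero_le) (Finset.mem_univ i)
    have hone : ∀ i, m * ENNReal.ofReal (p i t) ≤ lconv (fun s => ‖κ s‖ₑ)
        (fun s => ENNReal.ofReal c * (∑ j, ENNReal.ofReal (p j s)) +
          ∑ i, ENNReal.ofReal (e n i s)) volume t := by
      intro i
      calc m * ENNReal.ofReal (p i t)
          ≤ m * ‖vconv (smulB ℝ) (k i) (w n i) volume t‖ₑ := by
            gcongr
            rw [← ofReal_norm]
            exact ENNReal.ofReal_le_ofReal ((ht i).trans (le_abs_self _))
        _ ≤ m * lconv (fun s => ‖k i s‖ₑ) (fun s => ‖w n i s‖ₑ) volume t := by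
            gcongr
            exact (enorm_vconv_le _ _ _ _ _).trans
              ((mul_le_mul_left (enorm_smulB_le ℝ) _).trans (one_mul _).le)
        _ = ∫⁻ s in Ico 0 t, m * (‖k i (t - s)‖ₑ * ‖w n i s‖ₑ) := by
            rw [lconv, lintegral_const_mul' _ _ (by simp)]
        _ ≤ _ := by
            refine lintegral_mono fun s => ?_
            rw [← mul_assoc]
            exact mul_le_mul' (hkκ i _) (hW i s)
    rcases Nat.eq_zero_or_pos m with hm | hm
    · subst hm; simp
    · have h2 : (m : ℝ≥0∞) * ∑ i, ENNReal.ofReal (p i t) ≤ m * lconv (fun s => ‖κ s‖ₑ)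
        (fun s => ENNReal.ofReal c * (∑ j, ENNReal.ofReal (p j s)) +
          ∑ i, ENNReal.ofReal (e n i s)) volume t := by
        rw [Finset.mul_sum]
        refine (Finset.sum_le_card_nsmul _ _ _ fun i _ => hone i).trans ?_
        simp
      exact (ENNReal.mul_le_mul_iff_right (by simpa using hm.ne') (by simp)).1 h2

/-- The properties of the components of an admissible kernel that the comparison results use. -/
structure PosKernels {m : ℕ} (K : Fin m → ℝ → ℝ) (T : ℝ) : Prop where
  memLp : ∀ i, MemLp (K i) 2 (volume.restrict (Icc 0 T))
  nonneg : ∀ i t, 0 < t → 0 ≤ K i t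
  completelyPositive : ∀ i, CompletelyPositive (K i) T

theorem PosKernels.integrableOn {m : ℕ} {K : Fin m → ℝ → ℝ} {T : ℝ} (hK : PosKernels K T)
    (i : Fin m) : IntegrableOn (K i) (Icc 0 T) :=
  (hK.memLp i).integrable (by norm_num)

section Pointwise

variable {m : ℕ} {B : Fin m → ℝ} {i : Fin m}

theorem sum_split_le {v : Fin m → ℝ} {l x c : ℝ} (hB : ∀ j, j ≠ i → 0 ≤ B j)
    (hc : ∑ j, |B j| ≤ c)
    (hx : x ≤ (l + B i) * max (v i) 0 + ∑ j ∈ Finset.univ.erase i, B j * v j) :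
    x ≤ l * max (v i) 0 + c * ∑ j, max (v j) 0 := by
  set p : Fin m → ℝ := fun j => max (v j) 0 with hp
  have hp0 : ∀ j, 0 ≤ p j := fun j => le_max_right _ _
  have h1 : ∑ j ∈ Finset.univ.erase i, B j * v j ≤ ∑ j ∈ Finset.univ.erase i, |B j| * p j := by
    refine Finset.sum_le_sum fun j hj => ?_
    have hBj := hB j (Finset.ne_of_mem_erase hj)
    rw [abs_of_nonneg hBj]
    exact mul_le_mul_of_nonneg_left (le_max_left _ _) hBj
  have h2 : |B i| * p i + ∑ j ∈ Finset.univ.erase i, |B j| * p j = ∑ j, |B j| * p j :=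
    Finset.add_sum_erase _ (fun j => |B j| * p j) (Finset.mem_univ i)
  have h3 : ∑ j, |B j| * p j ≤ c * ∑ j, p j := by
    rw [Finset.mul_sum]
    refine Finset.sum_le_sum fun j _ => mul_le_mul_of_nonneg_right ?_ (hp0 j)
    exact (Finset.single_le_sum (f := fun j => |B j|) (fun j _ => abs_nonneg _)
      (Finset.mem_univ j)).trans hc
  have h4 : B i * p i ≤ |B i| * p i := mul_le_mul_of_nonneg_right (le_abs_self _) (hp0 i)
  have h5 : (l + B i) * p i = l * p i + B i * p i := by ring
  linarith

theorem norm_add_smul_sub_le {χ : Fin m → ℂ} {u : Fin m → ℝ} {z : ℂ} {l c : ℝ} (hl0 : 0 < l)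
    (hB : ∀ j, j ≠ i → 0 ≤ B j) (hl : 0 ≤ l + B i) (hc : ∑ j, |B j| ≤ c) :
    ‖χ i + l⁻¹ • ((∑ j, (B j : ℂ) * χ j) + z * χ i)‖ - (u i + l⁻¹ * ∑ j, B j * u j) ≤
      max (‖χ i‖ - u i) 0 + l⁻¹ * (c * ∑ j, max (‖χ j‖ - u j) 0 +
        max (‖((l + B i : ℝ) : ℂ) + z‖ - (l + B i)) 0 * ‖χ i‖) := by
  have hS := Finset.add_sum_erase Finset.univ (fun j => (B j : ℂ) * χ j) (Finset.mem_univ i)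
  have hU := Finset.add_sum_erase Finset.univ (fun j => B j * u j) (Finset.mem_univ i)
  have e1 : χ i + l⁻¹ • ((∑ j, (B j : ℂ) * χ j) + z * χ i) =
      l⁻¹ • ((((l + B i : ℝ) : ℂ) + z) * χ i +
        ∑ j ∈ Finset.univ.erase i, (B j : ℂ) * χ j) := by
    rw [← hS, Complex.real_smul, Complex.real_smul]
    have : (l : ℂ) ≠ 0 := by exact_mod_cast hl0.ne'
    push_cast
    field_simp
    ring
  have e2 : ‖(((l + B i : ℝ) : ℂ) + z) * χ i +
        ∑ j ∈ Finset.univ.erase i, (B j : ℂ) * χ j‖ ≤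
      ‖((l + B i : ℝ) : ℂ) + z‖ * ‖χ i‖ + ∑ j ∈ Finset.univ.erase i, B j * ‖χ j‖ := by
    refine (norm_add_le _ _).trans (add_le_add (norm_mul_le _ _) ((norm_sum_le _ _).trans ?_))
    refine Finset.sum_le_sum fun j hj => ?_
    rw [norm_mul, Complex.norm_real, Real.norm_of_nonneg (hB j (Finset.ne_of_mem_erase hj))]
  set E := max (‖((l + B i : ℝ) : ℂ) + z‖ - (l + B i)) 0 * ‖χ i‖ with hE
  have e3 : ‖((l + B i : ℝ) : ℂ) + z‖ * ‖χ i‖ ≤ (l + B i) * ‖χ i‖ + E := by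
    have := mul_le_mul_of_nonneg_right
      (le_max_left (‖((l + B i : ℝ) : ℂ) + z‖ - (l + B i)) 0) (norm_nonneg (χ i))
    rw [sub_mul] at this
    linarith
  have key := sum_split_le (v := fun j => ‖χ j‖ - u j) (l := l) (c := c) hB hc
    (x := l * (‖χ i + l⁻¹ • ((∑ j, (B j : ℂ) * χ j) + z * χ i)‖ -
      (u i + l⁻¹ * ∑ j, B j * u j)) - E) ?_
  · have hl' : 0 < l⁻¹ := inv_pos.2 hl0
    refine le_of_mul_le_mul_left ?_ hl0
    have e4 : l * (max (‖χ i‖ - u i) 0 + l⁻¹ * (c * ∑ j, max (‖χ j‖ - u j) 0 + E)) =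
        l * max (‖χ i‖ - u i) 0 + (c * ∑ j, max (‖χ j‖ - u j) 0 + E) := by
      field_simp
    rw [e4]
    linarith
  · rw [e1, norm_smul, Real.norm_of_nonneg (inv_pos.2 hl0).le, mul_sub, ← mul_assoc,
      mul_inv_cancel₀ hl0.ne', one_mul, mul_add, ← mul_assoc, mul_inv_cancel₀ hl0.ne', one_mul,
      ← hU]
    have e5 : ∑ j ∈ Finset.univ.erase i, B j * (‖χ j‖ - u j) =
        ∑ j ∈ Finset.univ.erase i, B j * ‖χ j‖ - ∑ j ∈ Finset.univ.erase i, B j * u j := by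
      rw [← Finset.sum_sub_distrib]
      exact Finset.sum_congr rfl fun j _ => mul_sub _ _ _
    have e6 := mul_le_mul_of_nonneg_left (le_max_left (‖χ i‖ - u i) 0) hl
    simp only [e5]
    linarith

theorem neg_add_mul_le {χ : Fin m → ℝ} {z l c h : ℝ} (hl0 : 0 < l)
    (hB : ∀ j, j ≠ i → 0 ≤ B j) (hc : ∑ j, |B j| ≤ c) (hz : z ≤ 0)
    (hh : (∑ j, B j * χ j) + z * χ i ≤ h) :
    -(χ i + l⁻¹ * h) ≤ max (-χ i) 0 + l⁻¹ * (c * ∑ j, max (-χ j) 0 +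
        max (-(l + B i + z)) 0 * |χ i|) := by
  have hS := Finset.add_sum_erase Finset.univ (fun j => B j * χ j) (Finset.mem_univ i)
  set E := max (-(l + B i + z)) 0 * |χ i| with hE
  have hE0 : 0 ≤ E := mul_nonneg (le_max_right _ _) (abs_nonneg _)
  have e1 : (l + B i + z) * (-χ i) ≤ (l + B i) * max (-χ i) 0 + E := by
    rcases le_total 0 (-χ i) with h1 | h1
    · rw [max_eq_left h1]
      nlinarith
    · rw [max_eq_right h1, mul_zero, zero_add, hE, abs_of_nonneg (by linarith)]
      have := mul_le_mul_of_nonneg_right (le_max_left (-(l + B i + z)) 0)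
        (by linarith : 0 ≤ χ i)
      linarith
  have key := sum_split_le (v := fun j => -χ j) (l := l) (c := c) hB hc
    (x := l * -(χ i + l⁻¹ * h) - E) ?_
  · refine le_of_mul_le_mul_left ?_ hl0
    have e4 : l * (max (-χ i) 0 + l⁻¹ * (c * ∑ j, max (-χ j) 0 + E)) =
        l * max (-χ i) 0 + (c * ∑ j, max (-χ j) 0 + E) := by
      field_simp
    rw [e4]
    linarith
  · have e2 : l * -(χ i + l⁻¹ * h) = -(l * χ i) - h := by field_simp; ring
    have e3 : ∑ j ∈ Finset.univ.erase i, B j * -χ j =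
        -∑ j ∈ Finset.univ.erase i, B j * χ j := by
      rw [← Finset.sum_neg_distrib]
      exact Finset.sum_congr rfl fun j _ => mul_neg _ _
    simp only [e2, e3]
    rw [← hS] at hh
    nlinarith

end Pointwise

section Comparison

variable {m : ℕ} {K : Fin m → ℝ → ℝ} {B : Fin m → Fin m → ℝ} {T : ℝ} {ν : Measure ℝ}

theorem tendsto_lintegral_ofReal_of_dominated {e : ℕ → ℝ → ℝ} {G : ℝ → ℝ}
    (he : ∀ n, AEStronglyMeasurable (e n) (volume.restrict (Icc 0 T)))
    (hG : IntegrableOn G (Icc 0 T))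
    (hb : ∀ n, ∀ᵐ t ∂(volume.restrict (Icc 0 T)), e n t ≤ G t)
    (hlim : ∀ᵐ t ∂(volume.restrict (Icc 0 T)),
      Filter.Tendsto (fun n => e n t) Filter.atTop (nhds 0)) :
    Filter.Tendsto (fun n => ∫⁻ t in Icc 0 T, ENNReal.ofReal (e n t)) Filter.atTop (nhds 0) := by
  have := tendsto_lintegral_of_dominated_convergence' (μ := volume.restrict (Icc 0 T))
    (F := fun n t => ENNReal.ofReal (e n t)) (f := fun _ => 0) (fun t => ‖G t‖ₑ)
    (fun n => (he n).aemeasurable.ennreal_ofReal) (fun n => ?_) hG.2.ne ?_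
  · simpa using this
  · filter_upwards [hb n] with t ht
    rw [← ofReal_norm]
    exact ENNReal.ofReal_le_ofReal (ht.trans (le_abs_self _))
  · filter_upwards [hlim] with t ht
    simpa using ENNReal.tendsto_ofReal ht

theorem tendsto_natCast_add_atTop (a : ℝ) :
    Filter.Tendsto (fun n : ℕ => (n : ℝ) + a) Filter.atTop Filter.atTop :=
  Filter.tendsto_atTop_add_const_right _ _ tendsto_natCast_atTop_atTop

theorem tendsto_norm_add_sub {z : ℂ} (hz : z.re ≤ 0) {a : ℕ → ℝ} (ha : ∀ n, 0 < a n)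
    (hlim : Filter.Tendsto a Filter.atTop Filter.atTop) :
    Filter.Tendsto (fun n => max (‖((a n : ℝ) : ℂ) + z‖ - a n) 0) Filter.atTop (nhds 0) := by
  have h1 : Filter.Tendsto (fun n => ‖z‖ ^ 2 * (a n)⁻¹) Filter.atTop (nhds 0) := by
    simpa using (tendsto_inv_atTop_zero.comp hlim).const_mul (‖z‖ ^ 2)
  refine tendsto_of_tendsto_of_tendsto_of_le_of_le tendsto_const_nhds h1
    (fun n => le_max_right _ _) (fun n => max_le ?_ ?_)
  · have hn := ha n
    have e1 : ‖((a n : ℝ) : ℂ) + z‖ ^ 2 ≤ a n ^ 2 + ‖z‖ ^ 2 := by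
      rw [← Complex.normSq_eq_norm_sq, ← Complex.normSq_eq_norm_sq, Complex.normSq_apply,
        Complex.normSq_apply]
      simp only [Complex.add_re, Complex.ofReal_re, Complex.add_im, Complex.ofReal_im, zero_add]
      nlinarith
    rw [← div_eq_mul_inv, le_div_iff₀ hn]
    have e2 := norm_nonneg (((a n : ℝ) : ℂ) + z)
    rcases le_or_gt ‖((a n : ℝ) : ℂ) + z‖ (a n) with h | h
    · nlinarith [sq_nonneg ‖z‖]
    · nlinarith
  · have := ha n
    positivity

/-- Comparison of a solution of a complex linear equation, damped by `z` with `Re z ≤ 0`, with the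
solution `u` of the undamped real equation whose forcing dominates. In terms of the resolvent of
`l (K i)` the diagonal coefficient becomes `l + B i i + z i`, and `‖l + B i i + z i‖` exceeds
`l + B i i` only by `O(1/l)`. -/
theorem norm_le_of_conv_equation [SFinite ν] (hK : PosKernels K T)
    (hB : ∀ i j, j ≠ i → 0 ≤ B i j) {χ f h z : Fin m → ℝ → ℂ} {u F : Fin m → ℝ → ℝ}
    (hf : ∀ i, IntegrableOn (f i) (Icc 0 T) ν) (hF : ∀ i, IntegrableOn (F i) (Icc 0 T) ν)
    (hfF : ∀ i, ∀ᵐ s ∂(ν.restrict (Icc 0 T)), ‖f i s‖ ≤ F i s)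
    (hχi : ∀ i, IntegrableOn (χ i) (Icc 0 T)) (hui : ∀ i, IntegrableOn (u i) (Icc 0 T))
    (hz : ∀ i, AEStronglyMeasurable (z i) (volume.restrict (Icc 0 T)))
    (hzχ : ∀ i, IntegrableOn (fun t => z i t * χ i t) (Icc 0 T))
    (hzre : ∀ i, ∀ᵐ t ∂(volume.restrict (Icc 0 T)), (z i t).re ≤ 0)
    (hh : ∀ i, ∀ᵐ t ∂(volume.restrict (Icc 0 T)),
      h i t = (∑ j, (B i j : ℂ) * χ j t) + z i t * χ i t)
    (hχ : ∀ i, ∀ᵐ t ∂(volume.restrict (Icc 0 T)),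
      χ i t = vconv (smulB ℂ) (K i) (f i) ν t + vconv (smulB ℂ) (K i) (h i) volume t)
    (hu : ∀ i, ∀ᵐ t ∂(volume.restrict (Icc 0 T)),
      u i t = vconv (smulB ℝ) (K i) (F i) ν t +
        vconv (smulB ℝ) (K i) (fun s => ∑ j, B i j * u j s) volume t) :
    ∀ᵐ t ∂(volume.restrict (Icc 0 T)), ∀ i, ‖χ i t‖ ≤ u i t := by
  set c : ℝ := 1 + ∑ i, ∑ j, |B i j| with hc
  have hrow : ∀ i, ∑ j, |B i j| ≤ c - 1 := fun i => by
    have := Finset.single_le_sum (f := fun i => ∑ j, |B i j|)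
      (fun i _ => Finset.sum_nonneg fun j _ => abs_nonneg _) (Finset.mem_univ i)
    simpa [hc] using this
  have hdiag : ∀ i, |B i i| ≤ c - 1 := fun i =>
    (Finset.single_le_sum (f := fun j => |B i j|) (fun j _ => abs_nonneg _)
      (Finset.mem_univ i)).trans (hrow i)
  have hc1 : 1 ≤ c := by
    have : 0 ≤ ∑ i, ∑ j, |B i j| :=
      Finset.sum_nonneg fun i _ => Finset.sum_nonneg fun j _ => abs_nonneg _
    linarith
  have ha : ∀ (n : ℕ) i, 0 < (n : ℝ) + c + B i i := fun n i => by
    have h1 := neg_abs_le (B i i)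
    have h2 := hdiag i
    have : (0 : ℝ) ≤ n := n.cast_nonneg
    linarith
  have hhi : ∀ i, IntegrableOn (h i) (Icc 0 T) := fun i => by
    have : IntegrableOn (fun t => (∑ j, (B i j : ℂ) * χ j t) + z i t * χ i t) (Icc 0 T) :=
      (integrable_finsetSum _ fun j _ => (hχi j).const_mul _).add (hzχ i)
    refine this.congr ?_
    filter_upwards [hh i] with t ht using ht.symm
  have hBu : ∀ i, IntegrableOn (fun s => ∑ j, B i j * u j s) (Icc 0 T) := fun i =>
    integrable_finsetSum _ fun j _ => (hui j).const_mul _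
  set e : ℕ → Fin m → ℝ → ℝ := fun n i t =>
    max (‖(((n : ℝ) + c + B i i : ℝ) : ℂ) + z i t‖ - ((n : ℝ) + c + B i i)) 0 * ‖χ i t‖ with he
  have hem : ∀ n i, AEStronglyMeasurable (e n i) (volume.restrict (Icc 0 T)) := fun n i =>
    (((aestronglyMeasurable_const.add (hz i)).norm.sub aestronglyMeasurable_const).sup
      aestronglyMeasurable_const).mul (hχi i).aestronglyMeasurable.norm
  have he0 : ∀ n i t, 0 ≤ e n i t := fun n i t =>
    mul_nonneg (le_max_right _ _) (norm_nonneg _)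
  have heb : ∀ n i t, e n i t ≤ ‖z i t * χ i t‖ := fun n i t => by
    rw [norm_mul]
    refine mul_le_mul_of_nonneg_right (max_le ?_ (norm_nonneg _)) (norm_nonneg _)
    have := norm_add_le (((n : ℝ) + c + B i i : ℝ) : ℂ) (z i t)
    rw [Complex.norm_real, Real.norm_of_nonneg (ha n i).le] at this
    linarith
  have hei : ∀ n i, IntegrableOn (e n i) (Icc 0 T) := fun n i =>
    Integrable.mono' (hzχ i).norm (hem n i) (.of_forall fun t => by
      rw [Real.norm_of_nonneg (he0 n i t)]
      exact heb n i t)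
  have helim : ∀ i, Filter.Tendsto (fun n => ∫⁻ t in Icc 0 T, ENNReal.ofReal (e n i t))
      Filter.atTop (nhds 0) := fun i => by
    refine tendsto_lintegral_ofReal_of_dominated (fun n => hem n i) (hzχ i).norm
      (fun n => .of_forall fun t => heb n i t) ?_
    filter_upwards [hzre i] with t ht
    have := tendsto_norm_add_sub ht (a := fun n : ℕ => (n : ℝ) + c + B i i) (fun n => ha n i)
      (by simpa only [add_assoc] using tendsto_natCast_add_atTop (c + B i i))
    have h0 := this.mul_const ‖χ i t‖
    rw [zero_mul] at h0
    exact h0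
  have main := ae_nonpos_of_le_resolvent_conv (k := K) (v := fun i t => ‖χ i t‖ - u i t) (e := e)
    (T := T) (c := c) (l₀ := c) (by linarith) hc1 hK.integrableOn hK.memLp hK.nonneg
    hK.completelyPositive (fun i => (hχi i).norm.sub (hui i)) hei he0 helim ?_
  · filter_upwards [main] with t ht i
    linarith [ht i]
  intro n i r hr0 hr hrk
  have hl : 0 < (n : ℝ) + c := by positivity
  set l := (n : ℝ) + c with hldef
  have hgχ : IntegrableOn (fun t => χ i t + l⁻¹ • h i t) (Icc 0 T) := (hχi i).add ((hhi i).smul l⁻¹)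
  have hgu : IntegrableOn (fun t => u i t + l⁻¹ • ∑ j, B i j * u j t) (Icc 0 T) :=
    (hui i).add ((hBu i).smul l⁻¹)
  refine ⟨fun t => ‖χ i t + l⁻¹ • h i t‖ - (u i t + l⁻¹ • ∑ j, B i j * u j t),
    hgχ.norm.sub hgu, ?_, ?_⟩
  · filter_upwards [eq_resolvent_conv hl (hK.integrableOn i) hr hrk (hf i) (hhi i) (hχ i),
      eq_resolvent_conv hl (hK.integrableOn i) hr hrk (hF i) (hBu i) (hu i),
      vconv_sub_right (smulB ℝ) hr hgχ.norm hgu,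
      vconv_mono hr (hf i).norm (hF i) (fun s _ => hr0 s) (hfF i)] with t h1 h2 h3 h4
    rw [h3, h2]
    have h5 : ‖χ i t‖ ≤ vconv (smulB ℝ) r (fun s => ‖χ i s + l⁻¹ • h i s‖) volume t +
        l⁻¹ * vconv (smulB ℝ) r (F i) ν t := by
      calc ‖χ i t‖ ≤ ‖vconv (smulB ℂ) r (fun s => χ i s + l⁻¹ • h i s) volume t‖ +
            ‖l⁻¹ • vconv (smulB ℂ) r (f i) ν t‖ := by
            conv_lhs => rw [h1]
            exact norm_add_le _ _
        _ ≤ _ := by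
            refine add_le_add (norm_vconv_le _ _ _ fun s _ => hr0 s) ?_
            rw [norm_smul, Real.norm_of_nonneg (inv_pos.2 hl).le]
            refine mul_le_mul_of_nonneg_left ?_ (inv_pos.2 hl).le
            exact (norm_vconv_le _ _ _ fun s _ => hr0 s).trans h4
    rw [smul_eq_mul]
    linarith
  · filter_upwards [hh i] with t ht
    rw [ht]
    exact norm_add_smul_sub_le (i := i) (B := B i) (χ := fun j => χ j t) (u := fun j => u j t)
      (z := z i t) hl (hB i) (ha n i).le ((hrow i).trans (by linarith))

/-- Solutions of real linear equations with nonnegative forcing are nonnegative, also in the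
presence of a damping `z ≤ 0` and of a nonnegative source term in `h`. -/
theorem nonneg_of_conv_equation [SFinite ν] (hK : PosKernels K T)
    (hB : ∀ i j, j ≠ i → 0 ≤ B i j) {χ f h z : Fin m → ℝ → ℝ}
    (hf : ∀ i, IntegrableOn (f i) (Icc 0 T) ν)
    (hf0 : ∀ i, ∀ᵐ s ∂(ν.restrict (Icc 0 T)), 0 ≤ f i s)
    (hχi : ∀ i, IntegrableOn (χ i) (Icc 0 T)) (hhi : ∀ i, IntegrableOn (h i) (Icc 0 T))
    (hz : ∀ i, AEStronglyMeasurable (z i) (volume.restrict (Icc 0 T)))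
    (hzχ : ∀ i, IntegrableOn (fun t => z i t * χ i t) (Icc 0 T))
    (hz0 : ∀ i, ∀ᵐ t ∂(volume.restrict (Icc 0 T)), z i t ≤ 0)
    (hh : ∀ i, ∀ᵐ t ∂(volume.restrict (Icc 0 T)),
      (∑ j, B i j * χ j t) + z i t * χ i t ≤ h i t)
    (hχ : ∀ i, ∀ᵐ t ∂(volume.restrict (Icc 0 T)),
      χ i t = vconv (smulB ℝ) (K i) (f i) ν t + vconv (smulB ℝ) (K i) (h i) volume t) :
    ∀ᵐ t ∂(volume.restrict (Icc 0 T)), ∀ i, 0 ≤ χ i t := by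
  set c : ℝ := 1 + ∑ i, ∑ j, |B i j| with hc
  have hrow : ∀ i, ∑ j, |B i j| ≤ c - 1 := fun i => by
    have := Finset.single_le_sum (f := fun i => ∑ j, |B i j|)
      (fun i _ => Finset.sum_nonneg fun j _ => abs_nonneg _) (Finset.mem_univ i)
    simpa [hc] using this
  have hdiag : ∀ i, |B i i| ≤ c - 1 := fun i =>
    (Finset.single_le_sum (f := fun j => |B i j|) (fun j _ => abs_nonneg _)
      (Finset.mem_univ i)).trans (hrow i)
  have hc1 : 1 ≤ c := by
    have : 0 ≤ ∑ i, ∑ j, |B i j| :=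
      Finset.sum_nonneg fun i _ => Finset.sum_nonneg fun j _ => abs_nonneg _
    linarith
  have ha : ∀ (n : ℕ) i, 0 < (n : ℝ) + c + B i i := fun n i => by
    have h1 := neg_abs_le (B i i)
    have h2 := hdiag i
    have : (0 : ℝ) ≤ n := n.cast_nonneg
    linarith
  set e : ℕ → Fin m → ℝ → ℝ := fun n i t =>
    max (-((n : ℝ) + c + B i i + z i t)) 0 * |χ i t| with he
  have hem : ∀ n i, AEStronglyMeasurable (e n i) (volume.restrict (Icc 0 T)) := fun n i =>
    ((aestronglyMeasurable_const.add (hz i)).neg.sup aestronglyMeasurable_const).mul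
      (hχi i).aestronglyMeasurable.norm
  have he0 : ∀ n i t, 0 ≤ e n i t := fun n i t =>
    mul_nonneg (le_max_right _ _) (abs_nonneg _)
  have heb : ∀ n i t, e n i t ≤ ‖z i t * χ i t‖ := fun n i t => by
    rw [norm_mul]
    refine mul_le_mul_of_nonneg_right (max_le ?_ (norm_nonneg _)) (abs_nonneg _)
    have := ha n i
    have h2 : -(z i t) ≤ ‖z i t‖ := neg_le_abs _
    linarith
  have hei : ∀ n i, IntegrableOn (e n i) (Icc 0 T) := fun n i =>
    Integrable.mono' (hzχ i).norm (hem n i) (.of_forall fun t => by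
      rw [Real.norm_of_nonneg (he0 n i t)]
      exact heb n i t)
  have helim : ∀ i, Filter.Tendsto (fun n => ∫⁻ t in Icc 0 T, ENNReal.ofReal (e n i t))
      Filter.atTop (nhds 0) := fun i => by
    refine tendsto_lintegral_ofReal_of_dominated (fun n => hem n i) (hzχ i).norm
      (fun n => .of_forall fun t => heb n i t) (.of_forall fun t => ?_)
    refine tendsto_const_nhds.congr' ?_
    have := (tendsto_natCast_add_atTop (c + B i i + z i t)).eventually_ge_atTop 0
    filter_upwards [this] with n hn
    simp only [he]
    rw [max_eq_right (by linarith), zero_mul]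
  have main := ae_nonpos_of_le_resolvent_conv (k := K) (v := fun i t => -χ i t) (e := e)
    (T := T) (c := c) (l₀ := c) (by linarith) hc1 hK.integrableOn hK.memLp hK.nonneg
    hK.completelyPositive (fun i => (hχi i).neg) hei he0 helim ?_
  · filter_upwards [main] with t ht i
    linarith [ht i]
  intro n i r hr0 hr hrk
  have hl : 0 < (n : ℝ) + c := by positivity
  set l := (n : ℝ) + c with hldef
  have hgχ : IntegrableOn (fun t => χ i t + l⁻¹ • h i t) (Icc 0 T) := (hχi i).add ((hhi i).smul l⁻¹)
  refine ⟨fun t => -(χ i t + l⁻¹ • h i t), hgχ.neg, ?_, ?_⟩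
  · filter_upwards [eq_resolvent_conv hl (hK.integrableOn i) hr hrk (hf i) (hhi i) (hχ i),
      ae_restrict_mem measurableSet_Icc] with t h1 ht
    have h2 := vconv_nonneg ht.2 (fun s _ => hr0 s) (hf0 i)
    have h3 := vconv_smul_right (smulB ℝ) r (fun t => χ i t + l⁻¹ • h i t) volume (-1) t
    simp only [neg_smul, one_smul] at h3
    rw [h3]
    have h4 := mul_nonneg (inv_pos.2 hl).le h2
    rw [smul_eq_mul] at h1
    linarith
  · filter_upwards [hh i, hz0 i] with t ht htz
    simp only [smul_eq_mul]
    exact neg_add_mul_le (i := i) (B := B i) (χ := fun j => χ j t) hl (hB i)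
      ((hrow i).trans (by linarith)) htz ht

end Comparison

/-! ### Vector measures with densities -/

section Density

variable {V : Type*} [NormedAddCommGroup V] [NormedSpace ℝ V] [CompleteSpace V]
  {ν : Measure ℝ} {w : ℝ → V}

theorem lintegral_variation_withDensity (hw : Integrable w ν) {f : ℝ → ℝ}
    (hf : AEStronglyMeasurable f (ν.withDensityᵥ w).variation) :
    ∫⁻ x, ‖f x‖ₑ ∂(ν.withDensityᵥ w).variation = ∫⁻ x, ‖f x • w x‖ₑ ∂ν := by
  rw [Measure.variation_withDensityᵥ hw] at hf ⊢
  rw [lintegral_withDensity_eq_lintegral_mul₀' hw.aestronglyMeasurable.enorm hf.enorm]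
  refine lintegral_congr fun x => ?_
  simp [enorm_smul, mul_comm]

theorem aestronglyMeasurable_smul_of_variation (hw : Integrable w ν) {f : ℝ → ℝ}
    (hf : AEStronglyMeasurable f (ν.withDensityᵥ w).variation) :
    AEStronglyMeasurable (fun x => f x • w x) ν := by
  rw [Measure.variation_withDensityᵥ hw] at hf
  obtain ⟨g, hg, hfg⟩ := hf
  refine (hg.aestronglyMeasurable.smul hw.aestronglyMeasurable).congr ?_
  have := (ae_withDensity_iff' hw.aestronglyMeasurable.enorm).1 hfg
  filter_upwards [this] with x hx
  rcases eq_or_ne (w x) 0 with h | h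
  · simp [h]
  · simp [hx (by simpa using h)]

theorem integrable_smul_of_variation (hw : Integrable w ν) {f : ℝ → ℝ}
    (hf : Integrable f (ν.withDensityᵥ w).variation) : Integrable (fun x => f x • w x) ν := by
  refine ⟨aestronglyMeasurable_smul_of_variation hw hf.1, ?_⟩
  rw [HasFiniteIntegral, ← lintegral_variation_withDensity hw hf.1]
  exact hf.2

/-- The integral of a scalar function with respect to a vector measure with density. -/
theorem integral_withDensityᵥ (hw : Integrable w ν) {f : ℝ → ℝ}
    (hf : AEStronglyMeasurable f (ν.withDensityᵥ w).variation) :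
    (ν.withDensityᵥ w).integral f (ContinuousLinearMap.lsmul ℝ ℝ) = ∫ x, f x • w x ∂ν := by
  set N := ν.withDensityᵥ w with hN
  by_cases hfi : Integrable f N.variation
  swap
  · rw [VectorMeasure.integral_undef hfi, integral_undef]
    intro h
    refine hfi ⟨hf, ?_⟩
    rw [HasFiniteIntegral, lintegral_variation_withDensity hw hf]
    exact h.2
  refine Integrable.induction (P := fun f : ℝ → ℝ =>
    N.integral f (ContinuousLinearMap.lsmul ℝ ℝ) = ∫ x, f x • w x ∂ν) ?_ ?_ ?_ ?_ hfi
  · intro c s hs hfin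
    have hfm : IsFiniteMeasure (N.variation.restrict s) := ⟨by simpa using hfin⟩
    have h1 := VectorMeasure.integral_indicator_const (μ := N)
      (B := (ContinuousLinearMap.lsmul ℝ ℝ : ℝ →L[ℝ] V →L[ℝ] V)) c hs
    refine h1.trans ?_
    rw [ContinuousLinearMap.lsmul_apply, hN, withDensityᵥ_apply hw hs,
      ← integral_indicator hs, ← integral_smul]
    refine integral_congr_ae (.of_forall fun x => ?_)
    by_cases hx : x ∈ s <;> simp [hx]
  · intro f g _ hf hg h1 h2
    have h3 := VectorMeasure.integral_add (μ := N)
      (B := (ContinuousLinearMap.lsmul ℝ ℝ : ℝ →L[ℝ] V →L[ℝ] V)) hf hg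
    refine h3.trans ?_
    rw [h1, h2, ← integral_add (integrable_smul_of_variation hw hf)
      (integrable_smul_of_variation hw hg)]
    refine integral_congr_ae (.of_forall fun x => ?_)
    simp [add_smul]
  · refine isClosed_eq VectorMeasure.continuous_integral ?_
    refine LipschitzWith.continuous (K := 1) fun f g => ?_
    have hfi := L1.integrable_coeFn f
    have hgi := L1.integrable_coeFn g
    rw [ENNReal.coe_one, one_mul, edist_eq_enorm_sub, ← integral_sub
      (integrable_smul_of_variation hw hfi) (integrable_smul_of_variation hw hgi),
      L1.edist_def]
    refine (enorm_integral_le_lintegral_enorm _).trans (le_of_eq ?_)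
    simp_rw [edist_eq_enorm_sub]
    have h1 := lintegral_variation_withDensity hw (hfi.sub hgi).1
    simp only [Pi.sub_apply, sub_smul] at h1
    exact h1.symm
  · intro f g hfg hf h
    rw [← VectorMeasure.integral_congr_ae hfg, h]
    refine integral_congr_ae ?_
    rw [hN, Measure.variation_withDensityᵥ hw] at hfg
    have := (ae_withDensity_iff' hw.aestronglyMeasurable.enorm).1 hfg
    filter_upwards [this] with x hx
    rcases eq_or_ne (w x) 0 with h | h
    · simp [h]
    · simp [hx (by simpa using h)]

end Density

/-- A finite dimensional vector measure has an integrable density with respect to a finite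
measure. -/
theorem exists_withDensityᵥ_eq {m : ℕ} (M : VectorMeasure ℝ (Cvec m)) :
    ∃ (ν : Measure ℝ) (_ : IsFiniteMeasure ν) (v : ℝ → Cvec m), Integrable v ν ∧
      ν.withDensityᵥ v = M := by
  -- real and imaginary parts of the components
  let P : Fin m → Cvec m →L[ℝ] ℂ := fun i =>
    (EuclideanSpace.proj (𝕜 := ℂ) i : Cvec m →L[ℂ] ℂ).restrictScalars ℝ
  let sre : Fin m → SignedMeasure ℝ := fun i =>
    M.mapRange (Complex.reCLM.comp (P i)).toLinearMap.toAddMonoidHom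
      (Complex.reCLM.comp (P i)).continuous
  let sim : Fin m → SignedMeasure ℝ := fun i =>
    M.mapRange (Complex.imCLM.comp (P i)).toLinearMap.toAddMonoidHom
      (Complex.imCLM.comp (P i)).continuous
  have hre : ∀ i A, sre i A = (M A i).re := fun i A => rfl
  have him : ∀ i A, sim i A = (M A i).im := fun i A => rfl
  let ν : Measure ℝ := ∑ i, ((sre i).totalVariation + (sim i).totalVariation)
  have hν : IsFiniteMeasure ν := by
    have : ∀ i, IsFiniteMeasure ((sre i).totalVariation + (sim i).totalVariation) := fun i => by
      unfold SignedMeasure.totalVariation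
      infer_instance
    infer_instance
  have hνA : ∀ i A, ν A = 0 → (sre i).totalVariation A = 0 ∧ (sim i).totalVariation A = 0 := by
    intro i A hA
    simp only [ν, Measure.finsetSum_apply, Measure.add_apply, Finset.sum_eq_zero_iff,
      Finset.mem_univ, true_implies, add_eq_zero] at hA
    exact hA i
  have acre : ∀ i, sre i ≪ᵥ ν.toENNRealVectorMeasure := fun i => by
    refine VectorMeasure.AbsolutelyContinuous.mk fun A hA h => ?_
    rw [Measure.toENNRealVectorMeasure_apply_measurable hA] at h
    exact SignedMeasure.null_of_totalVariation_zero _ (hνA i A h).1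
  have acim : ∀ i, sim i ≪ᵥ ν.toENNRealVectorMeasure := fun i => by
    refine VectorMeasure.AbsolutelyContinuous.mk fun A hA h => ?_
    rw [Measure.toENNRealVectorMeasure_apply_measurable hA] at h
    exact SignedMeasure.null_of_totalVariation_zero _ (hνA i A h).2
  let a : Fin m → ℝ → ℝ := fun i => (sre i).rnDeriv ν
  let b : Fin m → ℝ → ℝ := fun i => (sim i).rnDeriv ν
  have hai : ∀ i, Integrable (a i) ν := fun i => SignedMeasure.integrable_rnDeriv _ _
  have hbi : ∀ i, Integrable (b i) ν := fun i => SignedMeasure.integrable_rnDeriv _ _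
  have hint : ∀ i, Integrable (fun x => a i x • (EuclideanSpace.single i (1 : ℂ) : Cvec m) +
      b i x • EuclideanSpace.single i Complex.I) ν := fun i =>
    ((hai i).smul_const _).add ((hbi i).smul_const _)
  refine ⟨ν, hν, fun x => ∑ i, (a i x • (EuclideanSpace.single i (1 : ℂ) : Cvec m) +
      b i x • EuclideanSpace.single i Complex.I), integrable_finsetSum _ fun i _ => hint i, ?_⟩
  ext1 A hA
  rw [withDensityᵥ_apply (integrable_finsetSum _ fun i _ => hint i) hA,
    integral_finsetSum _ fun i _ => (hint i).integrableOn]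
  have h1 : ∀ i, ∫ x in A, (a i x • (EuclideanSpace.single i (1 : ℂ) : Cvec m) +
      b i x • EuclideanSpace.single i Complex.I) ∂ν =
      (M A i).re • (EuclideanSpace.single i (1 : ℂ) : Cvec m) +
      (M A i).im • EuclideanSpace.single i Complex.I := by
    intro i
    rw [integral_add ((hai i).integrableOn.smul_const _) ((hbi i).integrableOn.smul_const _),
      integral_smul_const, integral_smul_const, ← withDensityᵥ_apply (hai i) hA,
      ← withDensityᵥ_apply (hbi i) hA, SignedMeasure.withDensityᵥ_rnDeriv_eq _ _ (acre i),
      SignedMeasure.withDensityᵥ_rnDeriv_eq _ _ (acim i), hre, him]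
  simp_rw [h1]
  ext j
  simp only [PiLp.add_apply, PiLp.smul_apply, WithLp.ofLp_sum, Finset.sum_apply,
    Complex.real_smul, PiLp.single_apply]
  simp only [mul_ite, mul_one, mul_zero]
  rw [Finset.sum_add_distrib]
  simp [Complex.re_add_im]

/-- A density `v`, with respect to a finite measure `ν`, of the restriction of `μ` to `[0,T]`. -/
structure IsDensity {m : ℕ} (μ : LocFinMeasure m) (T : ℝ) (ν : Measure ℝ) (v : ℝ → Cvec m) :
    Prop where
  finite : IsFiniteMeasure ν
  integrable : Integrable v ν
  eq : ν.withDensityᵥ v = μ.onIcc T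

theorem LocFinMeasure.exists_isDensity {m : ℕ} (μ : LocFinMeasure m) (T : ℝ) :
    ∃ ν v, IsDensity μ T ν v := by
  obtain ⟨ν, h1, v, h2, h3⟩ := exists_withDensityᵥ_eq (μ.onIcc T)
  exact ⟨ν, v, h1, h2, h3⟩

namespace IsDensity

variable {m : ℕ} {μ : LocFinMeasure m} {T : ℝ} {ν : Measure ℝ} {v : ℝ → Cvec m}

theorem integrable_coord (h : IsDensity μ T ν v) (i : Fin m) : Integrable (fun s => v s i) ν :=
  ((EuclideanSpace.proj (𝕜 := ℂ) i : Cvec m →L[ℂ] ℂ).restrictScalars ℝ).integrable_comp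
    h.integrable

theorem totalVar_eq (h : IsDensity μ T ν v) :
    μ.totalVar T = ∫⁻ s in Icc 0 T, ‖v s‖ₑ ∂ν := by
  rw [LocFinMeasure.totalVar, ← h.eq, Measure.variation_withDensityᵥ h.integrable,
    withDensity_apply _ measurableSet_Icc]

theorem apply_coord (h : IsDensity μ T ν v) {A : Set ℝ} (hA : MeasurableSet A) (i : Fin m) :
    μ.onIcc T A i = ∫ s in A, v s i ∂ν := by
  rw [← h.eq, withDensityᵥ_apply h.integrable hA]
  exact (((EuclideanSpace.proj (𝕜 := ℂ) i : Cvec m →L[ℂ] ℂ).restrictScalars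
    ℝ).integral_comp_comm h.integrable.integrableOn).symm

theorem re_nonpos (h : IsDensity μ T ν v) (hT : 0 ≤ T) (hμ : μ.ReNonpos) (i : Fin m) :
    ∀ᵐ s ∂ν, (v s i).re ≤ 0 := by
  have hi := (h.integrable_coord i).re
  have := ae_nonneg_of_forall_setIntegral_nonneg hi.neg fun A hA _ => ?_
  · filter_upwards [this] with s hs
    simpa using hs
  · have h1 := hμ T hT A hA i
    rw [h.apply_coord hA i] at h1
    have h2 := integral_re (𝕜 := ℂ) (h.integrable_coord i).integrableOn (μ := ν.restrict A)
    simp only [Pi.neg_apply, integral_neg]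
    rw [h2]
    simpa using h1

/-- On `[0,T]`, the convolution with `μ` is that with its density. -/
theorem convMeasure_apply (h : IsDensity μ T ν v) {K : Fin m → ℝ → ℝ}
    (hK : ∀ i, ContinuousOn (K i) (Ioi 0)) {t : ℝ} (ht : t ∈ Icc 0 T) (i : Fin m) :
    convMeasure K μ t i = vconv (smulB ℂ) (K i) (fun s => v s i) ν t := by
  have hvi := (h.integrable_coord i).restrict (s := Ico 0 t)
  have hres : (μ.coord t i).restrict (Ico 0 t) =
      (ν.restrict (Ico 0 t)).withDensityᵥ (fun s => v s i) := by
    ext1 A hA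
    have hA' := hA.inter (measurableSet_Ico (a := (0 : ℝ)) (b := t))
    rw [VectorMeasure.restrict_apply _ measurableSet_Ico hA, LocFinMeasure.coord_apply,
      ← μ.restrict_onIcc t T ht.1 ht.2, VectorMeasure.restrict_apply _ measurableSet_Icc hA',
      h.apply_coord (hA'.inter measurableSet_Icc), withDensityᵥ_apply hvi hA,
      Measure.restrict_restrict hA, inter_assoc, inter_eq_left.2 Ico_subset_Icc_self]
  change ((μ.coord t i).restrict (Ico 0 t)).integral (fun s => K i (t - s))
      (ContinuousLinearMap.lsmul ℝ ℝ) = _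
  rw [hres, integral_withDensityᵥ hvi]
  · rfl
  · rw [Measure.variation_withDensityᵥ hvi]
    refine AEStronglyMeasurable.mono_ac (withDensity_absolutelyContinuous _ _) ?_
    refine ContinuousOn.aestronglyMeasurable ?_ measurableSet_Ico
    exact (hK i).comp (by fun_prop) fun s hs => sub_pos.2 hs.2

end IsDensity

/-! ### The kernel `E` -/

section Kernel

variable {m : ℕ}

theorem realMat_apply (A : Matrix (Fin m) (Fin m) ℝ) (v : Cvec m) (i : Fin m) :
    realMat A v i = ∑ j, (A i j : ℂ) * v j := by
  simp [realMat, Matrix.ofLp_toEuclideanCLM, Matrix.mulVec, dotProduct]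

theorem diagKernel_apply (K : Fin m → ℝ → ℝ) (t : ℝ) (v : Cvec m) (i : Fin m) :
    diagKernel K t v i = (K i t : ℂ) * v i := by
  rw [diagKernel, realMat_apply, Finset.sum_eq_single i]
  · simp
  · intro j _ hj
    simp [Matrix.diagonal_apply_ne _ hj.symm]
  · simp

theorem diagKernel_eq_sum (K : Fin m → ℝ → ℝ) (t : ℝ) :
    diagKernel K t = ∑ i, K i t • realMat (Matrix.diagonal (Pi.single i (1 : ℝ))) := by
  ext v i
  rw [diagKernel_apply]
  simp only [sum_apply, FunLike.coe_smul, Pi.smul_apply, WithLp.ofLp_sum,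
    Finset.sum_apply, PiLp.smul_apply, realMat_apply, Complex.real_smul]
  rw [Finset.sum_eq_single i]
  · rw [Finset.sum_eq_single i]
    · simp
    · intro j _ hj
      simp [Matrix.diagonal_apply_ne _ hj.symm]
    · simp
  · intro j _ hj
    have : ∀ k, (Matrix.diagonal (Pi.single j (1 : ℝ)) : Matrix (Fin m) (Fin m) ℝ) i k = 0 := by
      intro k
      rcases eq_or_ne i k with rfl | h
      · simp [hj.symm]
      · exact Matrix.diagonal_apply_ne _ h
    simp [this]
  · simp

theorem memLp_diagKernel {K : Fin m → ℝ → ℝ} {ρ : Measure ℝ} {p : ℝ≥0∞}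
    (h : ∀ i, MemLp (K i) p ρ) : MemLp (diagKernel K) p ρ := by
  have : diagKernel K =
      fun t => ∑ i, K i t • realMat (Matrix.diagonal (Pi.single i (1 : ℝ))) :=
    funext fun t => diagKernel_eq_sum K t
  rw [this]
  refine memLp_finsetSum (f := fun i t => K i t •
    (realMat (Matrix.diagonal (Pi.single i (1 : ℝ))) : Cmat m)) Finset.univ fun i _ => ?_
  refine MemLp.of_le_mul (c := ‖realMat (Matrix.diagonal (Pi.single i (1 : ℝ)))‖) (h i)
    ((h i).1.smul_const _) (.of_forall fun t => ?_)
  rw [mul_comm]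
  exact norm_smul_le (K i t) (realMat (Matrix.diagonal (Pi.single i (1 : ℝ))) : Cmat m)

theorem enorm_applyB_le : ‖applyB m‖ₑ ≤ 1 := by
  rw [← ofReal_norm]
  refine (ENNReal.ofReal_le_ofReal (LinearMap.mkContinuous₂_norm_le _ zero_le_one _)).trans ?_
  simp

/-- Components of the convolution with a diagonal kernel. -/
theorem vconv_diagKernel_apply {K : Fin m → ℝ → ℝ} {X : ℝ → Cvec m} {T : ℝ} {ν : Measure ℝ}
    [SFinite ν] (hK : IntegrableOn (diagKernel K) (Icc 0 T)) (hX : IntegrableOn X (Icc 0 T) ν) :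
    ∀ᵐ t ∂(volume.restrict (Icc 0 T)), ∀ i,
      vconv (applyB m) (diagKernel K) X ν t i = vconv (smulB ℂ) (K i) (fun s => X s i) ν t := by
  filter_upwards [ae_integrableOn_conv (applyB m) hK hX] with t ht i
  have h := ((EuclideanSpace.proj (𝕜 := ℂ) i : Cvec m →L[ℂ] ℂ).restrictScalars
    ℝ).integral_comp_comm ht
  refine (h.symm.trans ?_)
  refine integral_congr_ae (.of_forall fun s => ?_)
  simp [diagKernel_apply]

theorem re_vconv {k : ℝ → ℝ} {h : ℝ → ℂ} {T : ℝ} {ν : Measure ℝ} [SFinite ν]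
    (hk : IntegrableOn k (Icc 0 T)) (hh : IntegrableOn h (Icc 0 T) ν) :
    ∀ᵐ t ∂(volume.restrict (Icc 0 T)),
      (vconv (smulB ℂ) k h ν t).re = vconv (smulB ℝ) k (fun s => (h s).re) ν t := by
  filter_upwards [ae_integrableOn_conv (smulB ℂ) hk hh] with t ht
  have := Complex.reCLM.integral_comp_comm ht
  refine (this.symm.trans ?_)
  refine integral_congr_ae (.of_forall fun s => ?_)
  simp

variable {K : ℝ → Cmat m} {B : Cmat m}

theorem integrableOn_mul_const {T : ℝ} (hK : IntegrableOn K (Icc 0 T)) (B : Cmat m) :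
    IntegrableOn (fun t => K t * B) (Icc 0 T) :=
  ((mulB m).flip B).integrable_comp hK

theorem integrableOn_kernelE (hK : ∀ T : ℝ, 0 < T → IntegrableOn K (Icc 0 T)) {T : ℝ}
    (hT : 0 < T) : IntegrableOn (kernelE K B) (Icc 0 T) := by
  have hr := (resolventR_spec (B := B) hK).integrable T hT
  refine ((hK T hT).sub (integrableOn_vconv (mulB m) hr (hK T hT))).congr ?_
  filter_upwards [ae_restrict_mem measurableSet_Icc] with t ht
  simp only [kernelE, Pi.sub_apply, convMat_eq_vconv _ _ ht.1]

/-- The equation `E = K + K ∗ (B E)`. -/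
theorem kernelE_eq (hK : ∀ T : ℝ, 0 < T → IntegrableOn K (Icc 0 T)) {T : ℝ} (hT : 0 < T) :
    ∀ᵐ t ∂(volume.restrict (Icc 0 T)),
      kernelE K B t = K t + vconv (mulB m) (fun s => K s * B) (kernelE K B) volume t := by
  have hspec := resolventR_spec (B := B) hK
  set r := resolventR K B with hr
  have hri := hspec.integrable T hT
  have hKi := hK T hT
  have hKB := integrableOn_mul_const hKi B
  have hassoc : ∀ a b c : Cmat m, mulB m a (mulB m b c) = mulB m (mulB m a b) c := fun a b c =>
    (mul_assoc a b c).symm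
  have hE : kernelE K B =ᵐ[volume.restrict (Icc 0 T)]
      fun t => K t - vconv (mulB m) r K volume t := by
    filter_upwards [ae_restrict_mem measurableSet_Icc] with t ht
    simp only [kernelE, convMat_eq_vconv _ _ ht.1, ← hr]
  have hrK := integrableOn_vconv (mulB m) hri hKi
  -- `(K B) ∗ r = K B + r`, as `r` is the resolvent of `-K B`
  have hkr : vconv (mulB m) (fun s => K s * B) r volume =ᵐ[volume.restrict (Icc 0 T)]
      fun t => K t * B + r t := by
    filter_upwards [ae_restrict_Icc_of_Ici hspec.conv_left T, ae_restrict_mem measurableSet_Icc]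
      with t h1 ht
    rw [convMat_eq_vconv _ _ ht.1] at h1
    have h2 : vconv (mulB m) (fun s => -(K s * B)) r volume t =
        -vconv (mulB m) (fun s => K s * B) r volume t := by
      refine Eq.trans ?_ (integral_neg _)
      exact integral_congr_ae (.of_forall fun s => neg_mul (K (t - s) * B) (r s))
    rw [h2] at h1
    rw [← neg_neg (vconv _ _ _ _ _), h1]
    abel
  filter_upwards [hE, vconv_sub_right (mulB m) hKB hKi hrK,
    vconv_assoc (mulB m) (mulB m) (mulB m) (mulB m) hassoc hKB hri hKi,
    vconv_congr_left (mulB m) K volume hkr, vconv_add_left (mulB m) hKB hri hKi,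
    ae_restrict_mem measurableSet_Icc] with t h1 h2 h3 h4 h5 ht
  rw [vconv_congr_right (mulB m) _ ht.2 hE, h2, h3, h4, h5, h1]
  abel

end Kernel

/-! ### Volterra equations with Lipschitz nonlinearities -/

theorem memLp_of_ae_eq_add {V : Type*} [NormedAddCommGroup V] {f g h : ℝ → V} {p : ℝ≥0∞}
    {μ : Measure ℝ} (hf : MemLp f p μ) (hg : MemLp g p μ) (h' : ∀ᵐ t ∂μ, h t = f t + g t) :
    MemLp h p μ :=
  (memLp_congr_ae h').2 (hf.add hg)

section Abstract

variable {A V W : Type*} [NormedAddCommGroup A] [NormedSpace ℝ A]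
  [NormedAddCommGroup V] [NormedSpace ℝ V] [NormedAddCommGroup W] [NormedSpace ℝ W]
  {T : ℝ}

/-- The convolution of a kernel in `L^q` with a measure is in `L^q`. -/
theorem memLp_vconv_rpow (B : A →L[ℝ] V →L[ℝ] W) {f : ℝ → A} {h : ℝ → V} {ν : Measure ℝ}
    [SFinite ν] {q : ℝ} (hq : 1 ≤ q) (hf : MemLp f (ENNReal.ofReal q) (volume.restrict (Icc 0 T)))
    (hh : IntegrableOn h (Icc 0 T) ν) :
    MemLp (vconv B f h ν) (ENNReal.ofReal q) (volume.restrict (Icc 0 T)) := by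
  have hq0 : 0 < q := by linarith
  have hfi : ∫⁻ t in Icc 0 T, ‖f t‖ₑ ^ q ≠ ⊤ := by
    have := (eLpNorm_lt_top_iff_lintegral_rpow_enorm_lt_top (by simpa using hq0) (by simp)).1 hf.2
    rw [ENNReal.toReal_ofReal hq0.le] at this
    exact this.ne
  refine ⟨(integrableOn_vconv B (hf.integrable (by simpa using hq)) hh).aestronglyMeasurable, ?_⟩
  rw [eLpNorm_lt_top_iff_lintegral_rpow_enorm_lt_top (by simpa using hq0) (by simp),
    ENNReal.toReal_ofReal hq0.le]
  calc ∫⁻ t in Icc 0 T, ‖vconv B f h ν t‖ₑ ^ q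
      ≤ ∫⁻ t in Icc 0 T, ‖B‖ₑ ^ q *
          lconv (fun s => ‖f s‖ₑ) (fun s => ‖h s‖ₑ) ν t ^ q := by
        refine lintegral_mono fun t => ?_
        rw [← ENNReal.mul_rpow_of_nonneg _ _ hq0.le]
        exact ENNReal.rpow_le_rpow (enorm_vconv_le B f h ν t) hq0.le
    _ = ‖B‖ₑ ^ q * ∫⁻ t in Icc 0 T,
          lconv (fun s => ‖f s‖ₑ) (fun s => ‖h s‖ₑ) ν t ^ q :=
        lintegral_const_mul' _ _ (ENNReal.rpow_ne_top_of_nonneg hq0.le (by simp))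
    _ ≤ ‖B‖ₑ ^ q * ((∫⁻ s in Icc 0 T, ‖h s‖ₑ ∂ν) ^ q *
          ∫⁻ t in Icc 0 T, ‖f t‖ₑ ^ q) := by
        gcongr
        exact lintegral_lconv_rpow_le hq hf.1.enorm hh.aestronglyMeasurable.enorm
    _ < ⊤ := by
        refine (ENNReal.mul_ne_top (ENNReal.rpow_ne_top_of_nonneg hq0.le (by simp))
          (ENNReal.mul_ne_top ?_ hfi)).lt_top
        exact ENNReal.rpow_ne_top_of_nonneg hq0.le hh.2.ne

theorem memLp_vconv (B : A →L[ℝ] V →L[ℝ] W) {f : ℝ → A} {h : ℝ → V} {ν : Measure ℝ} [SFinite ν]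
    (hf : MemLp f 2 (volume.restrict (Icc 0 T))) (hh : IntegrableOn h (Icc 0 T) ν) :
    MemLp (vconv B f h ν) 2 (volume.restrict (Icc 0 T)) := by
  have := memLp_vconv_rpow B (q := 2) one_le_two (by simpa using hf) hh
  simpa using this

/-- Existence for Volterra equations whose nonlinearity is Lipschitz with an `L²` constant. The
fixed point problem is posed in `L¹`, for `Z = N(·, ψ)`. -/
theorem exists_volterra_solution [CompleteSpace W] (B : A →L[ℝ] W →L[ℝ] W) {k : ℝ → A}
    {f : ℝ → W} {N : ℝ → W → W} {a : ℝ → ℝ} (hk : MemLp k 2 (volume.restrict (Icc 0 T)))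
    (hf : MemLp f 2 (volume.restrict (Icc 0 T))) (ha : MemLp a 2 (volume.restrict (Icc 0 T)))
    (hN : ∀ ψ : ℝ → W, AEStronglyMeasurable ψ (volume.restrict (Icc 0 T)) →
      AEStronglyMeasurable (fun s => N s (ψ s)) (volume.restrict (Icc 0 T)))
    (hlip : ∀ s x y, ‖N s x - N s y‖ ≤ a s * ‖x - y‖) (h0 : ∀ s, N s 0 = 0) :
    ∃ ψ : ℝ → W, MemLp ψ 2 (volume.restrict (Icc 0 T)) ∧
      IntegrableOn (fun s => N s (ψ s)) (Icc 0 T) ∧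
      ∀ t ≤ T, ψ t = f t + vconv B k (fun s => N s (ψ s)) volume t := by
  have hki : IntegrableOn k (Icc 0 T) := hk.integrable (by norm_num)
  set Φ : (ℝ → W) → ℝ → W := fun Z s => N s (f s + vconv B k Z volume s) with hΦ
  have hψ : ∀ Z, IntegrableOn Z (Icc 0 T) →
      MemLp (fun s => f s + vconv B k Z volume s) 2 (volume.restrict (Icc 0 T)) := fun Z hZ =>
    hf.add (memLp_vconv B hk hZ)
  have hΦi : ∀ Z, IntegrableOn Z (Icc 0 T) → IntegrableOn (Φ Z) (Icc 0 T) := by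
    intro Z hZ
    have h2 : Integrable (fun s => a s * ‖f s + vconv B k Z volume s‖)
        (volume.restrict (Icc 0 T)) := ha.integrable_mul (hψ Z hZ).norm
    refine h2.mono' (hN _ (hψ Z hZ).1) (.of_forall fun s => ?_)
    simpa [h0] using hlip s (f s + vconv B k Z volume s) 0
  obtain ⟨n, hn⟩ : ∃ n : ℕ, ‖B‖ₑ * ((∫⁻ t in Icc 0 T, ‖a t‖ₑ ^ (2 : ℝ)) ^ (1 / 2 : ℝ) *
      (∫⁻ t in Icc 0 T, (expWeight n t * ‖k t‖ₑ) ^ (2 : ℝ)) ^ (1 / 2 : ℝ)) ≤ 1 / 2 := by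
    have h1 := tendsto_lintegral_expWeight one_le_two hk.1.enorm
      (lintegral_enorm_rpow_two_ne_top hk)
    have h2 := ((ENNReal.continuous_rpow_const (y := (1 / 2 : ℝ))).tendsto 0).comp h1
    rw [ENNReal.zero_rpow_of_pos (by norm_num)] at h2
    have hA : (∫⁻ t in Icc 0 T, ‖a t‖ₑ ^ (2 : ℝ)) ^ (1 / 2 : ℝ) ≠ ⊤ :=
      ENNReal.rpow_ne_top_of_nonneg (by norm_num) (lintegral_enorm_rpow_two_ne_top ha)
    have h3 := ENNReal.Tendsto.const_mul (a := ‖B‖ₑ)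
      (ENNReal.Tendsto.const_mul h2 (Or.inr hA)) (Or.inr (by simp))
    rw [mul_zero, mul_zero] at h3
    have h4 := h3.eventually_le_const (show (0 : ℝ≥0∞) < 1 / 2 by simp)
    exact h4.exists
  obtain ⟨Z, hZ, hfix⟩ := exists_fixedPoint_of_weighted_contraction n Φ hΦi fun Z Z' hZ hZ' => by
    have hd : IntegrableOn (fun t => Z t - Z' t) (Icc 0 T) := hZ.sub hZ'
    calc ∫⁻ t in Icc 0 T, expWeight n t * ‖Φ Z t - Φ Z' t‖ₑ
        ≤ ∫⁻ t in Icc 0 T, ‖B‖ₑ * (‖a t‖ₑ * lconv (fun s => expWeight n s * ‖k s‖ₑ)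
            (fun s => expWeight n s * ‖Z s - Z' s‖ₑ) volume t) := by
          refine lintegral_mono_ae ?_
          filter_upwards [vconv_sub_right B hki hZ hZ'] with t ht
          have h1 : ‖Φ Z t - Φ Z' t‖ₑ ≤ ‖a t‖ₑ * ‖vconv B k (fun s => Z s - Z' s) volume t‖ₑ := by
            rw [← ofReal_norm, ← ofReal_norm, ← ofReal_norm,
              ← ENNReal.ofReal_mul (norm_nonneg _)]
            refine ENNReal.ofReal_le_ofReal ((hlip t _ _).trans ?_)
            rw [add_sub_add_left_eq_sub, ht]
            exact mul_le_mul_of_nonneg_right (le_abs_self _) (norm_nonneg _)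
          rw [← expWeight_mul_lconv]
          calc expWeight n t * ‖Φ Z t - Φ Z' t‖ₑ
              ≤ expWeight n t * (‖a t‖ₑ * (‖B‖ₑ *
                lconv (fun s => ‖k s‖ₑ) (fun s => ‖Z s - Z' s‖ₑ) volume t)) := by
                gcongr
                exact h1.trans (mul_le_mul_right (enorm_vconv_le _ _ _ _ _) _)
            _ = _ := by ring
      _ = ‖B‖ₑ * ∫⁻ t in Icc 0 T, ‖a t‖ₑ * lconv (fun s => expWeight n s * ‖k s‖ₑ)
            (fun s => expWeight n s * ‖Z s - Z' s‖ₑ) volume t :=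
          lintegral_const_mul' _ _ (by simp)
      _ ≤ ‖B‖ₑ * (((∫⁻ t in Icc 0 T, ‖a t‖ₑ ^ (2 : ℝ)) ^ (1 / 2 : ℝ) *
          (∫⁻ t in Icc 0 T, (expWeight n t * ‖k t‖ₑ) ^ (2 : ℝ)) ^ (1 / 2 : ℝ)) *
          ∫⁻ t in Icc 0 T, expWeight n t * ‖Z t - Z' t‖ₑ) := by
          refine mul_le_mul_right (lintegral_mul_lconv_le_L2 ha.1.enorm
            ((measurable_expWeight n).aemeasurable.mul hk.1.enorm)
            ((measurable_expWeight n).aemeasurable.mul hd.aestronglyMeasurable.enorm)) _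
      _ ≤ _ := by
          rw [← mul_assoc]
          exact mul_le_mul_left hn _
  refine ⟨fun s => f s + vconv B k Z volume s, hψ Z hZ, hΦi Z hZ, fun t ht => ?_⟩
  change f t + vconv B k Z volume t = f t + vconv B k (Φ Z) volume t
  rw [vconv_congr_right B k ht hfix]

/-- Uniqueness for Volterra equations whose nonlinearity is Lipschitz with an `L²` constant. -/
theorem volterra_solution_unique (B : A →L[ℝ] V →L[ℝ] V) {k : ℝ → A}
    {f φ ψ gφ gψ : ℝ → V} {a : ℝ → ℝ} (hk : MemLp k 2 (volume.restrict (Icc 0 T)))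
    (ha : MemLp a 2 (volume.restrict (Icc 0 T))) (ha1 : ∀ t, 1 ≤ a t)
    (hφ : MemLp φ 2 (volume.restrict (Icc 0 T))) (hψ : MemLp ψ 2 (volume.restrict (Icc 0 T)))
    (hgφ : IntegrableOn gφ (Icc 0 T)) (hgψ : IntegrableOn gψ (Icc 0 T))
    (hlip : ∀ t, ‖gφ t - gψ t‖ ≤ a t * ‖φ t - ψ t‖)
    (hφe : ∀ᵐ t ∂(volume.restrict (Icc 0 T)), φ t = f t + vconv B k gφ volume t)
    (hψe : ∀ᵐ t ∂(volume.restrict (Icc 0 T)), ψ t = f t + vconv B k gψ volume t) :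
    φ =ᵐ[volume.restrict (Icc 0 T)] ψ := by
  have hki : IntegrableOn k (Icc 0 T) := hk.integrable (by norm_num)
  have hd : MemLp (fun t => φ t - ψ t) 2 (volume.restrict (Icc 0 T)) := hφ.sub hψ
  have key := ae_eq_zero_of_le_lconv (T := T) (k := fun t => ‖B‖ₑ * ‖k t‖ₑ)
    (c := fun t => ‖a t‖ₑ) (y := fun t => ‖φ t - ψ t‖ₑ) (e := fun _ _ => 0)
    (hk.1.enorm.const_mul _) ?_ ha.1.enorm (lintegral_enorm_rpow_two_ne_top ha) ?_ hd.1.enorm ?_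
    (fun _ => aemeasurable_const) (by simp) ?_
  · filter_upwards [key] with t ht
    rw [enorm_eq_zero, sub_eq_zero] at ht
    exact ht
  · simp_rw [ENNReal.mul_rpow_of_nonneg _ _ zero_le_two]
    rw [lintegral_const_mul' _ _ (by simp)]
    exact ENNReal.mul_ne_top (by simp) (lintegral_enorm_rpow_two_ne_top hk)
  · intro t
    rw [← ofReal_norm, ENNReal.one_le_ofReal]
    exact (ha1 t).trans (le_abs_self _)
  · have h1 : Integrable (fun t => a t * ‖φ t - ψ t‖) (volume.restrict (Icc 0 T)) :=
      ha.integrable_mul hd.norm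
    have h2 := h1.2.ne
    simpa [enorm_mul] using h2
  · intro n
    filter_upwards [hφe, hψe, vconv_sub_right B hki hgφ hgψ] with t h1 h2 h3
    have h4 : φ t - ψ t = vconv B k (fun s => gφ s - gψ s) volume t := by
      rw [h3, h1, h2]; abel
    rw [h4]
    refine (enorm_vconv_le _ _ _ _ _).trans ?_
    rw [lconv, ← lintegral_const_mul' _ _ (by simp)]
    refine lintegral_mono fun s => ?_
    rw [← mul_assoc]
    refine mul_le_mul_right ?_ _
    simp only [add_zero]
    rw [← ofReal_norm, ← ofReal_norm, ← ofReal_norm,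
      ← ENNReal.ofReal_mul (norm_nonneg _)]
    refine ENNReal.ofReal_le_ofReal ((hlip s).trans ?_)
    exact mul_le_mul_of_nonneg_right (le_abs_self _) (norm_nonneg _)

end Abstract

/-! ### The linear majorant of solutions -/

section Majorant

variable {m : ℕ} {K : Fin m → ℝ → ℝ} {β : Matrix (Fin m) (Fin m) ℝ} {T : ℝ}

theorem memLp_mul_const {K : ℝ → Cmat m} {ρ : Measure ℝ} (hK : MemLp K 2 ρ) (B : Cmat m) :
    MemLp (fun t => K t * B) 2 ρ :=
  ((mulB m).flip B).comp_memLp' hK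

theorem memLp_kernelE {K : ℝ → Cmat m} {B : Cmat m}
    (hK : ∀ T : ℝ, 0 < T → MemLp K 2 (volume.restrict (Icc 0 T))) (hT : 0 < T) :
    MemLp (kernelE K B) 2 (volume.restrict (Icc 0 T)) := by
  have hKi : ∀ T : ℝ, 0 < T → IntegrableOn K (Icc 0 T) := fun T hT =>
    (hK T hT).integrable (by norm_num)
  have hKB : MemLp (fun t => K t * B) 2 (volume.restrict (Icc 0 T)) :=
    memLp_mul_const (hK T hT) B
  have h1 : MemLp (vconv (mulB m) (fun t => K t * B) (kernelE K B) volume) 2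
      (volume.restrict (Icc 0 T)) := memLp_vconv (mulB m) hKB (integrableOn_kernelE hKi hT)
  exact memLp_of_ae_eq_add (hK T hT) h1 (kernelE_eq hKi hT)

/-- The componentwise modulus of a vector. -/
def absVec (x : Cvec m) : Cvec m := WithLp.toLp 2 fun i => (‖x i‖ : ℂ)

theorem norm_absVec (x : Cvec m) : ‖absVec x‖ = ‖x‖ := by
  simp [EuclideanSpace.norm_eq, absVec]

theorem continuous_absVec : Continuous (absVec : Cvec m → Cvec m) := by
  unfold absVec
  fun_prop

/-- The function `u = E ∗ (|w_i|)_i ν` solves `u = K ∗ (|w_i|)_i ν + K ∗ (βᵀ u)`. -/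
theorem exists_majorant (hK : ∀ T : ℝ, 0 < T → ∀ i, MemLp (K i) 2 (volume.restrict (Icc 0 T)))
    (hT : 0 < T) {ν : Measure ℝ} [SFinite ν] {w : ℝ → Cvec m} (hw : IntegrableOn w (Icc 0 T) ν) :
    ∃ u : ℝ → Cvec m, MemLp u 2 (volume.restrict (Icc 0 T)) ∧
      (∀ t, ‖u t‖ₑ ≤ lconv (fun s => ‖kernelE (diagKernel K) (realMat β.transpose) s‖ₑ)
        (fun s => ‖w s‖ₑ) ν t) ∧
      ∀ i, ∀ᵐ t ∂(volume.restrict (Icc 0 T)), (u t i).re =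
        vconv (smulB ℝ) (K i) (fun s => ‖w s i‖) ν t +
          vconv (smulB ℝ) (K i) (fun s => ∑ j, β j i * (u s j).re) volume t := by
  set B : Cmat m := realMat β.transpose with hB
  have hD : ∀ T : ℝ, 0 < T → MemLp (diagKernel K) 2 (volume.restrict (Icc 0 T)) := fun T hT =>
    memLp_diagKernel (hK T hT)
  have hDi : ∀ T : ℝ, 0 < T → IntegrableOn (diagKernel K) (Icc 0 T) := fun T hT =>
    (hD T hT).integrable (by norm_num)
  have hKi : ∀ i, IntegrableOn (K i) (Icc 0 T) := fun i => (hK T hT i).integrable (by norm_num)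
  set E := kernelE (diagKernel K) B with hE
  have hE2 := memLp_kernelE (B := B) hD hT
  have hEi : IntegrableOn E (Icc 0 T) := integrableOn_kernelE hDi hT
  have hKB := integrableOn_mul_const (hDi T hT) B
  set F : ℝ → Cvec m := fun s => absVec (w s) with hF
  have hFi : IntegrableOn F (Icc 0 T) ν := by
    refine Integrable.mono hw (continuous_absVec.comp_aestronglyMeasurable hw.1)
      (.of_forall fun s => (norm_absVec _).le)
  set u := vconv (applyB m) E F ν with hu
  have hu2 : MemLp u 2 (volume.restrict (Icc 0 T)) := memLp_vconv (applyB m) hE2 hFi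
  have hui : IntegrableOn u (Icc 0 T) := hu2.integrable (by norm_num)
  have hBu : IntegrableOn (fun s => B (u s)) (Icc 0 T) := (applyB m B).integrable_comp hui
  refine ⟨u, hu2, fun t => ?_, fun i => ?_⟩
  · refine (enorm_vconv_le _ _ _ _ _).trans ((mul_le_mul_left enorm_applyB_le _).trans ?_)
    rw [one_mul]
    refine le_of_eq ?_
    congr 1
    funext s
    rw [← ofReal_norm, ← ofReal_norm, norm_absVec]
  · have hassoc : ∀ (a b : Cmat m) (v : Cvec m),
        applyB m a (applyB m b v) = applyB m (mulB m a b) v := fun a b v => rfl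
    have hvec : ∀ᵐ t ∂(volume.restrict (Icc 0 T)), u t =
        vconv (applyB m) (diagKernel K) F ν t +
          vconv (applyB m) (diagKernel K) (fun s => B (u s)) volume t := by
      filter_upwards [vconv_congr_left (applyB m) F ν (kernelE_eq (B := B) hDi hT),
        vconv_add_left (applyB m) (hDi T hT) (integrableOn_vconv (mulB m) hKB hEi) hFi,
        vconv_assoc (applyB m) (applyB m) (mulB m) (applyB m) hassoc hKB hEi hFi]
        with t h1 h2 h3
      rw [hu, h1, h2, ← h3]
      rfl
    have hFc : IntegrableOn (fun s => F s i) (Icc 0 T) ν :=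
      ((EuclideanSpace.proj (𝕜 := ℂ) i : Cvec m →L[ℂ] ℂ).restrictScalars ℝ).integrable_comp hFi
    have hBc : IntegrableOn (fun s => B (u s) i) (Icc 0 T) :=
      ((EuclideanSpace.proj (𝕜 := ℂ) i : Cvec m →L[ℂ] ℂ).restrictScalars ℝ).integrable_comp hBu
    filter_upwards [hvec, vconv_diagKernel_apply (hDi T hT) hFi,
      vconv_diagKernel_apply (hDi T hT) hBu, re_vconv (hKi i) hFc, re_vconv (hKi i) hBc]
      with t h1 h2 h3 h4 h5
    rw [h1, PiLp.add_apply, h2, h3, Complex.add_re, h4, h5]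
    congr 2
    funext s
    rw [hB, realMat_apply, Complex.re_sum]
    refine Finset.sum_congr rfl fun j _ => ?_
    rw [Complex.re_ofReal_mul, Matrix.transpose_apply]

end Majorant

/-! ### The quadratic nonlinearity and its truncation -/

section Truncation

/-- The radial truncation of complex numbers to the disc of radius `c`. -/
def trunc (c : ℝ) (x : ℂ) : ℂ := ((c / max c ‖x‖ : ℝ) : ℂ) * x

/-- The projection of complex numbers onto the half plane `Re x ≤ 0`. -/
def clipRe (x : ℂ) : ℂ := ⟨min x.re 0, x.im⟩

variable {c : ℝ} {x y : ℂ}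

theorem trunc_ratio_nonneg (hc : 0 ≤ c) (x : ℂ) : 0 ≤ c / max c ‖x‖ := by positivity

theorem trunc_eq_self (hc : 0 ≤ c) (hx : ‖x‖ ≤ c) : trunc c x = x := by
  rcases hc.eq_or_lt with rfl | hc
  · have : x = 0 := by simpa using hx
    simp [trunc, this]
  · rw [trunc, max_eq_left hx, div_self hc.ne']
    simp

theorem norm_trunc_le (hc : 0 ≤ c) (x : ℂ) : ‖trunc c x‖ ≤ c := by
  rw [trunc, norm_mul, Complex.norm_real, Real.norm_of_nonneg (trunc_ratio_nonneg hc x)]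
  rcases hc.eq_or_lt with rfl | hc
  · simp
  · have hM : 0 < max c ‖x‖ := lt_max_of_lt_left hc
    rw [div_mul_eq_mul_div, div_le_iff₀ hM]
    gcongr
    exact le_max_right _ _

theorem norm_trunc_sub_le (hc : 0 ≤ c) (x y : ℂ) : ‖trunc c x - trunc c y‖ ≤ 2 * ‖x - y‖ := by
  rcases hc.eq_or_lt with rfl | hc
  · simp [trunc]
  set M := max c ‖x‖ with hM
  set M' := max c ‖y‖ with hM'
  have hM0 : 0 < M := lt_max_of_lt_left hc
  have hM0' : 0 < M' := lt_max_of_lt_left hc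
  have e : trunc c x - trunc c y = ((c / M : ℝ) : ℂ) * (x - y) +
      ((c / M - c / M' : ℝ) : ℂ) * y := by
    simp only [trunc, ← hM, ← hM']
    push_cast; ring
  have h1 : ‖((c / M : ℝ) : ℂ) * (x - y)‖ ≤ ‖x - y‖ := by
    rw [norm_mul, Complex.norm_real, Real.norm_of_nonneg (by positivity)]
    have : c / M ≤ 1 := (div_le_one hM0).2 (le_max_left _ _)
    exact mul_le_of_le_one_left (norm_nonneg _) this
  have h2 : ‖((c / M - c / M' : ℝ) : ℂ) * y‖ ≤ ‖x - y‖ := by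
    rw [norm_mul, Complex.norm_real, Real.norm_eq_abs]
    have e2 : c / M - c / M' = c * (M' - M) / (M * M') := by field_simp
    have h3 : |M' - M| ≤ ‖x - y‖ := by
      have h4 : |M' - M| ≤ |‖y‖ - ‖x‖| := by
        rw [hM, hM', max_comm c ‖y‖, max_comm c ‖x‖]
        exact abs_max_sub_max_le_abs _ _ _
      rw [← norm_sub_rev y x]
      exact h4.trans (abs_norm_sub_norm_le y x)
    rw [e2, abs_div, abs_mul, abs_of_pos hc, abs_of_pos (mul_pos hM0 hM0'), div_mul_eq_mul_div,
      div_le_iff₀ (mul_pos hM0 hM0')]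
    have h5 : c * ‖y‖ ≤ M * M' := mul_le_mul (le_max_left _ _) (le_max_right _ _)
      (norm_nonneg _) hM0.le
    calc c * |M' - M| * ‖y‖ = |M' - M| * (c * ‖y‖) := by ring
      _ ≤ ‖x - y‖ * (M * M') := mul_le_mul h3 h5 (by positivity) (norm_nonneg _)
  rw [e]
  linarith [norm_add_le (((c / M : ℝ) : ℂ) * (x - y)) (((c / M - c / M' : ℝ) : ℂ) * y)]

theorem norm_clipRe_sub_le (x y : ℂ) : ‖clipRe x - clipRe y‖ ≤ ‖x - y‖ := by
  rw [← Real.sqrt_sq (norm_nonneg (clipRe x - clipRe y)), ← Real.sqrt_sq (norm_nonneg (x - y))]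
  refine Real.sqrt_le_sqrt ?_
  rw [← Complex.normSq_eq_norm_sq, ← Complex.normSq_eq_norm_sq, Complex.normSq_apply,
    Complex.normSq_apply]
  simp only [clipRe, Complex.sub_re, Complex.sub_im]
  have h : |min x.re 0 - min y.re 0| ≤ |x.re - y.re| := by
    simpa using abs_min_sub_min_le_max x.re 0 y.re 0
  have h2 := sq_le_sq.2 h
  nlinarith

theorem norm_clipRe_le (x : ℂ) : ‖clipRe x‖ ≤ ‖x‖ := by
  have h0 : clipRe 0 = 0 := by apply Complex.ext <;> simp [clipRe]
  simpa [h0] using norm_clipRe_sub_le x 0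

theorem continuous_clipRe : Continuous clipRe :=
  (LipschitzWith.of_dist_le_mul (K := 1) fun x y => by
    simpa [dist_eq_norm] using norm_clipRe_sub_le x y).continuous

theorem clipRe_eq_self (hx : x.re ≤ 0) : clipRe x = x := by
  simp [clipRe, min_eq_left hx]

/-- The truncated square `P(τ x) τ x`, with `τ` the truncation at radius `c` and `P` the
projection onto `Re x ≤ 0`. It equals `x²` if `Re x ≤ 0` and `|x| ≤ c`. -/
def truncSq (c : ℝ) (x : ℂ) : ℂ := clipRe (trunc c x) * trunc c x

theorem norm_truncSq_sub_le (hc : 0 ≤ c) (x y : ℂ) :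
    ‖truncSq c x - truncSq c y‖ ≤ 4 * c * ‖x - y‖ := by
  have e : truncSq c x - truncSq c y = clipRe (trunc c x) * (trunc c x - trunc c y) +
      (clipRe (trunc c x) - clipRe (trunc c y)) * trunc c y := by
    simp only [truncSq]; ring
  rw [e]
  refine (norm_add_le _ _).trans ?_
  rw [norm_mul, norm_mul]
  have h1 := (norm_clipRe_le (trunc c x)).trans (norm_trunc_le hc x)
  have h2 := norm_trunc_sub_le hc x y
  have h3 := (norm_clipRe_sub_le (trunc c x) (trunc c y)).trans h2
  have h4 := norm_trunc_le hc y
  have h5 : ‖clipRe (trunc c x)‖ * ‖trunc c x - trunc c y‖ ≤ c * (2 * ‖x - y‖) := by gcongr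
  have h6 : ‖clipRe (trunc c x) - clipRe (trunc c y)‖ * ‖trunc c y‖ ≤ 2 * ‖x - y‖ * c := by gcongr
  linarith

theorem aestronglyMeasurable_trunc {μ : Measure ℝ} {g : ℝ → ℝ} {f : ℝ → ℂ}
    (hg : AEStronglyMeasurable g μ) (hf : AEStronglyMeasurable f μ) :
    AEStronglyMeasurable (fun s => trunc (g s) (f s)) μ := by
  have h1 : AEStronglyMeasurable (fun s => g s / max (g s) ‖f s‖) μ :=
    (hg.aemeasurable.div (hg.aemeasurable.sup hf.norm.aemeasurable)).aestronglyMeasurable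
  exact (Complex.continuous_ofReal.comp_aestronglyMeasurable h1).mul hf

end Truncation

section Riccati

variable {m : ℕ} {β : Matrix (Fin m) (Fin m) ℝ} {σ : Fin m → ℝ}

theorem norm_toLp_le (f : Fin m → ℂ) : ‖(WithLp.toLp 2 f : Cvec m)‖ ≤ ∑ i, ‖f i‖ := by
  have : (WithLp.toLp 2 f : Cvec m) = ∑ i, EuclideanSpace.single i (f i) := by
    ext j
    simp
  rw [this]
  refine (norm_sum_le _ _).trans (le_of_eq ?_)
  simp

/-- The map `u ↦ βᵀ u + (σ_i²/2 q_i)_i`, in which `q` stands for the quadratic terms. -/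
def affineR (β : Matrix (Fin m) (Fin m) ℝ) (σ : Fin m → ℝ) (u : Cvec m) (q : Fin m → ℂ) :
    Cvec m :=
  WithLp.toLp 2 fun i => (∑ j, u j * (β j i : ℂ)) + ((σ i ^ 2 / 2 : ℝ) : ℂ) * q i

theorem riccatiR_eq_affineR (u : Cvec m) : riccatiR β σ u = affineR β σ u fun i => u i ^ 2 := rfl

theorem norm_affineR_sub_le (u w : Cvec m) (q r : Fin m → ℂ) :
    ‖affineR β σ u q - affineR β σ w r‖ ≤
      ‖realMat β.transpose‖ * ‖u - w‖ + ∑ i, σ i ^ 2 / 2 * ‖q i - r i‖ := by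
  have e : affineR β σ u q - affineR β σ w r = realMat β.transpose (u - w) +
      WithLp.toLp 2 fun i => ((σ i ^ 2 / 2 : ℝ) : ℂ) * (q i - r i) := by
    ext i
    simp only [affineR, PiLp.sub_apply, PiLp.add_apply, realMat_apply, Matrix.transpose_apply]
    simp only [mul_sub, Finset.sum_sub_distrib]
    simp only [mul_comm]
    ring
  rw [e]
  refine (norm_add_le _ _).trans (add_le_add (ContinuousLinearMap.le_opNorm _ _)
    ((norm_toLp_le _).trans (Finset.sum_le_sum fun i _ => ?_)))
  rw [norm_mul, Complex.norm_real, Real.norm_of_nonneg (by positivity)]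

theorem norm_riccatiR_sub_le (u w : Cvec m) : ‖riccatiR β σ u - riccatiR β σ w‖ ≤
    (‖realMat β.transpose‖ + (∑ i, σ i ^ 2 / 2) * (‖u‖ + ‖w‖)) * ‖u - w‖ := by
  rw [riccatiR_eq_affineR, riccatiR_eq_affineR]
  refine (norm_affineR_sub_le _ _ _ _).trans ?_
  rw [add_mul, Finset.sum_mul, Finset.sum_mul]
  refine add_le_add le_rfl (Finset.sum_le_sum fun i _ => ?_)
  have e : u i ^ 2 - w i ^ 2 = (u i + w i) * (u - w) i := by
    rw [PiLp.sub_apply]; ring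
  rw [e, norm_mul, mul_assoc]
  have h1 := PiLp.norm_apply_le u i
  have h2 := PiLp.norm_apply_le w i
  have h3 := PiLp.norm_apply_le (u - w) i
  have h4 := norm_add_le (u i) (w i)
  have h5 : ‖u i + w i‖ ≤ ‖u‖ + ‖w‖ := by linarith
  gcongr

theorem norm_riccatiR_le (u : Cvec m) : ‖riccatiR β σ u‖ ≤
    ‖realMat β.transpose‖ * ‖u‖ + (∑ i, σ i ^ 2 / 2) * ‖u‖ ^ 2 := by
  have h := norm_riccatiR_sub_le (β := β) (σ := σ) u 0
  have h0 : riccatiR β σ (0 : Cvec m) = 0 := by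
    ext i; simp [riccatiR]
  rw [h0, sub_zero, sub_zero, norm_zero, add_zero] at h
  calc _ ≤ _ := h
    _ = _ := by ring

theorem continuous_riccatiR : Continuous (riccatiR β σ) := by
  unfold riccatiR
  fun_prop

theorem integrable_riccatiR {ψ : ℝ → Cvec m} {μ : Measure ℝ} [IsFiniteMeasure μ]
    (hψ : MemLp ψ 2 μ) : Integrable (fun s => riccatiR β σ (ψ s)) μ := by
  have h1 : Integrable ψ μ := hψ.integrable (by norm_num)
  have h2 : Integrable (fun s => ‖ψ s‖ ^ 2) μ := by
    have := hψ.integrable_norm_pow (p := 2) (by norm_num)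
    exact this
  refine ((h1.norm.const_mul ‖realMat β.transpose‖).add
    (h2.const_mul (∑ i, σ i ^ 2 / 2))).mono'
    (continuous_riccatiR.comp_aestronglyMeasurable hψ.1) (.of_forall fun s => ?_)
  exact norm_riccatiR_le _

end Riccati

/-! ### Solutions on bounded intervals -/

namespace Admissible

variable {m : ℕ} {b : Fin m → ℝ} {β : Matrix (Fin m) (Fin m) ℝ} {σ : Fin m → ℝ}
  {K : Fin m → ℝ → ℝ}

theorem continuousOn (h : Admissible b β σ K) (i : Fin m) : ContinuousOn (K i) (Ioi 0) := by
  simpa using h.K_shift_continuous i 0 (by simp)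

theorem antitoneOn (h : Admissible b β σ K) (i : Fin m) : AntitoneOn (K i) (Ioi 0) := by
  simpa using h.K_shift_antitone i 0 (by simp)

theorem kernel_nonneg (h : Admissible b β σ K) (i : Fin m) {t : ℝ} (ht : 0 < t) : 0 ≤ K i t := by
  simpa using h.K_shift_nonneg i 0 (by simp) t ht

theorem posKernels (h : Admissible b β σ K) {T : ℝ} (hT : 0 < T) : PosKernels K T where
  memLp i := h.K_memL2Loc i T hT
  nonneg i _ ht := h.kernel_nonneg i ht
  completelyPositive i :=
    completelyPositive_of_shift ((h.K_memL2Loc i T hT).integrable (by norm_num))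
      (fun _ ht => h.kernel_nonneg i ht) (h.antitoneOn i) (h.continuousOn i)
      fun s hs hs1 => h.K_shift_resolvent i s ⟨hs.le, hs1⟩

end Admissible

section Coordinates

variable {m : ℕ} {β : Matrix (Fin m) (Fin m) ℝ} {σ : Fin m → ℝ} {K : Fin m → ℝ → ℝ} {T : ℝ}
  {ν : Measure ℝ} {v ψ : ℝ → Cvec m}

theorem integrableOn_coord {X : ℝ → Cvec m} {ρ : Measure ℝ} (hX : IntegrableOn X (Icc 0 T) ρ)
    (i : Fin m) : IntegrableOn (fun s => X s i) (Icc 0 T) ρ :=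
  ((EuclideanSpace.proj (𝕜 := ℂ) i : Cvec m →L[ℂ] ℂ).restrictScalars ℝ).integrable_comp hX

theorem memLp_coord {X : ℝ → Cvec m} {ρ : Measure ℝ} {p : ℝ≥0∞} (hX : MemLp X p ρ)
    (i : Fin m) : MemLp (fun s => X s i) p ρ :=
  ((EuclideanSpace.proj (𝕜 := ℂ) i : Cvec m →L[ℂ] ℂ).restrictScalars ℝ).comp_memLp' hX

theorem coord_of_equation [SFinite ν] (hK : IntegrableOn (diagKernel K) (Icc 0 T))
    (hv : IntegrableOn v (Icc 0 T) ν) {Z : ℝ → Cvec m} (hZ : IntegrableOn Z (Icc 0 T))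
    (hψ : ∀ᵐ t ∂(volume.restrict (Icc 0 T)), ψ t =
      vconv (applyB m) (diagKernel K) v ν t + vconv (applyB m) (diagKernel K) Z volume t) :
    ∀ i, ∀ᵐ t ∂(volume.restrict (Icc 0 T)), ψ t i =
      vconv (smulB ℂ) (K i) (fun s => v s i) ν t +
        vconv (smulB ℂ) (K i) (fun s => Z s i) volume t := by
  intro i
  filter_upwards [hψ, vconv_diagKernel_apply hK hv, vconv_diagKernel_apply hK hZ] with t h1 h2 h3
  rw [h1, PiLp.add_apply, h2, h3]

theorem convFun_apply (g : ℝ → Cvec m) {t : ℝ} (ht : 0 ≤ t) (i : Fin m) :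
    convFun K g t i = vconv (smulB ℂ) (K i) (fun s => g s i) volume t := by
  change ∫ s in (0 : ℝ)..t, (K i (t - s) : ℂ) * g s i = _
  rw [vconv, intervalIntegral.integral_of_le ht, integral_Ioc_eq_integral_Ioo,
    integral_Ico_eq_integral_Ioo]
  simp

/-- On `[0,T]`, the right-hand side of the Riccati equation in terms of a density of `μ`. -/
theorem riccatiRHS_apply {μ : LocFinMeasure m} (hd : IsDensity μ T ν v)
    (hKc : ∀ i, ContinuousOn (K i) (Ioi 0)) {t : ℝ} (ht : t ∈ Icc 0 T) (i : Fin m) :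
    riccatiRHS β σ K μ ψ t i = vconv (smulB ℂ) (K i) (fun s => v s i) ν t +
      vconv (smulB ℂ) (K i) (fun s => riccatiR β σ (ψ s) i) volume t := by
  rw [riccatiRHS, PiLp.add_apply, hd.convMeasure_apply hKc ht, convFun_apply _ ht.1]

theorem riccatiRHS_ae_eq {μ : LocFinMeasure m} (hd : IsDensity μ T ν v)
    (hKc : ∀ i, ContinuousOn (K i) (Ioi 0)) (hK : IntegrableOn (diagKernel K) (Icc 0 T))
    (hψ : MemLp ψ 2 (volume.restrict (Icc 0 T))) :
    ∀ᵐ t ∂(volume.restrict (Icc 0 T)), riccatiRHS β σ K μ ψ t =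
      vconv (applyB m) (diagKernel K) v ν t +
        vconv (applyB m) (diagKernel K) (fun s => riccatiR β σ (ψ s)) volume t := by
  have := hd.finite
  filter_upwards [vconv_diagKernel_apply hK (hd.integrable.integrableOn (s := Icc 0 T)),
    vconv_diagKernel_apply hK (integrable_riccatiR (β := β) (σ := σ) hψ),
    ae_restrict_mem measurableSet_Icc] with t h1 h2 ht
  ext i
  rw [riccatiRHS_apply hd hKc ht, PiLp.add_apply, h1, h2]

/-- Solutions of an equation whose quadratic terms have the form `z_i ψ_i` with `Re z_i ≤ 0` are
dominated by the solution `u` of the linear equation driven by `|v_i| ν`. -/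
theorem norm_coord_le_of_equation [SFinite ν] (hK : PosKernels K T)
    (hβ : ∀ i j, i ≠ j → 0 ≤ β i j)
    (hv : IntegrableOn v (Icc 0 T) ν) {u : ℝ → Cvec m}
    (hu2 : MemLp u 2 (volume.restrict (Icc 0 T)))
    (hu : ∀ i, ∀ᵐ t ∂(volume.restrict (Icc 0 T)), (u t i).re =
        vconv (smulB ℝ) (K i) (fun s => ‖v s i‖) ν t +
          vconv (smulB ℝ) (K i) (fun s => ∑ j, β j i * (u s j).re) volume t)
    {q : ℝ → Fin m → ℂ} {z : Fin m → ℝ → ℂ} (hψ2 : MemLp ψ 2 (volume.restrict (Icc 0 T)))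
    (hZ : IntegrableOn (fun s => affineR β σ (ψ s) (q s)) (Icc 0 T))
    (hψ : ∀ᵐ t ∂(volume.restrict (Icc 0 T)), ψ t =
      vconv (applyB m) (diagKernel K) v ν t +
        vconv (applyB m) (diagKernel K) (fun s => affineR β σ (ψ s) (q s)) volume t)
    (hz : ∀ i, AEStronglyMeasurable (z i) (volume.restrict (Icc 0 T)))
    (hzre : ∀ i t, (z i t).re ≤ 0)
    (hzq : ∀ i t, ((σ i ^ 2 / 2 : ℝ) : ℂ) * q t i = z i t * ψ t i) :
    ∀ᵐ t ∂(volume.restrict (Icc 0 T)), ∀ i, ‖ψ t i‖ ≤ (u t i).re := by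
  have hD : IntegrableOn (diagKernel K) (Icc 0 T) :=
    (memLp_diagKernel hK.memLp).integrable (by norm_num)
  have hψi : IntegrableOn ψ (Icc 0 T) := hψ2.integrable (by norm_num)
  have hui : IntegrableOn u (Icc 0 T) := hu2.integrable (by norm_num)
  have hh : ∀ i t, affineR β σ (ψ t) (q t) i = (∑ j, (β j i : ℂ) * ψ t j) + z i t * ψ t i := by
    intro i t
    rw [← hzq]
    simp only [affineR]
    congr 1
    exact Finset.sum_congr rfl fun j _ => mul_comm _ _
  refine norm_le_of_conv_equation (B := fun i j => β j i) (χ := fun i t => ψ t i)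
    (f := fun i t => v t i) (h := fun i t => affineR β σ (ψ t) (q t) i) (z := z)
    (u := fun i t => (u t i).re) (F := fun i s => ‖v s i‖) hK (fun i j hij => hβ j i hij)
    (fun i => integrableOn_coord hv i) (fun i => (integrableOn_coord hv i).norm)
    (fun i => .of_forall fun s => le_rfl) (fun i => integrableOn_coord hψi i)
    (fun i => (integrableOn_coord hui i).re) hz (fun i => ?_)
    (fun i => .of_forall fun t => hzre i t) (fun i => .of_forall fun t => hh i t)
    (coord_of_equation hD hv hZ hψ) hu
  have h1 : IntegrableOn (fun t => affineR β σ (ψ t) (q t) i - ∑ j, (β j i : ℂ) * ψ t j)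
      (Icc 0 T) := (integrableOn_coord hZ i).sub
    (integrable_finsetSum _ fun j _ => (integrableOn_coord hψi j).const_mul _)
  refine h1.congr (.of_forall fun t => ?_)
  simp only [hh]
  ring

theorem aestronglyMeasurable_affineR {ρ : Measure ℝ} {q : ℝ → Fin m → ℂ}
    (hψ : AEStronglyMeasurable ψ ρ) (hq : ∀ i, AEStronglyMeasurable (fun s => q s i) ρ) :
    AEStronglyMeasurable (fun s => affineR β σ (ψ s) (q s)) ρ := by
  have hc : ∀ i, AEStronglyMeasurable (fun s =>
      (∑ j, ψ s j * (β j i : ℂ)) + ((σ i ^ 2 / 2 : ℝ) : ℂ) * q s i) ρ := fun i => by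
    refine AEStronglyMeasurable.add ?_ ((hq i).const_mul _)
    refine Finset.aestronglyMeasurable_fun_sum _ fun j _ => AEStronglyMeasurable.mul_const ?_ _
    exact (EuclideanSpace.proj (𝕜 := ℂ) j : Cvec m →L[ℂ] ℂ).continuous.comp_aestronglyMeasurable hψ
  have hc' : AEMeasurable (fun s i =>
      (∑ j, ψ s j * (β j i : ℂ)) + ((σ i ^ 2 / 2 : ℝ) : ℂ) * q s i) ρ :=
    aemeasurable_pi_iff.2 fun i => (hc i).aemeasurable
  exact (PiLp.continuous_toLp 2 fun _ : Fin m => ℂ).comp_aestronglyMeasurable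
    hc'.aestronglyMeasurable

end Coordinates

theorem memLp_const_add {f : ℝ → ℝ} {ρ : Measure ℝ} [IsFiniteMeasure ρ] {p : ℝ≥0∞} (c : ℝ)
    (hf : MemLp f p ρ) : MemLp (fun t => c + f t) p ρ :=
  memLp_of_ae_eq_add (memLp_const c) hf (.of_forall fun _ => rfl)

section Local

variable {m : ℕ} {b : Fin m → ℝ} {β : Matrix (Fin m) (Fin m) ℝ} {σ : Fin m → ℝ}
  {K : Fin m → ℝ → ℝ} {T : ℝ} {ν : Measure ℝ} {v ψ : ℝ → Cvec m}

/-- Nonpositivity of the real parts: the quadratic terms `P(ψ_i) ψ_i`, with `P` the projection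
onto `Re x ≤ 0`, have real part at most `min(Re ψ_i, 0) Re ψ_i`. -/
theorem re_nonpos_of_equation [SFinite ν] (hK : PosKernels K T)
    (hβ : ∀ i j, i ≠ j → 0 ≤ β i j)
    (hv : IntegrableOn v (Icc 0 T) ν) (hvre : ∀ i, ∀ᵐ s ∂(ν.restrict (Icc 0 T)), (v s i).re ≤ 0)
    (hψ2 : MemLp ψ 2 (volume.restrict (Icc 0 T)))
    {q : ℝ → Fin m → ℂ} (hZ : IntegrableOn (fun s => affineR β σ (ψ s) (q s)) (Icc 0 T))
    (hq : ∀ᵐ t ∂(volume.restrict (Icc 0 T)), ∀ i, q t i = clipRe (ψ t i) * ψ t i)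
    (hψ : ∀ᵐ t ∂(volume.restrict (Icc 0 T)), ψ t =
      vconv (applyB m) (diagKernel K) v ν t +
        vconv (applyB m) (diagKernel K) (fun s => affineR β σ (ψ s) (q s)) volume t) :
    ∀ᵐ t ∂(volume.restrict (Icc 0 T)), ∀ i, (ψ t i).re ≤ 0 := by
  have hD : IntegrableOn (diagKernel K) (Icc 0 T) :=
    (memLp_diagKernel hK.memLp).integrable (by norm_num)
  have hψi : IntegrableOn ψ (Icc 0 T) := hψ2.integrable (by norm_num)
  have hre : ∀ i, AEStronglyMeasurable (fun t => (ψ t i).re) (volume.restrict (Icc 0 T)) :=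
    fun i => (integrableOn_coord hψi i).re.aestronglyMeasurable
  have hzm : ∀ i, AEStronglyMeasurable (fun t => σ i ^ 2 / 2 * min (ψ t i).re 0)
      (volume.restrict (Icc 0 T)) := fun i =>
    ((hre i).inf aestronglyMeasurable_const).const_mul _
  have key := nonneg_of_conv_equation (B := fun i j => β j i) (χ := fun i t => -(ψ t i).re)
    (f := fun i t => -(v t i).re) (h := fun i t => -(affineR β σ (ψ t) (q t) i).re)
    (z := fun i t => σ i ^ 2 / 2 * min (ψ t i).re 0) (ν := ν) hK (fun i j hij => hβ j i hij)
    (fun i => (integrableOn_coord hv i).re.neg)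
    (fun i => (hvre i).mono fun s hs => neg_nonneg.2 hs)
    (fun i => (integrableOn_coord hψi i).re.neg) (fun i => (integrableOn_coord hZ i).re.neg)
    hzm (fun i => ?_)
    (fun i => .of_forall fun t =>
      mul_nonpos_of_nonneg_of_nonpos (by positivity) (min_le_right _ _)) (fun i => ?_) (fun i => ?_)
  · filter_upwards [key] with t ht i
    exact neg_nonneg.1 (ht i)
  · have h1 : Integrable (fun t => σ i ^ 2 / 2 * ‖ψ t‖ ^ 2) (volume.restrict (Icc 0 T)) :=
      (hψ2.integrable_norm_pow (p := 2) (by norm_num)).const_mul _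
    refine h1.mono' ((hzm i).mul (hre i).neg) (.of_forall fun t => ?_)
    have h2 : |(ψ t i).re| ≤ ‖ψ t‖ := (Complex.abs_re_le_norm _).trans (PiLp.norm_apply_le _ _)
    have h3 : |min (ψ t i).re 0| ≤ ‖ψ t‖ := by
      refine le_trans ?_ h2
      simpa using abs_min_sub_min_le_max (ψ t i).re 0 0 0
    rw [norm_mul, norm_mul, norm_neg, Real.norm_eq_abs (min _ _), Real.norm_eq_abs (Complex.re _),
      Real.norm_of_nonneg (by positivity), mul_assoc, sq ‖ψ t‖]
    gcongr
  · filter_upwards [hq] with t ht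
    have hc : (clipRe (ψ t i) * ψ t i).re =
        min (ψ t i).re 0 * (ψ t i).re - (ψ t i).im * (ψ t i).im := Complex.mul_re _ _
    simp only [affineR, ht i, Complex.add_re, Complex.re_sum, Complex.re_mul_ofReal,
      Complex.re_ofReal_mul, hc]
    have e : ∑ j, β j i * -(ψ t j).re = -∑ j, (ψ t j).re * β j i := by
      rw [← Finset.sum_neg_distrib]
      exact Finset.sum_congr rfl fun j _ => by ring
    rw [e]
    have h2 : 0 ≤ σ i ^ 2 / 2 * ((ψ t i).im * (ψ t i).im) :=
      mul_nonneg (by positivity) (mul_self_nonneg _)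
    linarith
  · filter_upwards [coord_of_equation hD hv hZ hψ i,
      re_vconv (hK.integrableOn i) (integrableOn_coord hv i),
      re_vconv (hK.integrableOn i) (integrableOn_coord hZ i)] with t h1 h2 h3
    have hneg : ∀ (g : ℝ → ℝ) (ρ : Measure ℝ), vconv (smulB ℝ) (K i) (fun s => -g s) ρ t =
        -vconv (smulB ℝ) (K i) g ρ t := fun g ρ => by
      simp only [vconv, map_neg, integral_neg]
    rw [hneg, hneg, h1, Complex.add_re, h2, h3]
    ring

/-- The equation with the quadratic terms truncated at the radii `g_i` has a solution. -/
theorem exists_truncated_solution [SFinite ν] (hK : ∀ i, MemLp (K i) 2 (volume.restrict (Icc 0 T)))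
    (hv : IntegrableOn v (Icc 0 T) ν) {g : Fin m → ℝ → ℝ} (hg0 : ∀ i s, 0 ≤ g i s)
    (hg2 : ∀ i, MemLp (g i) 2 (volume.restrict (Icc 0 T))) :
    ∃ ψ : ℝ → Cvec m, MemLp ψ 2 (volume.restrict (Icc 0 T)) ∧
      IntegrableOn (fun s => affineR β σ (ψ s) fun i => truncSq (g i s) (ψ s i)) (Icc 0 T) ∧
      ∀ t ≤ T, ψ t = vconv (applyB m) (diagKernel K) v ν t + vconv (applyB m) (diagKernel K)
        (fun s => affineR β σ (ψ s) fun i => truncSq (g i s) (ψ s i)) volume t := by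
  have hD2 : MemLp (diagKernel K) 2 (volume.restrict (Icc 0 T)) := memLp_diagKernel hK
  have hNm : ∀ ψ : ℝ → Cvec m, AEStronglyMeasurable ψ (volume.restrict (Icc 0 T)) →
      AEStronglyMeasurable (fun s => affineR β σ (ψ s) fun i => truncSq (g i s) (ψ s i))
        (volume.restrict (Icc 0 T)) := fun ψ hψ => by
    refine aestronglyMeasurable_affineR hψ fun i => ?_
    have := aestronglyMeasurable_trunc (hg2 i).1 ((EuclideanSpace.proj (𝕜 := ℂ) i :
      Cvec m →L[ℂ] ℂ).continuous.comp_aestronglyMeasurable hψ)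
    exact (continuous_clipRe.comp_aestronglyMeasurable this).mul this
  have ha2 : MemLp (fun s => ‖realMat β.transpose‖ + ∑ i, σ i ^ 2 / 2 * 4 * g i s) 2
      (volume.restrict (Icc 0 T)) :=
    memLp_const_add _ (memLp_finsetSum _ fun i _ => (hg2 i).const_mul _)
  exact exists_volterra_solution
    (N := fun s x => affineR β σ x fun i => truncSq (g i s) (x i)) (applyB m) hD2
    (memLp_vconv (applyB m) hD2 hv) ha2 hNm (fun s x y => by
      refine (norm_affineR_sub_le _ _ _ _).trans ?_
      rw [add_mul, Finset.sum_mul]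
      refine add_le_add le_rfl (Finset.sum_le_sum fun i _ => ?_)
      rw [mul_assoc (σ i ^ 2 / 2), mul_assoc (σ i ^ 2 / 2)]
      refine mul_le_mul_of_nonneg_left ?_ (by positivity)
      refine (norm_truncSq_sub_le (hg0 i s) _ _).trans ?_
      exact mul_le_mul_of_nonneg_left (PiLp.norm_apply_le (x - y) i)
        (mul_nonneg (by norm_num) (hg0 i s))) (fun s => by
      ext i
      simp [affineR, truncSq, trunc])

/-- Existence on `[0,T]`. The equation in which `ψ_i²` is replaced by its truncation at the
radius `u_i`, with `u` the linear majorant, has a solution; by comparison the truncation is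
inactive. -/
theorem exists_local_solution [SFinite ν] (h : Admissible b β σ K) (hT : 0 < T)
    (hv : IntegrableOn v (Icc 0 T) ν)
    (hvre : ∀ i, ∀ᵐ s ∂(ν.restrict (Icc 0 T)), (v s i).re ≤ 0) :
    ∃ ψ : ℝ → Cvec m, MemLp ψ 2 (volume.restrict (Icc 0 T)) ∧
      (∀ᵐ t ∂(volume.restrict (Icc 0 T)), ∀ i, (ψ t i).re ≤ 0) ∧
      ∀ᵐ t ∂(volume.restrict (Icc 0 T)), ψ t =
        vconv (applyB m) (diagKernel K) v ν t +
          vconv (applyB m) (diagKernel K) (fun s => riccatiR β σ (ψ s)) volume t := by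
  have hK := h.posKernels hT
  obtain ⟨u, hu2, -, hu⟩ := exists_majorant (β := β) (fun T hT i => h.K_memL2Loc i T hT) hT hv
  set g : Fin m → ℝ → ℝ := fun i s => max (u s i).re 0 with hg
  have hg0 : ∀ i s, 0 ≤ g i s := fun i s => le_max_right _ _
  have hg2 : ∀ i, MemLp (g i) 2 (volume.restrict (Icc 0 T)) := fun i => by
    have h1 : MemLp (fun s => (u s i).re) 2 (volume.restrict (Icc 0 T)) := (memLp_coord hu2 i).re
    refine h1.of_le (h1.1.sup aestronglyMeasurable_const) (.of_forall fun s => ?_)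
    simpa [hg] using abs_max_sub_max_le_abs (u s i).re 0 0
  obtain ⟨ψ, hψ2, hZ, hψ⟩ := exists_truncated_solution (β := β) (σ := σ) hK.memLp hv hg0 hg2
  have hψe : ∀ᵐ t ∂(volume.restrict (Icc 0 T)), ψ t =
      vconv (applyB m) (diagKernel K) v ν t +
        vconv (applyB m) (diagKernel K)
          (fun s => affineR β σ (ψ s) fun i => truncSq (g i s) (ψ s i)) volume t := by
    filter_upwards [ae_restrict_mem measurableSet_Icc] with t ht using hψ t ht.2
  have htm : ∀ i, AEStronglyMeasurable (fun s => trunc (g i s) (ψ s i))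
      (volume.restrict (Icc 0 T)) := fun i =>
    aestronglyMeasurable_trunc (hg2 i).1 (memLp_coord hψ2 i).1
  have hbd := norm_coord_le_of_equation hK h.β_offdiag_nonneg hv hu2 hu hψ2 hZ hψe
    (z := fun i t => ((σ i ^ 2 / 2 * (g i t / max (g i t) ‖ψ t i‖) : ℝ) : ℂ) *
      clipRe (trunc (g i t) (ψ t i))) (fun i => ?_) (fun i t => ?_) (fun i t => ?_)
  rotate_left
  · have h1 : AEStronglyMeasurable (fun t => σ i ^ 2 / 2 * (g i t / max (g i t) ‖ψ t i‖))
        (volume.restrict (Icc 0 T)) :=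
      (((hg2 i).1.aemeasurable.div ((hg2 i).1.aemeasurable.sup
        (memLp_coord hψ2 i).1.norm.aemeasurable)).const_mul _).aestronglyMeasurable
    exact (Complex.continuous_ofReal.comp_aestronglyMeasurable h1).mul
      (continuous_clipRe.comp_aestronglyMeasurable (htm i))
  · rw [Complex.re_ofReal_mul]
    exact mul_nonpos_of_nonneg_of_nonpos
      (mul_nonneg (by positivity) (trunc_ratio_nonneg (hg0 i t) _)) (min_le_right _ _)
  · simp only [truncSq]
    rw [show trunc (g i t) (ψ t i) = ((g i t / max (g i t) ‖ψ t i‖ : ℝ) : ℂ) * ψ t i from rfl]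
    push_cast
    ring
  have htr : ∀ᵐ t ∂(volume.restrict (Icc 0 T)), ∀ i,
      truncSq (g i t) (ψ t i) = clipRe (ψ t i) * ψ t i := by
    filter_upwards [hbd] with t ht i
    rw [truncSq, trunc_eq_self (hg0 i t) ((ht i).trans (le_max_left _ _))]
  have hre := re_nonpos_of_equation hK h.β_offdiag_nonneg hv hvre hψ2 hZ htr hψe
  refine ⟨ψ, hψ2, hre, ?_⟩
  have hNR : (fun s => affineR β σ (ψ s) fun i => truncSq (g i s) (ψ s i))
      =ᵐ[volume.restrict (Icc 0 T)] fun s => riccatiR β σ (ψ s) := by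
    filter_upwards [htr, hre] with t h1 h2
    simp only [riccatiR_eq_affineR]
    congr 1
    funext i
    rw [h1 i, clipRe_eq_self (h2 i), sq]
  filter_upwards [hψe, ae_restrict_mem measurableSet_Icc] with t h1 ht
  rw [h1, vconv_congr_right (applyB m) _ ht.2 hNR]

theorem local_solution_unique (h : Admissible b β σ K) (hT : 0 < T) {f φ : ℝ → Cvec m}
    (hφ2 : MemLp φ 2 (volume.restrict (Icc 0 T))) (hψ2 : MemLp ψ 2 (volume.restrict (Icc 0 T)))
    (hφ : ∀ᵐ t ∂(volume.restrict (Icc 0 T)), φ t =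
      f t + vconv (applyB m) (diagKernel K) (fun s => riccatiR β σ (φ s)) volume t)
    (hψ : ∀ᵐ t ∂(volume.restrict (Icc 0 T)), ψ t =
      f t + vconv (applyB m) (diagKernel K) (fun s => riccatiR β σ (ψ s)) volume t) :
    φ =ᵐ[volume.restrict (Icc 0 T)] ψ := by
  have ha : MemLp (fun t => (1 + ‖realMat β.transpose‖) + (∑ i, σ i ^ 2 / 2) * (‖φ t‖ + ‖ψ t‖)) 2
      (volume.restrict (Icc 0 T)) :=
    memLp_const_add _ ((hφ2.norm.add hψ2.norm).const_mul _)
  have hc : 0 ≤ ∑ i, σ i ^ 2 / 2 := Finset.sum_nonneg fun i _ => by positivity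
  refine volterra_solution_unique (applyB m) (memLp_diagKernel fun i => h.K_memL2Loc i T hT) ha
    (fun t => ?_) hφ2 hψ2 (integrable_riccatiR hφ2) (integrable_riccatiR hψ2) (fun t => ?_) hφ hψ
  · have h1 := mul_nonneg hc (add_nonneg (norm_nonneg (φ t)) (norm_nonneg (ψ t)))
    have h2 := norm_nonneg (realMat β.transpose)
    linarith
  · refine (norm_riccatiR_sub_le _ _).trans (mul_le_mul_of_nonneg_right ?_ (norm_nonneg _))
    linarith

/-- The bound `‖ψ‖_q ≤ |μ|([0,T]) ‖E‖_q`, which holds for complex `μ` as well. -/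
theorem lintegral_solution_rpow_le [SFinite ν] (h : Admissible b β σ K) (hT : 0 < T)
    (hv : IntegrableOn v (Icc 0 T) ν)
    (hψ2 : MemLp ψ 2 (volume.restrict (Icc 0 T)))
    (hre : ∀ᵐ t ∂(volume.restrict (Icc 0 T)), ∀ i, (ψ t i).re ≤ 0)
    (hψ : ∀ᵐ t ∂(volume.restrict (Icc 0 T)), ψ t =
        vconv (applyB m) (diagKernel K) v ν t +
          vconv (applyB m) (diagKernel K) (fun s => riccatiR β σ (ψ s)) volume t)
    {q : ℝ} (hq : 1 ≤ q) :
    ∫⁻ t in Icc 0 T, ‖ψ t‖ₑ ^ q ≤ (∫⁻ s in Icc 0 T, ‖v s‖ₑ ∂ν) ^ q *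
      ∫⁻ t in Icc 0 T, ‖kernelE (diagKernel K) (realMat β.transpose) t‖ₑ ^ q := by
  have hK := h.posKernels hT
  obtain ⟨u, hu2, hub, hu⟩ := exists_majorant (β := β) (fun T hT i => h.K_memL2Loc i T hT) hT hv
  -- the factors `z_i = σ_i²/2 ψ_i` are clipped, as `Re z_i ≤ 0` is known only almost everywhere
  have hbd : ∀ᵐ t ∂(volume.restrict (Icc 0 T)), ∀ i, ‖ψ t i‖ ≤ (u t i).re := by
    have hcl : (fun s => riccatiR β σ (ψ s)) =ᵐ[volume.restrict (Icc 0 T)]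
        fun s => affineR β σ (ψ s) fun i => clipRe (ψ s i) * ψ s i := by
      filter_upwards [hre] with t ht
      rw [riccatiR_eq_affineR]
      congr 1
      funext i
      rw [clipRe_eq_self (ht i), sq]
    refine norm_coord_le_of_equation hK h.β_offdiag_nonneg hv hu2 hu hψ2
      ((integrable_riccatiR hψ2).congr hcl) ?_
      (z := fun i t => ((σ i ^ 2 / 2 : ℝ) : ℂ) * clipRe (ψ t i)) (fun i => ?_) (fun i t => ?_)
      (fun i t => by ring)
    · filter_upwards [hψ, ae_restrict_mem measurableSet_Icc] with t h1 ht
      rw [h1, ← vconv_congr_right (applyB m) _ ht.2 hcl]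
    · exact (continuous_clipRe.comp_aestronglyMeasurable (memLp_coord hψ2 i).1).const_mul _
    · rw [Complex.re_ofReal_mul]
      exact mul_nonpos_of_nonneg_of_nonpos (by positivity) (min_le_right _ _)
  have hE := memLp_kernelE (K := diagKernel K) (B := realMat β.transpose)
    (fun T hT => memLp_diagKernel fun i => h.K_memL2Loc i T hT) hT
  calc ∫⁻ t in Icc 0 T, ‖ψ t‖ₑ ^ q
      ≤ ∫⁻ t in Icc 0 T, lconv (fun s => ‖kernelE (diagKernel K) (realMat β.transpose) s‖ₑ)
        (fun s => ‖v s‖ₑ) ν t ^ q := by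
        refine lintegral_mono_ae ?_
        filter_upwards [hbd] with t ht
        refine ENNReal.rpow_le_rpow (le_trans ?_ (hub t)) (by linarith)
        rw [← ofReal_norm, ← ofReal_norm]
        refine ENNReal.ofReal_le_ofReal ?_
        rw [EuclideanSpace.norm_eq, EuclideanSpace.norm_eq]
        refine Real.sqrt_le_sqrt (Finset.sum_le_sum fun i _ => ?_)
        gcongr
        exact (ht i).trans (Complex.re_le_norm _)
    _ ≤ _ := lintegral_lconv_rpow_le hq hE.1.enorm hv.aestronglyMeasurable.enorm

end Local

/-! ### Existence, uniqueness and the `L^q` bound -/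

section Global

variable {m : ℕ} {b : Fin m → ℝ} {β : Matrix (Fin m) (Fin m) ℝ} {σ : Fin m → ℝ}
  {K : Fin m → ℝ → ℝ} {μ : LocFinMeasure m} {T : ℝ} {φ ψ : ℝ → Cvec m}

theorem riccatiRHS_congr (hφψ : φ =ᵐ[volume.restrict (Icc 0 T)] ψ) {t : ℝ} (ht : t ∈ Icc 0 T) :
    riccatiRHS β σ K μ φ t = riccatiRHS β σ K μ ψ t := by
  rw [riccatiRHS, riccatiRHS]
  congr 1
  ext i
  rw [convFun_apply _ ht.1, convFun_apply _ ht.1]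
  exact vconv_congr_right _ _ ht.2 (hφψ.mono fun s hs => by simp only [hs])

theorem memLp_Icc_mono {S T : ℝ} (hST : S ≤ T) (h : MemLp ψ 2 (volume.restrict (Icc 0 T))) :
    MemLp ψ 2 (volume.restrict (Icc 0 S)) :=
  h.mono_measure (Measure.restrict_mono (Icc_subset_Icc_right hST) le_rfl)

namespace Admissible

theorem integrableOn_diagKernel (h : Admissible b β σ K) (hT : 0 < T) :
    IntegrableOn (diagKernel K) (Icc 0 T) :=
  (memLp_diagKernel fun i => h.K_memL2Loc i T hT).integrable (by norm_num)

theorem riccati_unique_on (h : Admissible b β σ K) (hT : 0 < T)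
    (hφ2 : MemLp φ 2 (volume.restrict (Icc 0 T))) (hψ2 : MemLp ψ 2 (volume.restrict (Icc 0 T)))
    (hφ : ∀ᵐ t ∂(volume.restrict (Icc 0 T)), φ t = riccatiRHS β σ K μ φ t)
    (hψ : ∀ᵐ t ∂(volume.restrict (Icc 0 T)), ψ t = riccatiRHS β σ K μ ψ t) :
    φ =ᵐ[volume.restrict (Icc 0 T)] ψ := by
  obtain ⟨ν, v, hd⟩ := μ.exists_isDensity T
  refine local_solution_unique h hT (f := vconv (applyB m) (diagKernel K) v ν) hφ2 hψ2 ?_ ?_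
  · filter_upwards [hφ, riccatiRHS_ae_eq (β := β) (σ := σ) hd h.continuousOn
      (h.integrableOn_diagKernel hT) hφ2] with t h1 h2
    exact h1.trans h2
  · filter_upwards [hψ, riccatiRHS_ae_eq (β := β) (σ := σ) hd h.continuousOn
      (h.integrableOn_diagKernel hT) hψ2] with t h1 h2
    exact h1.trans h2

theorem exists_riccati_on (h : Admissible b β σ K) (hμ : μ.ReNonpos) (hT : 0 < T) :
    ∃ ψ : ℝ → Cvec m, MemLp ψ 2 (volume.restrict (Icc 0 T)) ∧
      (∀ᵐ t ∂(volume.restrict (Icc 0 T)), ∀ i, (ψ t i).re ≤ 0) ∧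
      ∀ᵐ t ∂(volume.restrict (Icc 0 T)), ψ t = riccatiRHS β σ K μ ψ t := by
  obtain ⟨ν, v, hd⟩ := μ.exists_isDensity T
  have := hd.finite
  obtain ⟨ψ, h1, h2, h3⟩ := exists_local_solution h hT hd.integrable.integrableOn
    fun i => ae_restrict_of_ae (hd.re_nonpos hT.le hμ i)
  refine ⟨ψ, h1, h2, ?_⟩
  filter_upwards [h3, riccatiRHS_ae_eq (β := β) (σ := σ) hd h.continuousOn
      (h.integrableOn_diagKernel hT) h1] with t h4 h5
  exact h4.trans h5.symm

/-- The local solutions glue to some `Y`; the right-hand side of the equation for `Y` is the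
representative for which the equation holds everywhere. -/
theorem exists_isRiccatiSolution (h : Admissible b β σ K) (hμ : μ.ReNonpos) :
    ∃ ψ : ℝ → Cvec m, IsRiccatiSolution β σ K μ ψ := by
  have hpos : ∀ n : ℕ, (0 : ℝ) < n + 1 := fun n => by positivity
  choose Z h1 h2 h3 using fun n : ℕ => h.exists_riccati_on hμ (hpos n)
  have hle : ∀ n : ℕ, (n : ℝ) ≤ n + 1 := fun n => by linarith
  obtain ⟨Y, hY⟩ := exists_glue Z fun n => by
    have hle' : (n : ℝ) + 1 ≤ (n + 1 : ℕ) + 1 := by push_cast; linarith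
    exact ae_restrict_Icc_mono (hle n) (h.riccati_unique_on (μ := μ) (hpos n) (h1 n)
      (memLp_Icc_mono hle' (h1 (n + 1))) (h3 n) (ae_restrict_Icc_mono hle' (h3 (n + 1))))
  have hψY : ∀ n : ℕ, riccatiRHS β σ K μ Y =ᵐ[volume.restrict (Icc (0 : ℝ) n)] Y := fun n => by
    filter_upwards [hY n, ae_restrict_Icc_mono (hle n) (h3 n), ae_restrict_mem measurableSet_Icc]
      with t e1 e2 ht
    rw [riccatiRHS_congr (hY n) ht, ← e2, e1]
  have hψZ : ∀ n : ℕ, riccatiRHS β σ K μ Y =ᵐ[volume.restrict (Icc (0 : ℝ) n)] Z n := fun n =>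
    (hψY n).trans (hY n)
  refine ⟨riccatiRHS β σ K μ Y, fun T hT => ?_, ?_, fun t ht => ?_⟩
  · exact memLp_Icc_mono (Nat.le_ceil T)
      ((memLp_congr_ae (hψZ ⌈T⌉₊)).2 (memLp_Icc_mono (hle _) (h1 ⌈T⌉₊)))
  · refine ae_restrict_Ici_of_forall_Icc fun n => ?_
    filter_upwards [hψZ n, ae_restrict_Icc_mono (hle n) (h2 n)] with t e1 e2
    rw [e1]
    exact e2
  · exact (riccatiRHS_congr (hψY ⌈t⌉₊) ⟨ht, Nat.le_ceil t⟩).symm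

theorem riccati_unique (h : Admissible b β σ K) (hψ : IsRiccatiSolution β σ K μ ψ)
    (hφ2 : MemL2Loc φ)
    (hφ : ∀ᵐ t ∂(volume.restrict (Ici (0 : ℝ))), φ t = riccatiRHS β σ K μ φ t) :
    φ =ᵐ[volume.restrict (Ici (0 : ℝ))] ψ := by
  refine ae_restrict_Ici_of_forall_Icc fun n => ?_
  have hpos : (0 : ℝ) < n + 1 := by positivity
  refine ae_restrict_Icc_mono (show (n : ℝ) ≤ n + 1 by linarith)
    (h.riccati_unique_on (μ := μ) hpos (hφ2 _ hpos) (hψ.memL2Loc _ hpos)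
      (ae_restrict_Icc_of_Ici hφ _) ?_)
  filter_upwards [ae_restrict_mem measurableSet_Icc] with t ht using hψ.eq_rhs t ht.1

end Admissible

theorem lpNorm_eq {E : Type*} [NormedAddCommGroup E] (f : ℝ → E) {q : ℝ} (hq : 0 < q) (T : ℝ) :
    lpNorm f q T = (∫⁻ t in Icc 0 T, ‖f t‖ₑ ^ q) ^ (1 / q) := by
  rw [lpNorm, eLpNorm_eq_lintegral_rpow_enorm_toReal (by simpa using hq) (by simp),
    ENNReal.toReal_ofReal hq.le]

theorem IsRiccatiSolution.lpNorm_le (h : Admissible b β σ K)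
    (hψ : IsRiccatiSolution β σ K μ ψ) (hT : 0 < T) {q : ℝ} (hq : 1 ≤ q) :
    lpNorm ψ q T ≤ μ.totalVar T * lpNorm (kernelE (diagKernel K) (realMat β.transpose)) q T := by
  obtain ⟨ν, v, hd⟩ := μ.exists_isDensity T
  have := hd.finite
  have hq0 : 0 < q := by linarith
  have hψ2 := hψ.memL2Loc T hT
  rw [lpNorm_eq _ hq0, lpNorm_eq _ hq0, hd.totalVar_eq]
  have key := lintegral_solution_rpow_le h hT (ν := ν) hd.integrable.integrableOn hψ2
    (ae_restrict_Icc_of_Ici hψ.re_nonpos T) ?_ hq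
  · calc _ ≤ _ := ENNReal.rpow_le_rpow key (by positivity)
      _ = _ := by
        rw [ENNReal.mul_rpow_of_nonneg _ _ (by positivity), ← ENNReal.rpow_mul,
          mul_one_div_cancel hq0.ne', ENNReal.rpow_one]
  · filter_upwards [ae_restrict_mem measurableSet_Icc, riccatiRHS_ae_eq (β := β) (σ := σ) hd
      h.continuousOn (h.integrableOn_diagKernel hT) hψ2] with t ht h2
    exact (hψ.eq_rhs t ht.1).trans h2

end Global

/-! ### Fractional Sobolev regularity of convolutions -/

section Gagliardo

variable {A : Type*} [NormedAddCommGroup A] {η p T : ℝ}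

/-- The integrand of the Gagliardo seminorm. -/
def gagIntegrand (f : ℝ → A) (η p x y : ℝ) : ℝ≥0∞ :=
  ‖f x - f y‖ₑ ^ p / ENNReal.ofReal (|x - y| ^ (1 + η * p))

theorem gagIntegrand_comm (f : ℝ → A) (η p x y : ℝ) :
    gagIntegrand f η p x y = gagIntegrand f η p y x := by
  rw [gagIntegrand, gagIntegrand, abs_sub_comm, ← enorm_neg, neg_sub]

theorem measurable_gagWeight (η p : ℝ) :
    Measurable fun z : ℝ × ℝ => ENNReal.ofReal (|z.1 - z.2| ^ (1 + η * p)) := by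
  fun_prop

theorem measurable_gagIntegrand {f : ℝ → A} (hf : StronglyMeasurable f) (η p : ℝ) :
    Measurable fun z : ℝ × ℝ => gagIntegrand f η p z.1 z.2 := by
  have h1 : StronglyMeasurable fun z : ℝ × ℝ => f z.1 - f z.2 :=
    (hf.comp_measurable measurable_fst).sub (hf.comp_measurable measurable_snd)
  exact (h1.enorm.pow_const p).div (measurable_gagWeight η p)

theorem lintegral_rotate {G : ℝ → ℝ → ℝ → ℝ≥0∞}
    (hG : Measurable fun z : (ℝ × ℝ) × ℝ => G z.1.1 z.1.2 z.2) (ρ π : Measure ℝ) [SFinite ρ]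
    [SFinite π] : ∫⁻ t, ∫⁻ s, ∫⁻ r, G t s r ∂π ∂ρ ∂ρ = ∫⁻ r, ∫⁻ t, ∫⁻ s, G t s r ∂ρ ∂ρ ∂π := by
  have h1 : Measurable fun z : ℝ × ℝ => ∫⁻ r, G z.1 z.2 r ∂π := hG.lintegral_prod_right'
  rw [← lintegral_prod (fun z : ℝ × ℝ => ∫⁻ r, G z.1 z.2 r ∂π) h1.aemeasurable,
    lintegral_lintegral_swap (f := fun (z : ℝ × ℝ) r => G z.1 z.2 r) hG.aemeasurable]
  refine lintegral_congr fun r => ?_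
  exact lintegral_prod (fun z : ℝ × ℝ => G z.1 z.2 r)
    (hG.comp (measurable_id.prodMk measurable_const)).aemeasurable

/-- Jensen's inequality and translation invariance bound the Gagliardo seminorm of a convolution
with `π`. -/
theorem gagliardo_conv_le {F : ℝ → A} (hF : StronglyMeasurable F) {π : Measure ℝ} [SFinite π]
    (hπ : ∀ᵐ r ∂π, 0 ≤ r) (hp : 1 ≤ p) :
    ∫⁻ t in Icc 0 T, ∫⁻ s in Icc 0 T, (∫⁻ r, ‖F (t - r) - F (s - r)‖ₑ ∂π) ^ p /
        ENNReal.ofReal (|t - s| ^ (1 + η * p)) ≤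
      π univ ^ p * ∫⁻ x in Iic T, ∫⁻ y in Iic T, gagIntegrand F η p x y := by
  have hm : Measurable fun z : (ℝ × ℝ) × ℝ => gagIntegrand F η p (z.1.1 - z.2) (z.1.2 - z.2) :=
    (measurable_gagIntegrand hF η p).comp
      (((measurable_fst.comp measurable_fst).sub measurable_snd).prodMk
        ((measurable_snd.comp measurable_fst).sub measurable_snd))
  have h1 : ∀ t s, (∫⁻ r, ‖F (t - r) - F (s - r)‖ₑ ∂π) ^ p /
        ENNReal.ofReal (|t - s| ^ (1 + η * p)) ≤
      π univ ^ (p - 1) * ∫⁻ r, gagIntegrand F η p (t - r) (s - r) ∂π := by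
    intro t s
    have hms : Measurable fun r => ‖F (t - r) - F (s - r)‖ₑ :=
      ((hF.comp_measurable (measurable_const.sub measurable_id)).sub
        (hF.comp_measurable (measurable_const.sub measurable_id))).enorm
    calc (∫⁻ r, ‖F (t - r) - F (s - r)‖ₑ ∂π) ^ p / ENNReal.ofReal (|t - s| ^ (1 + η * p))
        ≤ (π univ ^ (p - 1) * ∫⁻ r, ‖F (t - r) - F (s - r)‖ₑ ^ p ∂π) /
            ENNReal.ofReal (|t - s| ^ (1 + η * p)) :=
          ENNReal.div_le_div_right (lintegral_rpow_le hms.aemeasurable hp) _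
      _ = π univ ^ (p - 1) * ∫⁻ r, gagIntegrand F η p (t - r) (s - r) ∂π := by
          simp only [gagIntegrand, sub_sub_sub_cancel_right, div_eq_mul_inv]
          rw [lintegral_mul_const _ (hms.pow_const p), mul_assoc]
  have h2 : ∀ᵐ r ∂π, ∫⁻ t in Icc 0 T, ∫⁻ s in Icc 0 T, gagIntegrand F η p (t - r) (s - r) ≤
      ∫⁻ x in Iic T, ∫⁻ y in Iic T, gagIntegrand F η p x y := by
    filter_upwards [hπ] with r hr
    have hshift : ∀ f : ℝ → ℝ≥0∞, ∫⁻ t in Icc 0 T, f (t - r) ≤ ∫⁻ x in Iic T, f x := by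
      intro f
      calc ∫⁻ t in Icc 0 T, f (t - r) = ∫⁻ t, (Icc 0 T).indicator (fun t => f (t - r)) t :=
            (lintegral_indicator measurableSet_Icc _).symm
        _ ≤ ∫⁻ t, (Iic T).indicator f (t - r) := by
            refine lintegral_mono fun t => ?_
            by_cases ht : t ∈ Icc 0 T
            · rw [indicator_of_mem ht,
                indicator_of_mem (show t - r ∈ Iic T from by simp only [mem_Iic]; linarith [ht.2])]
            · rw [indicator_of_notMem ht]
              exact zero_le
        _ = ∫⁻ x in Iic T, f x := by
            rw [lintegral_sub_right_eq_self (fun x => (Iic T).indicator f x) r,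
              lintegral_indicator measurableSet_Iic]
    calc ∫⁻ t in Icc 0 T, ∫⁻ s in Icc 0 T, gagIntegrand F η p (t - r) (s - r)
        ≤ ∫⁻ t in Icc 0 T, ∫⁻ y in Iic T, gagIntegrand F η p (t - r) y :=
          lintegral_mono fun t => hshift fun y => gagIntegrand F η p (t - r) y
      _ ≤ _ := hshift fun x => ∫⁻ y in Iic T, gagIntegrand F η p x y
  have hm2 : Measurable fun z : ℝ × ℝ => ∫⁻ r, gagIntegrand F η p (z.1 - r) (z.2 - r) ∂π :=
    hm.lintegral_prod_right'
  calc _ ≤ ∫⁻ t in Icc 0 T, ∫⁻ s in Icc 0 T,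
        π univ ^ (p - 1) * ∫⁻ r, gagIntegrand F η p (t - r) (s - r) ∂π :=
        lintegral_mono fun t => lintegral_mono fun s => h1 t s
    _ = π univ ^ (p - 1) * ∫⁻ t in Icc 0 T, ∫⁻ s in Icc 0 T,
          ∫⁻ r, gagIntegrand F η p (t - r) (s - r) ∂π := by
        rw [← lintegral_const_mul _ (f := fun t => ∫⁻ s in Icc 0 T,
          ∫⁻ r, gagIntegrand F η p (t - r) (s - r) ∂π) hm2.lintegral_prod_right']
        refine lintegral_congr fun t => ?_
        exact lintegral_const_mul _ (hm2.comp measurable_prodMk_left)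
    _ = π univ ^ (p - 1) * ∫⁻ r, (∫⁻ t in Icc 0 T, ∫⁻ s in Icc 0 T,
          gagIntegrand F η p (t - r) (s - r)) ∂π := by
        rw [lintegral_rotate (G := fun t s r => gagIntegrand F η p (t - r) (s - r)) hm]
    _ ≤ π univ ^ (p - 1) * ∫⁻ r, (∫⁻ x in Iic T, ∫⁻ y in Iic T, gagIntegrand F η p x y) ∂π :=
        mul_le_mul_right (lintegral_mono_ae h2) _
    _ = _ := by
        rw [lintegral_const, mul_left_comm, mul_comm]
        congr 1
        have := ENNReal.rpow_add_of_nonneg (x := π univ) (p - 1) 1 (by linarith) zero_le_one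
        rw [sub_add_cancel, ENNReal.rpow_one] at this
        exact this.symm

theorem lintegral_Iic_rpow {x a : ℝ} (hx : 0 < x) (ha : 0 < a) :
    ∫⁻ y in Iic 0, (ENNReal.ofReal (|x - y| ^ (1 + a)))⁻¹ =
      ENNReal.ofReal (1 / a) * ENNReal.ofReal (x ^ (-a)) := by
  have e : ∀ z ∈ Ici x, (ENNReal.ofReal (|z| ^ (1 + a)))⁻¹ = ENNReal.ofReal (z ^ (-a - 1)) := by
    intro z hz
    have hz0 : 0 < z := hx.trans_le hz
    rw [← ENNReal.ofReal_inv_of_pos (by positivity), abs_of_pos hz0, ← Real.rpow_neg hz0.le]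
    congr 2
    ring
  have hi := integrableOn_Ioi_rpow_of_lt (show -a - 1 < -1 by linarith) hx
  calc ∫⁻ y in Iic 0, (ENNReal.ofReal (|x - y| ^ (1 + a)))⁻¹
      = ∫⁻ y, (Ici x).indicator (fun z => (ENNReal.ofReal (|z| ^ (1 + a)))⁻¹) (x - y) := by
        rw [← lintegral_indicator measurableSet_Iic]
        refine lintegral_congr fun y => ?_
        by_cases hy : y ≤ 0
        · rw [indicator_of_mem (show y ∈ Iic 0 from hy),
            indicator_of_mem (show x - y ∈ Ici x from by simpa using hy)]
        · rw [indicator_of_notMem (show y ∉ Iic 0 from hy),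
            indicator_of_notMem (show x - y ∉ Ici x from by simpa using hy)]
    _ = ∫⁻ z in Ici x, (ENNReal.ofReal (|z| ^ (1 + a)))⁻¹ := by
        rw [lintegral_sub_left_eq_self
          (fun z => (Ici x).indicator (fun z => (ENNReal.ofReal (|z| ^ (1 + a)))⁻¹) z) x,
          lintegral_indicator measurableSet_Ici]
    _ = ∫⁻ z in Ioi x, ENNReal.ofReal (z ^ (-a - 1)) := by
        rw [setLIntegral_congr_fun measurableSet_Ici e]
        exact setLIntegral_congr Ioi_ae_eq_Ici.symm
    _ = ENNReal.ofReal (∫ z in Ioi x, z ^ (-a - 1)) := by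
        refine (ofReal_integral_eq_lintegral_ofReal hi ?_).symm
        filter_upwards [ae_restrict_mem measurableSet_Ioi] with z hz
        exact Real.rpow_nonneg (hx.trans hz).le _
    _ = _ := by
        rw [integral_Ioi_rpow_of_lt (show -a - 1 < -1 by linarith) hx,
          ← ENNReal.ofReal_mul (by positivity)]
        congr 1
        rw [sub_add_cancel]
        field_simp

/-- The Gagliardo seminorm on `(-∞,T]` of the extension by zero of `f`. -/
theorem lintegral_gagIntegrand_indicator_le {f : ℝ → A}
    (hf : StronglyMeasurable ((Ioc 0 T).indicator f)) (hη : 0 < η) (hp : 0 < p) :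
    ∫⁻ x in Iic T, ∫⁻ y in Iic T, gagIntegrand ((Ioc 0 T).indicator f) η p x y ≤
      gagliardo f η p T + ENNReal.ofReal (2 / (η * p)) *
        ∫⁻ t in Icc 0 T, ENNReal.ofReal (t ^ (-(η * p))) * ‖f t‖ₑ ^ p := by
  set F := (Ioc 0 T).indicator f with hF
  have ha : 0 < η * p := mul_pos hη hp
  rcases lt_or_ge T 0 with hT | hT
  · have hz : ∀ x ∈ Iic T, ∀ y ∈ Iic T, gagIntegrand F η p x y = 0 := by
      intro x hx y hy
      have h0 : ∀ x ∈ Iic T, F x = 0 := fun x hx =>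
        indicator_of_notMem (fun h => absurd h.1 (not_lt.2 (le_trans hx hT.le))) _
      simp [gagIntegrand, h0 x hx, h0 y hy, hp]
    rw [setLIntegral_congr_fun measurableSet_Iic fun x hx =>
      setLIntegral_congr_fun measurableSet_Iic fun y hy => hz x hx y hy]
    simp
  have hm := measurable_gagIntegrand hf η p
  have hsplit : ∀ g : ℝ → ℝ≥0∞, ∫⁻ x in Iic T, g x = (∫⁻ x in Iic 0, g x) + ∫⁻ x in Ioc 0 T, g x :=
    fun g => by
      rw [← Iic_union_Ioc_eq_Iic hT]
      exact lintegral_union measurableSet_Ioc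
        (disjoint_left.2 fun x hx hx' => absurd hx'.1 (not_lt.2 hx))
  have hneg : ∀ x ∈ Iic (0 : ℝ), F x = 0 := fun x hx =>
    indicator_of_notMem (fun h => absurd h.1 (not_lt.2 hx)) _
  have hpos : ∀ x ∈ Ioc 0 T, F x = f x := fun x hx => indicator_of_mem hx _
  set P := ∫⁻ x in Ioc 0 T, ∫⁻ y in Iic 0, gagIntegrand F η p x y with hP
  have hcross : P ≤ ENNReal.ofReal (1 / (η * p)) *
      ∫⁻ t in Icc 0 T, ENNReal.ofReal (t ^ (-(η * p))) * ‖f t‖ₑ ^ p := by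
    calc P = ∫⁻ x in Ioc 0 T, ENNReal.ofReal (1 / (η * p)) *
          (ENNReal.ofReal (x ^ (-(η * p))) * ‖f x‖ₑ ^ p) := by
          refine setLIntegral_congr_fun measurableSet_Ioc fun x hx => ?_
          have e1 : ∀ y ∈ Iic (0 : ℝ), gagIntegrand F η p x y =
              ‖f x‖ₑ ^ p * (ENNReal.ofReal (|x - y| ^ (1 + η * p)))⁻¹ := fun y hy => by
            rw [gagIntegrand, hneg y hy, hpos x hx, sub_zero, div_eq_mul_inv]
          rw [setLIntegral_congr_fun measurableSet_Iic e1, lintegral_const_mul,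
            lintegral_Iic_rpow hx.1 ha]
          · ring
          · fun_prop
      _ = ENNReal.ofReal (1 / (η * p)) * ∫⁻ x in Ioc 0 T,
            (ENNReal.ofReal (x ^ (-(η * p))) * ‖f x‖ₑ ^ p) :=
          lintegral_const_mul' _ _ ENNReal.ofReal_ne_top
      _ ≤ _ := mul_le_mul_right (lintegral_mono_set Ioc_subset_Icc_self) _
  have hswap : ∫⁻ x in Iic 0, ∫⁻ y in Ioc 0 T, gagIntegrand F η p x y = P := by
    rw [lintegral_lintegral_swap (f := fun x y => gagIntegrand F η p x y) hm.aemeasurable]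
    exact lintegral_congr fun x => lintegral_congr fun y => gagIntegrand_comm F η p y x
  have hdiag : ∫⁻ x in Ioc 0 T, ∫⁻ y in Ioc 0 T, gagIntegrand F η p x y ≤ gagliardo f η p T := by
    rw [setLIntegral_congr_fun measurableSet_Ioc fun x hx =>
      setLIntegral_congr_fun measurableSet_Ioc fun y hy => show gagIntegrand F η p x y =
        gagIntegrand f η p x y by rw [gagIntegrand, gagIntegrand, hpos x hx, hpos y hy]]
    exact (lintegral_mono_set Ioc_subset_Icc_self).trans
      (lintegral_mono fun x => lintegral_mono_set Ioc_subset_Icc_self)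
  have hzero : ∫⁻ x in Iic 0, ∫⁻ y in Iic 0, gagIntegrand F η p x y = 0 := by
    rw [setLIntegral_congr_fun measurableSet_Iic fun x hx =>
      setLIntegral_congr_fun measurableSet_Iic fun y hy => show gagIntegrand F η p x y = 0 by
        simp [gagIntegrand, hneg x hx, hneg y hy, hp]]
    simp
  have hm1 : Measurable fun x => ∫⁻ y in Iic 0, gagIntegrand F η p x y :=
    hm.lintegral_prod_right'
  rw [hsplit]
  simp_rw [hsplit (fun y => gagIntegrand F η p _ y)]
  rw [lintegral_add_left hm1, lintegral_add_left hm1, hzero, hswap, zero_add]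
  calc P + (P + ∫⁻ x in Ioc 0 T, ∫⁻ y in Ioc 0 T, gagIntegrand F η p x y)
      ≤ _ + (_ + _) := add_le_add hcross (add_le_add hcross hdiag)
    _ = _ := by
      rw [show 2 / (η * p) = 1 / (η * p) + 1 / (η * p) by ring,
        ENNReal.ofReal_add (by positivity) (by positivity)]
      ring

end Gagliardo

section Difference

variable {A V W : Type*} [NormedAddCommGroup A] [NormedSpace ℝ A] [NormedAddCommGroup V]
  [NormedSpace ℝ V] [NormedAddCommGroup W] [NormedSpace ℝ W] {T : ℝ}

theorem enorm_vconv_sub_le (B : A →L[ℝ] V →L[ℝ] W) {f : ℝ → A} {h : ℝ → V} {ρ : Measure ℝ}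
    [SFinite ρ] (hf : IntegrableOn f (Icc 0 T)) (hh : IntegrableOn h (Icc 0 T) ρ) :
    ∀ᵐ t ∂(volume.restrict (Icc 0 T)), ∀ᵐ s ∂(volume.restrict (Icc 0 T)),
      ‖vconv B f h ρ t - vconv B f h ρ s‖ₑ ≤ ‖B‖ₑ *
        ∫⁻ r, ‖(Ioc 0 T).indicator f (t - r) - (Ioc 0 T).indicator f (s - r)‖ₑ *
          ‖(Ico 0 T).indicator h r‖ₑ ∂ρ := by
  have key : ∀ᵐ t ∂(volume.restrict (Icc 0 T)), t ∈ Icc 0 T ∧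
      Integrable (fun r => B ((Ioc 0 T).indicator f (t - r)) ((Ico 0 T).indicator h r)) ρ := by
    filter_upwards [ae_restrict_of_ae (integrable_conv_prod B hf hh).prod_right_ae,
      ae_restrict_mem measurableSet_Icc] with t h1 ht
    exact ⟨ht, h1⟩
  filter_upwards [key] with t ht
  filter_upwards [key] with s hs
  rw [vconv_eq_indicator B f h ρ ht.1.2, vconv_eq_indicator B f h ρ hs.1.2,
    ← integral_sub ht.2 hs.2, ← lintegral_const_mul' _ _ (by simp)]
  refine (enorm_integral_le_lintegral_enorm _).trans (lintegral_mono fun r => ?_)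
  rw [← sub_apply, ← map_sub, ← mul_assoc]
  refine (ContinuousLinearMap.le_opENorm _ _).trans ?_
  gcongr
  exact ContinuousLinearMap.le_opENorm _ _

end Difference

section Kernel

variable {m : ℕ} {K : Fin m → ℝ → ℝ} {η p T : ℝ}

theorem stronglyMeasurable_indicator_diagKernel (hK : ∀ i, ContinuousOn (K i) (Ioi 0)) (T : ℝ) :
    StronglyMeasurable ((Ioc 0 T).indicator (diagKernel K)) := by
  classical
  have h1 : ∀ i, Measurable ((Ioc 0 T).indicator (K i)) := fun i => by
    rw [← piecewise_eq_indicator]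
    exact ContinuousOn.measurable_piecewise ((hK i).mono Ioc_subset_Ioi_self)
      continuousOn_const measurableSet_Ioc
  have e : (Ioc 0 T).indicator (diagKernel K) = fun t => ∑ i, (Ioc 0 T).indicator (K i) t •
      realMat (Matrix.diagonal (Pi.single i (1 : ℝ))) := by
    funext t
    by_cases ht : t ∈ Ioc 0 T
    · simp only [indicator_of_mem ht, diagKernel_eq_sum]
    · simp only [indicator_of_notMem ht]
      exact (Finset.sum_eq_zero fun i _ => zero_smul ℝ (_ : Cmat m)).symm
  rw [e]
  refine Finset.stronglyMeasurable_fun_sum _ fun i _ => ?_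
  exact (h1 i).stronglyMeasurable.smul_const _

theorem lintegral_enorm_rpow_le_of_weight {A : Type*} [NormedAddCommGroup A] (f : ℝ → A)
    (ha : 0 ≤ η * p) :
    ∫⁻ t in Icc 0 T, ‖f t‖ₑ ^ p ≤ ENNReal.ofReal (T ^ (η * p)) *
      ∫⁻ t in Icc 0 T, ENNReal.ofReal (t ^ (-(η * p))) * ‖f t‖ₑ ^ p := by
  rw [← lintegral_const_mul' _ _ ENNReal.ofReal_ne_top]
  refine lintegral_mono_ae ?_
  filter_upwards [ae_pos_restrict_Icc T, ae_restrict_mem measurableSet_Icc] with t h0 ht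
  rw [← mul_assoc, ← ENNReal.ofReal_mul (Real.rpow_nonneg (h0.le.trans ht.2) _)]
  refine le_mul_of_one_le_left zero_le ?_
  rw [ENNReal.one_le_ofReal, Real.rpow_neg h0.le, ← div_eq_mul_inv,
    one_le_div (Real.rpow_pos_of_pos h0 _)]
  exact Real.rpow_le_rpow h0.le ht.2 ha

theorem memLp_of_kernelBracket_lt_top {D : ℝ → Cmat m}
    (hD : AEStronglyMeasurable D (volume.restrict (Icc 0 T))) (hη : 0 < η) (hp : 0 < p)
    (h : kernelBracket D η p T < ⊤) : MemLp D (ENNReal.ofReal p) (volume.restrict (Icc 0 T)) := by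
  refine ⟨hD, ?_⟩
  rw [eLpNorm_lt_top_iff_lintegral_rpow_enorm_lt_top (by simpa using hp) (by simp),
    ENNReal.toReal_ofReal hp.le]
  refine (lintegral_enorm_rpow_le_of_weight D (mul_pos hη hp).le).trans_lt ?_
  rw [kernelBracket, ENNReal.rpow_lt_top_iff_of_pos (by positivity), ENNReal.add_lt_top] at h
  exact ENNReal.mul_lt_top ENNReal.ofReal_lt_top h.1

end Kernel

section Sobolev

variable {m : ℕ} {b : Fin m → ℝ} {β : Matrix (Fin m) (Fin m) ℝ} {σ : Fin m → ℝ}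
  {K : Fin m → ℝ → ℝ} {μ : LocFinMeasure m} {η p T : ℝ} {ψ : ℝ → Cvec m}

theorem IsRiccatiSolution.exists_ae_eq (h : Admissible b β σ K)
    (hψ : IsRiccatiSolution β σ K μ ψ) (hT : 0 < T) :
    ∃ ν v, IsDensity μ T ν v ∧ ∀ᵐ t ∂(volume.restrict (Icc 0 T)), ψ t =
      vconv (applyB m) (diagKernel K) v ν t +
        vconv (applyB m) (diagKernel K) (fun s => riccatiR β σ (ψ s)) volume t := by
  obtain ⟨ν, v, hd⟩ := μ.exists_isDensity T
  refine ⟨ν, v, hd, ?_⟩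
  filter_upwards [ae_restrict_mem measurableSet_Icc, riccatiRHS_ae_eq (β := β) (σ := σ) hd
    h.continuousOn (h.integrableOn_diagKernel hT) (hψ.memL2Loc T hT)] with t ht h2
  exact (hψ.eq_rhs t ht.1).trans h2

theorem IsRiccatiSolution.memLp (h : Admissible b β σ K) (hψ : IsRiccatiSolution β σ K μ ψ)
    (hT : 0 < T) (hη : 0 < η) (hp : 1 ≤ p) (hbr : kernelBracket (diagKernel K) η p T < ⊤) :
    MemLp ψ (ENNReal.ofReal p) (volume.restrict (Icc 0 T)) := by
  obtain ⟨ν, v, hd, he⟩ := hψ.exists_ae_eq h hT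
  have := hd.finite
  have hD : MemLp (diagKernel K) (ENNReal.ofReal p) (volume.restrict (Icc 0 T)) :=
    memLp_of_kernelBracket_lt_top (h.integrableOn_diagKernel hT).aestronglyMeasurable hη
      (by linarith) hbr
  exact memLp_of_ae_eq_add (memLp_vconv_rpow (applyB m) hp hD hd.integrable.integrableOn)
    (memLp_vconv_rpow (applyB m) hp hD (integrable_riccatiR (hψ.memL2Loc T hT))) he

theorem lintegral_mul_enorm_eq_withDensity {V : Type*} [NormedAddCommGroup V] {ρ : Measure ℝ}
    {H : ℝ → V} (hH : AEStronglyMeasurable H ρ) {Φ : ℝ → ℝ≥0∞} (hΦ : Measurable Φ) :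
    ∫⁻ r, Φ r * ‖H r‖ₑ ∂ρ = ∫⁻ r, Φ r ∂(ρ.withDensity fun r => ‖H r‖ₑ) := by
  rw [lintegral_withDensity_eq_lintegral_mul₀' hH.enorm hΦ.aemeasurable]
  simp [mul_comm]

theorem withDensity_indicator_Ico_univ {V : Type*} [NormedAddCommGroup V] (ρ : Measure ℝ)
    (f : ℝ → V) : (ρ.withDensity fun r => ‖(Ico 0 T).indicator f r‖ₑ) univ ≤
      ∫⁻ s in Icc 0 T, ‖f s‖ₑ ∂ρ := by
  rw [withDensity_apply _ MeasurableSet.univ, Measure.restrict_univ]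
  simp_rw [enorm_indicator_eq_indicator_enorm]
  rw [lintegral_indicator measurableSet_Ico]
  exact lintegral_mono_set Ico_subset_Icc_self

theorem ae_withDensity_indicator_Ico {V : Type*} [NormedAddCommGroup V] (ρ : Measure ℝ)
    (f : ℝ → V) : ∀ᵐ r ∂(ρ.withDensity fun r => ‖(Ico 0 T).indicator f r‖ₑ), 0 ≤ r := by
  have : (ρ.withDensity fun r => ‖(Ico 0 T).indicator f r‖ₑ) (Iio 0) = 0 := by
    rw [withDensity_apply _ measurableSet_Iio, setLIntegral_congr_fun measurableSet_Iio
      (g := fun _ => 0) fun r hr => ?_, lintegral_zero]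
    simp [indicator_of_notMem (show r ∉ Ico 0 T from fun h => absurd h.1 (not_le.2 hr))]
  rw [ae_iff]
  convert this using 2
  ext r
  simp

/-- The Gagliardo seminorm of a solution is that of `K ∗ π` with `π = |μ| + |R(ψ)|`. -/
theorem IsRiccatiSolution.gagliardo_le (h : Admissible b β σ K)
    (hψ : IsRiccatiSolution β σ K μ ψ) (hT : 0 < T) (hη : 0 < η) (hp : 1 ≤ p) :
    gagliardo ψ η p T ≤ (μ.totalVar T + ∫⁻ s in Icc 0 T, ‖riccatiR β σ (ψ s)‖ₑ) ^ p *
      (gagliardo (diagKernel K) η p T + ENNReal.ofReal (2 / (η * p)) *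
        ∫⁻ t in Icc 0 T, ENNReal.ofReal (t ^ (-(η * p))) * ‖diagKernel K t‖ₑ ^ p) := by
  have hp0 : 0 < p := by linarith
  obtain ⟨ν, v, hd, he⟩ := hψ.exists_ae_eq h hT
  have := hd.finite
  have hD := h.integrableOn_diagKernel hT
  have hv : IntegrableOn v (Icc 0 T) ν := hd.integrable.integrableOn
  have hR : IntegrableOn (fun s => riccatiR β σ (ψ s)) (Icc 0 T) :=
    integrable_riccatiR (hψ.memL2Loc T hT)
  have hF := stronglyMeasurable_indicator_diagKernel h.continuousOn T
  set F := (Ioc 0 T).indicator (diagKernel K) with hFdef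
  set π₁ := ν.withDensity fun r => ‖(Ico 0 T).indicator v r‖ₑ with hπ₁
  set π₂ := volume.withDensity fun r =>
    ‖(Ico 0 T).indicator (fun s => riccatiR β σ (ψ s)) r‖ₑ with hπ₂
  have hπ : ∀ᵐ r ∂(π₁ + π₂), 0 ≤ r := by
    rw [ae_add_measure_iff]
    exact ⟨ae_withDensity_indicator_Ico _ _, ae_withDensity_indicator_Ico _ _⟩
  have hmass : (π₁ + π₂) univ ≤ μ.totalVar T + ∫⁻ s in Icc 0 T, ‖riccatiR β σ (ψ s)‖ₑ := by
    rw [Measure.add_apply, hd.totalVar_eq]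
    exact add_le_add (withDensity_indicator_Ico_univ _ _) (withDensity_indicator_Ico_univ _ _)
  have hincr : ∀ᵐ t ∂(volume.restrict (Icc 0 T)), ∀ᵐ s ∂(volume.restrict (Icc 0 T)),
      ‖ψ t - ψ s‖ₑ ≤ ∫⁻ r, ‖F (t - r) - F (s - r)‖ₑ ∂(π₁ + π₂) := by
    filter_upwards [he, enorm_vconv_sub_le (applyB m) hD hv,
      enorm_vconv_sub_le (applyB m) hD hR] with t e1 f1 g1
    filter_upwards [he, f1, g1] with s e2 f2 g2
    have hΦ : Measurable fun r => ‖F (t - r) - F (s - r)‖ₑ :=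
      ((hF.comp_measurable (measurable_const.sub measurable_id)).sub
        (hF.comp_measurable (measurable_const.sub measurable_id))).enorm
    rw [lintegral_add_measure, hπ₁, hπ₂,
      ← lintegral_mul_enorm_eq_withDensity (aestronglyMeasurable_indicator_Ico hv.1) hΦ,
      ← lintegral_mul_enorm_eq_withDensity (aestronglyMeasurable_indicator_Ico hR.1) hΦ, e1, e2,
      add_sub_add_comm]
    refine (enorm_add_le _ _).trans (add_le_add (f2.trans ?_) (g2.trans ?_)) <;>
    exact (mul_le_mul_left enorm_applyB_le _).trans (one_mul _).le
  calc gagliardo ψ η p T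
      ≤ ∫⁻ t in Icc 0 T, ∫⁻ s in Icc 0 T, (∫⁻ r, ‖F (t - r) - F (s - r)‖ₑ ∂(π₁ + π₂)) ^ p /
          ENNReal.ofReal (|t - s| ^ (1 + η * p)) := by
        refine lintegral_mono_ae ?_
        filter_upwards [hincr] with t ht
        refine lintegral_mono_ae ?_
        filter_upwards [ht] with s hs
        exact ENNReal.div_le_div_right (ENNReal.rpow_le_rpow hs hp0.le) _
    _ ≤ (π₁ + π₂) univ ^ p * ∫⁻ x in Iic T, ∫⁻ y in Iic T, gagIntegrand F η p x y :=
        gagliardo_conv_le hF hπ hp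
    _ ≤ _ := mul_le_mul' (ENNReal.rpow_le_rpow hmass hp0.le)
        (lintegral_gagIntegrand_indicator_le hF hη hp0)

theorem lintegral_enorm_riccatiR_le (ψ : ℝ → Cvec m) :
    ∫⁻ s in Icc 0 T, ‖riccatiR β σ (ψ s)‖ₑ ≤ ENNReal.ofReal (‖realMat β.transpose‖ * T) +
      ENNReal.ofReal (‖realMat β.transpose‖ + ∑ i, σ i ^ 2 / 2) * lpNorm ψ 2 T ^ 2 := by
  set a := ‖realMat β.transpose‖ with ha
  set c := ∑ i, σ i ^ 2 / 2 with hc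
  have ha0 : 0 ≤ a := norm_nonneg _
  have hc0 : 0 ≤ c := Finset.sum_nonneg fun i _ => by positivity
  have e : lpNorm ψ 2 T ^ 2 = ∫⁻ t in Icc 0 T, ‖ψ t‖ₑ ^ (2 : ℝ) := by
    rw [lpNorm_eq _ zero_lt_two, ← ENNReal.rpow_natCast, ← ENNReal.rpow_mul]
    norm_num
  calc ∫⁻ s in Icc 0 T, ‖riccatiR β σ (ψ s)‖ₑ
      ≤ ∫⁻ s in Icc 0 T, (ENNReal.ofReal a + ENNReal.ofReal (a + c) * ‖ψ s‖ₑ ^ (2 : ℝ)) := by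
        refine lintegral_mono fun s => ?_
        rw [← ofReal_norm, ← ofReal_norm, ENNReal.ofReal_rpow_of_nonneg (norm_nonneg _) zero_le_two,
          ← ENNReal.ofReal_mul (by positivity), ← ENNReal.ofReal_add ha0 (by positivity)]
        refine ENNReal.ofReal_le_ofReal ((norm_riccatiR_le _).trans ?_)
        rw [Real.rpow_two]
        nlinarith [mul_nonneg ha0 (sq_nonneg (‖ψ s‖ - 1)), mul_nonneg ha0 (sq_nonneg ‖ψ s‖)]
    _ = _ := by
        rw [lintegral_add_left measurable_const, lintegral_const_mul' _ _ ENNReal.ofReal_ne_top,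
          lintegral_const, Measure.restrict_apply_univ, Real.volume_Icc, sub_zero,
          ← ENNReal.ofReal_mul ha0, e]

/-- The constant in the fractional Sobolev bound. -/
def sobolevConst (β : Matrix (Fin m) (Fin m) ℝ) (σ : Fin m → ℝ) (η p T : ℝ) : ℝ≥0∞ :=
  (1 + ENNReal.ofReal (2 / (η * p))) ^ (1 / p) *
    (1 + ENNReal.ofReal (‖realMat β.transpose‖ * T) +
      ENNReal.ofReal (‖realMat β.transpose‖ + ∑ i, σ i ^ 2 / 2))

theorem sobolevConst_lt_top (hp : 0 < p) : sobolevConst β σ η p T < ⊤ := by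
  refine ENNReal.mul_lt_top (ENNReal.rpow_lt_top_of_nonneg (by positivity) (by simp)) ?_
  exact ENNReal.add_lt_top.2 ⟨ENNReal.add_lt_top.2 ⟨ENNReal.one_lt_top, ENNReal.ofReal_lt_top⟩,
    ENNReal.ofReal_lt_top⟩

theorem IsRiccatiSolution.sobolevNorm_le (h : Admissible b β σ K)
    (hψ : IsRiccatiSolution β σ K μ ψ) (hT : 0 < T) (hη : 0 < η) (hp : 1 ≤ p) :
    sobolevNorm ψ η p T ≤ lpNorm ψ p T + sobolevConst β σ η p T *
      (1 + kernelBracket (diagKernel K) η p T) * (1 + μ.totalVar T + lpNorm ψ 2 T ^ 2) := by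
  have hp0 : 0 < p := by linarith
  set c₀ := 1 + ENNReal.ofReal (2 / (η * p)) with hc₀
  set α := ENNReal.ofReal (‖realMat β.transpose‖ * T) with hα
  set γ := ENNReal.ofReal (‖realMat β.transpose‖ + ∑ i, σ i ^ 2 / 2) with hγ
  set X := 1 + μ.totalVar T + lpNorm ψ 2 T ^ 2 with hX
  have hmass : μ.totalVar T + ∫⁻ s in Icc 0 T, ‖riccatiR β σ (ψ s)‖ₑ ≤ (1 + α + γ) * X := by
    have h1 : μ.totalVar T ≤ 1 * X := by
      rw [one_mul, hX, add_right_comm]; exact le_add_self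
    have h2 : α ≤ α * X := le_mul_of_one_le_right zero_le (by
      rw [hX, add_assoc]; exact le_self_add)
    have h3 : γ * lpNorm ψ 2 T ^ 2 ≤ γ * X := mul_le_mul_right le_add_self _
    calc _ ≤ 1 * X + (α * X + γ * X) :=
          add_le_add h1 ((lintegral_enorm_riccatiR_le ψ).trans (add_le_add h2 h3))
      _ = _ := by ring
  have hgag : gagliardo ψ η p T ^ (1 / p) ≤
      ((1 + α + γ) * X) * (c₀ ^ (1 / p) * kernelBracket (diagKernel K) η p T) := by
    have h1 := hψ.gagliardo_le h hT hη hp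
    set G := gagliardo (diagKernel K) η p T with hG
    set J := ∫⁻ t in Icc 0 T, ENNReal.ofReal (t ^ (-(η * p))) * ‖diagKernel K t‖ₑ ^ p with hJ
    have h2 : G + ENNReal.ofReal (2 / (η * p)) * J ≤ c₀ * (J + G) := by
      have : c₀ * (J + G) = G + ENNReal.ofReal (2 / (η * p)) * J +
          (J + ENNReal.ofReal (2 / (η * p)) * G) := by rw [hc₀]; ring
      rw [this]
      exact le_self_add
    calc gagliardo ψ η p T ^ (1 / p) ≤ (((1 + α + γ) * X) ^ p * (c₀ * (J + G))) ^ (1 / p) :=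
          ENNReal.rpow_le_rpow (h1.trans (mul_le_mul' (ENNReal.rpow_le_rpow hmass hp0.le) h2))
            (by positivity)
      _ = _ := by
          rw [ENNReal.mul_rpow_of_nonneg _ _ (by positivity), ← ENNReal.rpow_mul,
            mul_one_div_cancel hp0.ne', ENNReal.rpow_one,
            ENNReal.mul_rpow_of_nonneg _ _ (by positivity)]
          rfl
  calc sobolevNorm ψ η p T
      ≤ (∫⁻ t in Icc 0 T, ‖ψ t‖ₑ ^ p) ^ (1 / p) + gagliardo ψ η p T ^ (1 / p) :=
        ENNReal.rpow_add_le_add_rpow _ _ (by positivity) ((div_le_one hp0).2 hp)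
    _ ≤ lpNorm ψ p T +
        ((1 + α + γ) * X) * (c₀ ^ (1 / p) * kernelBracket (diagKernel K) η p T) := by
        rw [lpNorm_eq _ hp0]
        exact add_le_add le_rfl hgag
    _ = lpNorm ψ p T + sobolevConst β σ η p T * kernelBracket (diagKernel K) η p T * X := by
        rw [sobolevConst]
        ring
    _ ≤ _ := by
        refine add_le_add le_rfl (mul_le_mul_left (mul_le_mul_right le_add_self _) _)

end Sobolev

/-! ### Continuity -/

section Holder

variable {V : Type*} [NormedAddCommGroup V] [NormedSpace ℝ V] {T : ℝ}

/-- Hölder's inequality for a convolution, at every point. -/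
theorem lconv_le_holder {k w : ℝ → ℝ≥0∞} {p q : ℝ} (hpq : p.HolderConjugate q)
    (hk : AEMeasurable k (volume.restrict (Icc 0 T)))
    (hw : AEMeasurable w (volume.restrict (Icc 0 T))) {t : ℝ} (ht : t ≤ T) :
    lconv k w volume t ≤
      (∫⁻ s in Icc 0 T, k s ^ p) ^ (1 / p) * (∫⁻ s in Icc 0 T, w s ^ q) ^ (1 / q) := by
  have hK := aemeasurable_indicator_Ioc hk
  have hW := aemeasurable_indicator_Ico hw
  have hKt : AEMeasurable fun s => (Ioc 0 T).indicator k (t - s) :=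
    hK.comp_quasiMeasurePreserving (quasiMeasurePreserving_sub_left volume t)
  have hpow : ∀ (f : ℝ → ℝ≥0∞) (r : ℝ) (_ : 0 < r) (S : Set ℝ) (_ : MeasurableSet S)
      (_ : S ⊆ Icc 0 T), ∫⁻ s, S.indicator f s ^ r ≤ ∫⁻ s in Icc 0 T, f s ^ r := by
    intro f r hr S hS hST
    calc ∫⁻ s, S.indicator f s ^ r = ∫⁻ s, S.indicator (fun s => f s ^ r) s := by
          refine lintegral_congr fun s => ?_
          by_cases hs : s ∈ S
          · simp only [indicator_of_mem hs]
          · simp only [indicator_of_notMem hs, ENNReal.zero_rpow_of_pos hr]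
      _ = ∫⁻ s in S, f s ^ r := lintegral_indicator hS _
      _ ≤ _ := lintegral_mono_set hST
  rw [lconv_eq_indicator k w volume ht]
  refine (ENNReal.lintegral_mul_le_Lp_mul_Lq volume hpq hKt hW).trans (mul_le_mul' ?_ ?_)
  · refine ENNReal.rpow_le_rpow ?_ (one_div_nonneg.2 hpq.nonneg)
    rw [lintegral_sub_left_eq_self (fun s => (Ioc 0 T).indicator k s ^ p) t]
    exact hpow k p hpq.pos _ measurableSet_Ioc Ioc_subset_Icc_self
  · refine ENNReal.rpow_le_rpow ?_ (one_div_nonneg.2 hpq.symm.nonneg)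
    exact hpow w q hpq.symm.pos _ measurableSet_Ico Ico_subset_Icc_self

theorem integrableOn_conv_of_lconv_lt_top {k : ℝ → ℝ} {g : ℝ → V}
    (hk : AEStronglyMeasurable k (volume.restrict (Icc 0 T)))
    (hg : AEStronglyMeasurable g (volume.restrict (Icc 0 T))) {t : ℝ} (ht : t ≤ T)
    (h : lconv (fun s => ‖k s‖ₑ) (fun s => ‖g s‖ₑ) volume t < ⊤) :
    IntegrableOn (fun s => smulB V (k (t - s)) (g s)) (Ico 0 t) := by
  refine ⟨?_, ?_⟩
  · have h1 : AEStronglyMeasurable fun s =>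
        smulB V ((Ioc 0 T).indicator k (t - s)) ((Ico 0 T).indicator g s) :=
      ((aestronglyMeasurable_indicator_Ioc hk).comp_quasiMeasurePreserving
        (quasiMeasurePreserving_sub_left volume t)).smul (aestronglyMeasurable_indicator_Ico hg)
    rw [← aestronglyMeasurable_indicator_iff measurableSet_Ico]
    exact h1.congr (.of_forall fun s => (indicator_conv_integrand (smulB V) k g ht s).symm)
  · refine lt_of_le_of_lt (lintegral_mono fun s => ?_) h
    simp only [ContinuousLinearMap.lsmul_apply]
    exact enorm_smul_le

/-- The convolution of kernels `k ∈ L^p` and functions `g ∈ L^q`, `1/p + 1/q = 1`, is continuous: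
it is the uniform limit of the convolutions with the bounded kernels `min(k, n)`. -/
theorem continuousOn_vconv_of_holder {k : ℝ → ℝ} {g : ℝ → V} {p q : ℝ}
    (hpq : p.HolderConjugate q) (hkc : ContinuousOn k (Ioi 0)) (hk0 : ∀ t, 0 < t → 0 ≤ k t)
    (hkm : AEStronglyMeasurable k (volume.restrict (Icc 0 T)))
    (hkp : ∫⁻ s in Icc 0 T, ‖k s‖ₑ ^ p ≠ ⊤)
    (hg : IntegrableOn g (Icc 0 T)) (hgq : ∫⁻ s in Icc 0 T, ‖g s‖ₑ ^ q ≠ ⊤) :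
    ContinuousOn (vconv (smulB V) k g volume) (Iic T) := by
  set kn : ℕ → ℝ → ℝ := fun n t => min (k t) n with hkn
  have hknm : ∀ n, AEStronglyMeasurable (kn n) (volume.restrict (Icc 0 T)) := fun n =>
    hkm.inf aestronglyMeasurable_const
  have hdm : ∀ n, AEStronglyMeasurable (fun s => k s - kn n s) (volume.restrict (Icc 0 T)) :=
    fun n => hkm.sub (hknm n)
  have hnn : ∀ n : ℕ, (0 : ℝ) ≤ n := fun n => n.cast_nonneg
  set G := (∫⁻ s in Icc 0 T, ‖g s‖ₑ ^ q) ^ (1 / q) with hG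
  have hGt : G ≠ ⊤ := ENNReal.rpow_ne_top_of_nonneg (one_div_nonneg.2 hpq.symm.nonneg) hgq
  have hdle : ∀ n s, 0 < s → ‖k s - kn n s‖ₑ ≤ ‖k s‖ₑ := fun n s hs => by
    rw [← ofReal_norm, ← ofReal_norm]
    refine ENNReal.ofReal_le_ofReal ?_
    have h1 := hk0 s hs
    have h2 : 0 ≤ kn n s := le_min h1 (hnn n)
    have h3 : kn n s ≤ k s := min_le_left _ _
    rw [Real.norm_of_nonneg h1, Real.norm_of_nonneg (by linarith)]
    linarith
  have hlim : Filter.Tendsto (fun n => (∫⁻ s in Icc 0 T, ‖k s - kn n s‖ₑ ^ p) ^ (1 / p) * G)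
      Filter.atTop (nhds 0) := by
    have h1 : Filter.Tendsto (fun n => ∫⁻ s in Icc 0 T, ‖k s - kn n s‖ₑ ^ p) Filter.atTop
        (nhds (∫⁻ s in Icc 0 T, 0)) := by
      refine tendsto_lintegral_of_dominated_convergence' (fun s => ‖k s‖ₑ ^ p)
        (fun n => (hdm n).enorm.pow_const p) (fun n => ?_) hkp ?_
      · filter_upwards [ae_pos_restrict_Icc T] with s hs
        exact ENNReal.rpow_le_rpow (hdle n s hs) hpq.nonneg
      · refine .of_forall fun s => ?_
        obtain ⟨N, hN⟩ := exists_nat_ge (k s)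
        refine tendsto_const_nhds.congr' ?_
        filter_upwards [Filter.eventually_ge_atTop N] with n hn
        have : kn n s = k s := min_eq_left (hN.trans (by exact_mod_cast hn))
        rw [this, sub_self, enorm_zero, ENNReal.zero_rpow_of_pos hpq.pos]
    rw [lintegral_zero] at h1
    have h2 := ((ENNReal.continuous_rpow_const (y := 1 / p)).tendsto 0).comp h1
    rw [ENNReal.zero_rpow_of_pos (one_div_pos.2 hpq.pos)] at h2
    simpa using ENNReal.Tendsto.mul_const h2 (Or.inr hGt)
  have hbound : ∀ n, ∀ t ≤ T, edist (vconv (smulB V) k g volume t)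
      (vconv (smulB V) (kn n) g volume t) ≤
      (∫⁻ s in Icc 0 T, ‖k s - kn n s‖ₑ ^ p) ^ (1 / p) * G := by
    intro n t ht
    have hfin : ∀ f : ℝ → ℝ, AEStronglyMeasurable f (volume.restrict (Icc 0 T)) →
        (∀ s, 0 < s → ‖f s‖ₑ ≤ ‖k s‖ₑ) →
        lconv (fun s => ‖f s‖ₑ) (fun s => ‖g s‖ₑ) volume t < ⊤ := fun f hf hfk => by
      refine (lconv_le_holder hpq hf.enorm hg.aestronglyMeasurable.enorm ht).trans_lt ?_
      refine ENNReal.mul_lt_top (ENNReal.rpow_lt_top_of_nonneg (one_div_nonneg.2 hpq.nonneg)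
        (ne_top_of_le_ne_top hkp (lintegral_mono_ae ?_))) hGt.lt_top
      filter_upwards [ae_pos_restrict_Icc T] with s hs
      exact ENNReal.rpow_le_rpow (hfk s hs) hpq.nonneg
    have i1 := integrableOn_conv_of_lconv_lt_top hkm hg.aestronglyMeasurable ht
      (hfin k hkm fun s _ => le_rfl)
    have i2 := integrableOn_conv_of_lconv_lt_top (hknm n) hg.aestronglyMeasurable ht
      (hfin (kn n) (hknm n) fun s hs => by
        rw [← ofReal_norm, ← ofReal_norm]
        refine ENNReal.ofReal_le_ofReal ?_
        rw [Real.norm_of_nonneg (hk0 s hs), Real.norm_of_nonneg (le_min (hk0 s hs) (hnn n))]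
        exact min_le_left _ _)
    have e : vconv (smulB V) k g volume t - vconv (smulB V) (kn n) g volume t =
        vconv (smulB V) (fun s => k s - kn n s) g volume t := by
      simp only [vconv, map_sub, sub_apply]
      exact (integral_sub i1 i2).symm
    rw [edist_eq_enorm_sub, e]
    refine (enorm_vconv_le _ _ _ _ _).trans ((mul_le_mul_left (enorm_smulB_le V) _).trans ?_)
    rw [one_mul]
    exact lconv_le_holder hpq (hdm n).enorm hg.aestronglyMeasurable.enorm ht
  have hunif : TendstoUniformlyOn (fun n => vconv (smulB V) (kn n) g volume)
      (vconv (smulB V) k g volume) Filter.atTop (Iic T) := by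
    rw [EMetric.tendstoUniformlyOn_iff]
    intro ε hε
    filter_upwards [hlim.eventually_lt_const hε] with n hn t ht
    exact (hbound n t ht).trans_lt hn
  refine hunif.continuousOn (.of_forall fun n t _ => ?_)
  refine continuousWithinAt_vconv (C := n) (hkc.inf continuousOn_const) (fun s hs => ?_) hg
  rw [abs_of_nonneg (le_min (hk0 s hs) (hnn n))]
  exact min_le_right _ _

end Holder

section Continuity

variable {m : ℕ} {b : Fin m → ℝ} {β : Matrix (Fin m) (Fin m) ℝ} {σ : Fin m → ℝ}
  {K : Fin m → ℝ → ℝ} {μ : LocFinMeasure m} {η p T : ℝ} {ψ : ℝ → Cvec m}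

theorem norm_coord_diagKernel_le (K : Fin m → ℝ → ℝ) (i : Fin m) (t : ℝ) :
    ‖K i t‖ ≤ ‖diagKernel K t‖ := by
  have h := (diagKernel K t).le_opNorm (EuclideanSpace.single i 1)
  have h2 := PiLp.norm_apply_le (diagKernel K t (EuclideanSpace.single i 1)) i
  rw [diagKernel_apply] at h2
  simpa using h2.trans h

theorem lintegral_riccatiR_rpow_ne_top (hψ : MemLp ψ 3 (volume.restrict (Icc 0 T))) :
    ∫⁻ s in Icc 0 T, ‖riccatiR β σ (ψ s)‖ₑ ^ (3 / 2 : ℝ) ≠ ⊤ := by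
  set c := ‖realMat β.transpose‖ + ∑ i, σ i ^ 2 / 2 with hc
  have hc0 : 0 ≤ ∑ i, σ i ^ 2 / 2 := Finset.sum_nonneg fun i _ => by positivity
  have ha0 := norm_nonneg (realMat β.transpose)
  have h1 : MemLp (fun s => 1 + ‖ψ s‖) 3 (volume.restrict (Icc 0 T)) := memLp_const_add 1 hψ.norm
  have h2 := (eLpNorm_lt_top_iff_lintegral_rpow_enorm_lt_top (by simp) (by simp)).1 h1.2
  have hle : ∀ s, ‖riccatiR β σ (ψ s)‖ₑ ^ (3 / 2 : ℝ) ≤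
      ENNReal.ofReal (c ^ (3 / 2 : ℝ)) * ‖1 + ‖ψ s‖‖ₑ ^ (3 : ℝ) := fun s => by
    have h3 : 0 ≤ 1 + ‖ψ s‖ := by positivity
    rw [← ofReal_norm, ← ofReal_norm, Real.norm_of_nonneg h3,
      ENNReal.ofReal_rpow_of_nonneg (norm_nonneg _) (by norm_num),
      ENNReal.ofReal_rpow_of_nonneg h3 (by norm_num), ← ENNReal.ofReal_mul (by positivity)]
    refine ENNReal.ofReal_le_ofReal ?_
    have h4 : ‖riccatiR β σ (ψ s)‖ ≤ c * (1 + ‖ψ s‖) ^ (2 : ℝ) := by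
      refine (norm_riccatiR_le _).trans ?_
      rw [Real.rpow_two, hc]
      have h5 := norm_nonneg (ψ s)
      nlinarith [mul_nonneg ha0 h5, mul_nonneg ha0 (mul_nonneg h5 h5), mul_nonneg hc0 h5]
    calc ‖riccatiR β σ (ψ s)‖ ^ (3 / 2 : ℝ) ≤ (c * (1 + ‖ψ s‖) ^ (2 : ℝ)) ^ (3 / 2 : ℝ) :=
          Real.rpow_le_rpow (norm_nonneg _) h4 (by norm_num)
      _ = _ := by
        rw [Real.mul_rpow (by positivity) (by positivity), ← Real.rpow_mul h3]
        norm_num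
  refine ne_top_of_le_ne_top ?_ (lintegral_mono hle)
  rw [lintegral_const_mul' _ _ ENNReal.ofReal_ne_top]
  refine ENNReal.mul_ne_top ENNReal.ofReal_ne_top ?_
  simpa using h2.ne

theorem IsRiccatiSolution.continuousWithinAt (h : Admissible b β σ K)
    (hψ : IsRiccatiSolution β σ K μ ψ) (hη : 0 < η) (hp : 3 ≤ p)
    (hbr : ∀ T : ℝ, 0 < T → kernelBracket (diagKernel K) η p T < ⊤) {t₀ : ℝ} (ht₀ : 0 ≤ t₀)
    (hc : ContinuousWithinAt (convMeasure K μ) (Ici 0) t₀) :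
    ContinuousWithinAt ψ (Ici 0) t₀ := by
  set T := t₀ + 1 with hTdef
  have hT : 0 < T := by positivity
  have h3p : (3 : ℝ≥0∞) ≤ ENNReal.ofReal p := by simpa using hp
  have hD : MemLp (diagKernel K) 3 (volume.restrict (Icc 0 T)) :=
    (memLp_of_kernelBracket_lt_top (h.integrableOn_diagKernel hT).aestronglyMeasurable hη
      (by linarith) (hbr T hT)).mono_exponent h3p
  have hψ3 : MemLp ψ 3 (volume.restrict (Icc 0 T)) :=
    (hψ.memLp h hT hη (by linarith) (hbr T hT)).mono_exponent h3p
  have hR : IntegrableOn (fun s => riccatiR β σ (ψ s)) (Icc 0 T) :=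
    integrable_riccatiR (hψ.memL2Loc T hT)
  have hRq := lintegral_riccatiR_rpow_ne_top (β := β) (σ := σ) hψ3
  have hconv : ∀ i, ContinuousOn (vconv (smulB ℂ) (K i) (fun s => riccatiR β σ (ψ s) i) volume)
      (Iic T) := fun i => by
    refine continuousOn_vconv_of_holder (p := 3) (q := 3 / 2)
      (Real.holderConjugate_iff.2 ⟨by norm_num, by norm_num⟩) (h.continuousOn i)
      (fun t ht => h.kernel_nonneg i ht) (h.K_memL2Loc i T hT).1 ?_ (integrableOn_coord hR i) ?_
    · have h2 := (eLpNorm_lt_top_iff_lintegral_rpow_enorm_lt_top (by simp) (by simp)).1 hD.2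
      refine ne_top_of_le_ne_top h2.ne (lintegral_mono fun s => ?_)
      simp only [ENNReal.toReal_ofNat]
      refine ENNReal.rpow_le_rpow ?_ (by norm_num)
      exact enorm_le_iff_norm_le.2 (norm_coord_diagKernel_le K i s)
    · refine ne_top_of_le_ne_top hRq (lintegral_mono fun s => ?_)
      refine ENNReal.rpow_le_rpow ?_ (by norm_num)
      exact enorm_le_iff_norm_le.2 (PiLp.norm_apply_le _ i)
  have hfun : ContinuousWithinAt (convFun K fun s => riccatiR β σ (ψ s)) (Ici 0) t₀ := by
    have h1 : ContinuousWithinAt (fun t => WithLp.toLp 2 fun i =>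
        vconv (smulB ℂ) (K i) (fun s => riccatiR β σ (ψ s) i) volume t : ℝ → Cvec m)
        (Ici 0) t₀ := by
      refine (PiLp.continuous_toLp 2 fun _ : Fin m => ℂ).continuousAt.comp_continuousWithinAt
        (continuousWithinAt_pi.2 fun i => ?_)
      exact ((hconv i).continuousAt (Iic_mem_nhds (by linarith))).continuousWithinAt
    refine h1.congr (fun t ht => ?_) ?_
    · ext i
      exact convFun_apply _ ht i
    · ext i
      exact convFun_apply _ ht₀ i
  exact (hc.add hfun).congr (fun t ht => hψ.eq_rhs t ht) (hψ.eq_rhs t₀ ht₀)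

end Continuity

end VolterraRiccati

end

theorem theorem3p5 {m : ℕ} (β : Matrix (Fin m) (Fin m) ℝ) (σ : Fin m → ℝ)
    (p η : ℝ) (hp : 2 ≤ p) (hη0 : 0 < η) (hη1 : η < 1) :
    (∀ (b : Fin m → ℝ) (K : Fin m → ℝ → ℝ), VolterraRiccati.Admissible b β σ K →
      (∀ T : ℝ, 0 < T →
        VolterraRiccati.kernelBracket (VolterraRiccati.diagKernel K) η p T < ⊤) →
      -- (a) existence and uniqueness
      (∀ μ : VolterraRiccati.LocFinMeasure m, μ.ReNonpos →
        ∃ ψ : ℝ → VolterraRiccati.Cvec m, VolterraRiccati.IsRiccatiSolution β σ K μ ψ ∧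
          ∀ φ : ℝ → VolterraRiccati.Cvec m, VolterraRiccati.MemL2Loc φ →
            (∀ᵐ t ∂(volume.restrict (Ici (0 : ℝ))),
              φ t = VolterraRiccati.riccatiRHS β σ K μ φ t) →
            φ =ᵐ[volume.restrict (Ici (0 : ℝ))] ψ) ∧
      -- (b) bounds in L^q
      (∀ μ : VolterraRiccati.LocFinMeasure m, μ.ReNonpos →
        ∀ ψ : ℝ → VolterraRiccati.Cvec m, VolterraRiccati.IsRiccatiSolution β σ K μ ψ →
        ∀ T q : ℝ, 0 < T → 1 ≤ q → q ≤ p →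
        ∀ E : ℝ → VolterraRiccati.Cmat m,
          E = VolterraRiccati.kernelE (VolterraRiccati.diagKernel K)
            (VolterraRiccati.realMat β.transpose) →
          VolterraRiccati.lpNorm ψ q T ≤
              2 * μ.totalVar T * VolterraRiccati.lpNorm E q T +
                ENNReal.ofReal (∑ i, σ i ^ 2 / 2) * μ.totalVar T ^ 2 *
                  VolterraRiccati.lpNorm E q T * VolterraRiccati.lpNorm E 2 T ^ 2 ∧
          (μ.ImZero →
            VolterraRiccati.lpNorm ψ q T ≤ μ.totalVar T * VolterraRiccati.lpNorm E q T)) ∧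
      -- (c) continuity
      (3 ≤ p → ∀ μ : VolterraRiccati.LocFinMeasure m, μ.ReNonpos →
        ∀ ψ : ℝ → VolterraRiccati.Cvec m, VolterraRiccati.IsRiccatiSolution β σ K μ ψ →
        ∀ t₀ : ℝ, 0 ≤ t₀ →
          ContinuousWithinAt (VolterraRiccati.convMeasure K μ) (Ici 0) t₀ →
          ContinuousWithinAt ψ (Ici 0) t₀)) ∧
    -- (b) bound in W^{η,p}; the constant depends only on `m`, `β`, `σ`, `p`, `η`, `T`
    (∀ T : ℝ, 0 < T → ∃ C : ℝ≥0,
      ∀ (b : Fin m → ℝ) (K : Fin m → ℝ → ℝ), VolterraRiccati.Admissible b β σ K →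
      (∀ T' : ℝ, 0 < T' →
        VolterraRiccati.kernelBracket (VolterraRiccati.diagKernel K) η p T' < ⊤) →
      ∀ μ : VolterraRiccati.LocFinMeasure m, μ.ReNonpos →
      ∀ ψ : ℝ → VolterraRiccati.Cvec m, VolterraRiccati.IsRiccatiSolution β σ K μ ψ →
        VolterraRiccati.sobolevNorm ψ η p T < ⊤ ∧
        VolterraRiccati.sobolevNorm ψ η p T ≤ VolterraRiccati.lpNorm ψ p T +
          C * (1 + VolterraRiccati.kernelBracket (VolterraRiccati.diagKernel K) η p T) *
            (1 + μ.totalVar T + VolterraRiccati.lpNorm ψ 2 T ^ 2)) := by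
  refine ⟨fun b K h hbr => ⟨fun μ hμ => ?_, fun μ _ ψ hψ T q hT hq _ E hE => ?_,
    fun hp3 μ _ ψ hψ t₀ ht₀ hc => hψ.continuousWithinAt h hη0 hp3 hbr ht₀ hc⟩, fun T hT => ?_⟩
  · obtain ⟨ψ, hψ⟩ := h.exists_isRiccatiSolution hμ
    exact ⟨ψ, hψ, fun φ hφ2 hφ => h.riccati_unique hψ hφ2 hφ⟩
  -- the bound stated for real `μ` holds for all `μ`, and implies the other one
  · have hle := hψ.lpNorm_le h hT hq
    rw [← hE] at hle
    refine ⟨hle.trans (le_add_right ?_), fun _ => hle⟩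
    rw [mul_assoc]
    exact le_mul_of_one_le_left zero_le one_le_two
  · have hC : VolterraRiccati.sobolevConst β σ η p T < ⊤ :=
      VolterraRiccati.sobolevConst_lt_top (by linarith)
    refine ⟨(VolterraRiccati.sobolevConst β σ η p T).toNNReal, fun b K h hbr μ _ ψ hψ => ?_⟩
    rw [ENNReal.coe_toNNReal hC.ne]
    have hle := hψ.sobolevNorm_le h hT hη0 (p := p) (by linarith)
    refine ⟨hle.trans_lt ?_, hle⟩
    have hψp : VolterraRiccati.lpNorm ψ p T < ⊤ :=
      (hψ.memLp h hT hη0 (by linarith) (hbr T hT)).2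
    have hψ2 : VolterraRiccati.lpNorm ψ 2 T < ⊤ := by
      have := (hψ.memL2Loc T hT).2
      simpa [VolterraRiccati.lpNorm] using this
    obtain ⟨ν, v, hd⟩ := μ.exists_isDensity T
    have hμT : μ.totalVar T < ⊤ := by
      rw [hd.totalVar_eq]
      exact hd.integrable.integrableOn.2
    exact ENNReal.add_lt_top.2 ⟨hψp, ENNReal.mul_lt_top
      (ENNReal.mul_lt_top hC (ENNReal.add_lt_top.2 ⟨ENNReal.one_lt_top, hbr T hT⟩))
      (ENNReal.add_lt_top.2 ⟨ENNReal.add_lt_top.2 ⟨ENNReal.one_lt_top, hμT⟩,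
        ENNReal.pow_lt_top hψ2⟩)⟩
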